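/- Let $\rho(x)=(1+|x|)^{-1/2}$, $\eta=1/(3\cdot 2^{20}\sqrt2)$, $(t)_+=\max\{t,0\}$, and let $\mathbb D$ be the set of continuous even functions $f:\mathbb R\to\mathbb R$ with $\|\rho f\|_{L^\infty}<\infty$ such that $f(0)=1$, $(1-x^2)_+\le f(x)\le 1$ for all $x$, $f$ is non-increasing on $[0,\infty)$, $s\mapsto f(\sqrt s)$ is convex on $[0,\infty)$, and the left derivative satisfies $f'_-(1/2)\le-\eta$. For $f\in\mathbb D$ put $f(+\infty)=\lim_{x\to+\infty}f(x)$, $$b(f)=\frac2\pi\int_0^\infty\big(f(y)-f(+\infty)\big)\,dy,\qquad c(f)=\frac2\pi\int_0^\infty\frac{f(0)-f(y)}{y^2}\,dy,$$ $$T(f)(x)=\frac1\pi\int_0^\infty f(y)\Big(\frac yx\ln\Big|\frac{x+y}{x-y}\Big|-2\Big)dy\quad(x\ne0),\qquad T(f)(0)=0.$$ For $a\le1$ put $T_a(f)=\Big(1+\frac{2a\,T(f)}{(1-a/3)c(f)}\Big)_+$ and $$R_a(f)(x)=T_a(f)(x)^{1/a}\exp\Big(\frac{1-a}{a}\int_0^x\frac{T_a(f)(y)-T_a(f)(0)}{y\,T_a(f)(y)}\,dy\Big)\quad(a\neq0),$$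 $$R_0(f)(x)=\exp\Big(\frac{2}{c(f)}\Big(T(f)(x)+\int_0^x\frac{T(f)(y)}{y}\,dy\Big)\Big),$$ where, for $a>0$, $R_a(f)(x)=0$ at the points $x$ with $T_a(f)(x)=0$. Finally put $$Q(f)=-\frac2\pi\int_0^\infty T(f)'(x)\,x f(x)\,dx,\qquad \mu(f)=\frac{2Q(f)}{b(f)^2},\qquad \overline\mu=\frac{9\pi^2}{64}-\frac34 .$$ **Theorem.** Let $a\le1$ and let $f\in\mathbb D$ be a fixed point of $R_a$, i.e. $R_a(f)=f$. Then the quantities above are well defined (the limit $f(+\infty)$ exists, $T(f)$ is differentiable on $(0,\infty)$, the integrals defining $b(f)$, $c(f)$ and $Q(f)$ converge absolutely), $b(f)>0$, $c(f)>0$, $1+a\mu(f)>0$, and $$\frac{b(f)}{c(f)}=\frac{1-a/3}{1+a\mu(f)},\qquad 0\le\mu(f)\le\overline\mu<1 .$$ If moreover $a\in[0,1]$, then $$\mu(f)\ \ge\ \frac{\overline\mu}{9(1-a/3)^2}\ >\ 0 .$$ -/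

import Mathlib

open Set Filter Topology MeasureTheory

noncomputable section

namespace GCLM

/-- The weight `ρ(x) = (1 + |x|)^{-1/2}`. -/
def rho (x : ℝ) : ℝ := (1 + |x|) ^ (-(1 / 2) : ℝ)

/-- The space `𝕍` of continuous even functions on `ℝ` with `‖ρ f‖_{L^∞} < ∞`. -/
def setV : Set (ℝ → ℝ) :=
  {f | Continuous f ∧ (∀ x, f (-x) = f x) ∧ BddAbove (range fun x => rho x * |f x|)}

/-- The constant `η = 1 / (3 · 2^20 · √2)`. -/
def eta : ℝ := 1 / (3 * 2 ^ 20 * Real.sqrt 2)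

/-- The set `𝔻`. The last condition is `f'_-(1/2) ≤ -η`, with `f'_-` the left derivative. -/
def setD : Set (ℝ → ℝ) :=
  {f | f ∈ setV ∧ f 0 = 1 ∧ (∀ x, max (1 - x ^ 2) 0 ≤ f x ∧ f x ≤ 1) ∧
    AntitoneOn f (Ici 0) ∧ ConvexOn ℝ (Ici 0) (fun s => f (Real.sqrt s)) ∧
    derivWithin f (Iio (1 / 2)) (1 / 2) ≤ -eta}

/-- The limit `f(+∞)`; it exists for every `f ∈ 𝔻`. -/
def atInfty (f : ℝ → ℝ) : ℝ := limUnder atTop f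

/-- `b(f) = (2/π) ∫_0^∞ (f(y) - f(+∞)) dy`. -/
def b (f : ℝ → ℝ) : ℝ := 2 / Real.pi * ∫ y in Ioi (0 : ℝ), (f y - atInfty f)

/-- `c(f) = (2/π) ∫_0^∞ (f(0) - f(y)) / y² dy`. -/
def c (f : ℝ → ℝ) : ℝ := 2 / Real.pi * ∫ y in Ioi (0 : ℝ), (f 0 - f y) / y ^ 2

/-- The linear map `T`; its kernel is extended continuously by `0` to `x = 0`,
so that `T(f)(0) = 0`. -/
def T (f : ℝ → ℝ) (x : ℝ) : ℝ :=
  if x = 0 then 0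
  else 1 / Real.pi *
    ∫ y in Ioi (0 : ℝ), f y * (y / x * Real.log |(x + y) / (x - y)| - 2)

/-- `T_a(f) = (1 + 2a T(f) / ((1 - a/3) c(f)))_+`. -/
def Ta (a : ℝ) (f : ℝ → ℝ) (x : ℝ) : ℝ :=
  max (1 + 2 * a * T f x / ((1 - a / 3) * c f)) 0

/-- The nonlinear map `R_a`. Where `T_a(f)(x) = 0` (possible only for `a > 0`), the first factor,
hence the value, is `0`. -/
def R (a : ℝ) (f : ℝ → ℝ) (x : ℝ) : ℝ :=
  if a = 0 then
    Real.exp (2 / c f * (T f x + ∫ y in (0 : ℝ)..x, T f y / y))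
  else
    Ta a f x ^ (1 / a) *
      Real.exp ((1 - a) / a * ∫ y in (0 : ℝ)..x, (Ta a f y - Ta a f 0) / (y * Ta a f y))

/-- `Q(f) = -(2/π) ∫_0^∞ T(f)'(x) · x f(x) dx`. -/
def Q (f : ℝ → ℝ) : ℝ :=
  -(2 / Real.pi) * ∫ x in Ioi (0 : ℝ), deriv (T f) x * (x * f x)

/-- `μ(f) = 2 Q(f) / b(f)²`. -/
def mu (f : ℝ → ℝ) : ℝ := 2 * Q f / b f ^ 2

/-- `μ̄ = 9π²/64 - 3/4`. -/
def muBar : ℝ := 9 * Real.pi ^ 2 / 64 - 3 / 4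

end GCLM

end

noncomputable section

namespace GCLM

/-! ### The logarithmic kernels -/

/-! Write `T f x = (1/π) ∫ f(y) k(y/x) dy` with `k = evenK - 1 + oddK`, where under `r ↦ 1/r`
`evenK` is even and nonnegative off `r = 1`, `oddK` is odd with values in `[-1, 1]`, and `oddK' =
evenK / r`. Put `I = ∫_0^∞ f` and `E = ∫∫ f(x) f(y) evenK(y/x) dy dx` (`energy`). Antisymmetry of
`oddK` gives `π ∫ T f · f = E - I²`. An integration by parts, with the dilation symmetry of the even
form, gives `π ∫ (T f)' x f = -E`. Hence `b = 2I/π`, `Q = 2E/π²` and `μ = E/I²`.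

Logarithmic differentiation of the fixed point equation yields, with `d = (1 - a/3) c(f)`, the
equation `(d + 2a T f) x f' = 2 f (x (T f)' + (1 - a) T f)`. Adding `(d + 2a T f) f`, integrating
and using the two formulas above gives `π d I = 2 I² + 2 a E` (`MemD.fixed_identity`), that is `d =
b (1 + a μ)`. Positivity of `d` and `b` makes `1 + a μ` positive.

All this presupposes that `f` is integrable (`MemD.integrableOn_of_fixed`). If the unclipped `T_a`
(`preT`) is nonpositive somewhere, `f` vanishes from there on. Otherwise, for `a < 1`, either `T f`
is bounded below, so that `f - f(+∞)` is integrable (`MemD.integral_sub_le`) and power decay forces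
`f(+∞) = 0`, or `T f` is unbounded, `a ≤ 0`, and `f` decays with an exponent above 1. For `a = 1`
the equation is affine, and a positive `preT` would turn `f - f(+∞)` into an integrable
eigenfunction of a positive kernel, which `not_eigenfunction_kerT` excludes.

Upper bound on `μ`: since `s ↦ f(√s)` is convex, decreasing and tends to 0, `f` is a limit of
positive mixtures of truncated parabolas `(s - x²)₊`. As `E` and `I²` are both quadratic, it
suffices to compare the bilinear forms on pairs of parabolas (`homForm_eparab_le`). In the ratio `r
= y/x` this is a Chebyshev inequality between the increasing `evenK` and a decreasing quotient of
correlations, with equality for equal parabolas. The constant `muBar` is the mean of `evenK` on `(0,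
1)` for the weight `3 - r²`.

Lower bound: `f ≥ (1 - x²)₊` gives `E ≥ (4/9) muBar` and `c(f) ≤ 4/π`; for `a ≥ 0` the latter and `b
≤ d` bound `I` by `2 (1 - a/3)`. -/

/-- `ln |(1 + r) / (1 - r)|`. -/
def ell (r : ℝ) : ℝ := Real.log |(1 + r) / (1 - r)|

/-- The part of the kernel of `T` that is odd under `r ↦ 1 / r`. -/
def oddK (r : ℝ) : ℝ := (r - r⁻¹) / 2 * ell r

/-- The part of the kernel of `T` that is even under `r ↦ 1 / r`, normalized to vanish at `0`. -/
def evenK (r : ℝ) : ℝ := (r + r⁻¹) / 2 * ell r - 1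

/-- The kernel of `T` as a function of the ratio of the variables. -/
def kerT (r : ℝ) : ℝ := r * ell r - 2

lemma kerT_eq (r : ℝ) : kerT r = evenK r - 1 + oddK r := by
  unfold kerT evenK oddK; ring

lemma ell_inv {r : ℝ} (hr : r ≠ 0) : ell r⁻¹ = ell r := by
  unfold ell
  have h : (1 + r⁻¹) / (1 - r⁻¹) = -((1 + r) / (1 - r)) := by
    rcases eq_or_ne r 1 with rfl | h1
    · simp
    have : r - 1 ≠ 0 := sub_ne_zero.2 h1
    have : 1 - r ≠ 0 := sub_ne_zero.2 h1.symm
    have h3 : 1 - r⁻¹ = (r - 1) / r := by field_simp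
    have h4 : 1 + r⁻¹ = (r + 1) / r := by field_simp
    rw [h3, h4]
    field_simp
    ring
  rw [h, abs_neg]

lemma oddK_inv {r : ℝ} (hr : r ≠ 0) : oddK r⁻¹ = -oddK r := by
  unfold oddK; rw [ell_inv hr, inv_inv]; ring

lemma evenK_inv {r : ℝ} (hr : r ≠ 0) : evenK r⁻¹ = evenK r := by
  unfold evenK; rw [ell_inv hr, inv_inv]; ring

lemma measurable_ell : Measurable ell := by unfold ell; fun_prop
lemma measurable_oddK : Measurable oddK := by unfold oddK; have := measurable_ell; fun_prop
lemma measurable_evenK : Measurable evenK := by unfold evenK; have := measurable_ell; fun_prop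
lemma measurable_kerT : Measurable kerT := by unfold kerT; have := measurable_ell; fun_prop

lemma ell_lower {r : ℝ} (h0 : 0 ≤ r) (h1 : r < 1) : 2 * r ≤ ell r := by
  have := Real.sum_range_le_log_div h0 h1 1
  rw [ell, Real.log_abs]
  simp at this
  linarith

lemma ell_upper {r : ℝ} (h0 : 0 ≤ r) (h1 : r < 1) : ell r ≤ 2 * r / (1 - r ^ 2) := by
  have := Real.log_div_le_sum_range_add h0 h1 0
  rw [ell, Real.log_abs]
  simp at this
  rw [mul_div_assoc]
  linarith

lemma ell_eq {r : ℝ} (h0 : 0 < r) (h1 : r ≠ 1) : ell r = Real.log (1 + r) - Real.log (r - 1) := by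
  have : 1 - r ≠ 0 := sub_ne_zero.2 h1.symm
  rw [ell, Real.log_abs, Real.log_div (by positivity) this, ← Real.log_neg_eq_log (1 - r), neg_sub]

lemma hasDerivAt_ell {r : ℝ} (h0 : 0 < r) (h1 : r ≠ 1) :
    HasDerivAt ell (2 / (1 - r ^ 2)) r := by
  have h2 : r - 1 ≠ 0 := sub_ne_zero.2 h1
  have h3 : 1 + r ≠ 0 := by positivity
  have h := (((hasDerivAt_id r).const_add 1).log h3).sub (((hasDerivAt_id r).sub_const 1).log h2)
  have h4 : 1 - r ^ 2 ≠ 0 := by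
    have : 1 - r ^ 2 = -((r - 1) * (1 + r)) := by ring
    rw [this]; exact neg_ne_zero.2 (mul_ne_zero h2 h3)
  have h5 : 2 / (1 - r ^ 2) = 1 / (1 + r) - 1 / (r - 1) := by
    field_simp
    ring
  rw [h5]
  refine h.congr_of_eventuallyEq ?_
  filter_upwards [isOpen_Ioi.mem_nhds h0, isOpen_ne.mem_nhds h1] with s hs hs1
  simp [ell_eq hs hs1]

lemma hasDerivAt_oddK {r : ℝ} (h0 : 0 < r) (h1 : r ≠ 1) :
    HasDerivAt oddK (evenK r / r) r := by
  have h2 : r - 1 ≠ 0 := sub_ne_zero.2 h1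
  have h := (((hasDerivAt_id r).sub (hasDerivAt_inv h0.ne')).div_const 2).mul (hasDerivAt_ell h0 h1)
  have h4 : 1 - r ^ 2 ≠ 0 := by
    have : 1 - r ^ 2 = -((r - 1) * (1 + r)) := by ring
    rw [this]; exact neg_ne_zero.2 (mul_ne_zero h2 (by positivity))
  refine h.congr_deriv ?_
  simp only [evenK, id, Pi.sub_apply]
  field_simp
  ring

/-- In this form the zero of `r - r⁻¹` absorbs the logarithmic singularity at `r = 1`, because `t
log t` is continuous. -/
lemma oddK_eq {r : ℝ} (h0 : 0 < r) :
    oddK r = (1 + r⁻¹) / 2 * ((r - 1) * Real.log (1 + r) - (r - 1) * Real.log (r - 1)) := by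
  rcases eq_or_ne r 1 with rfl | h1
  · simp [oddK]
  · rw [oddK, ell_eq h0 h1]
    field_simp
    ring

lemma continuousOn_oddK : ContinuousOn oddK (Ioi 0) := by
  have h : ContinuousOn (fun r : ℝ => (1 + r⁻¹) / 2 *
      ((r - 1) * Real.log (1 + r) - (r - 1) * Real.log (r - 1))) (Ioi 0) := by
    have h1 : Continuous fun r : ℝ => (r - 1) * Real.log (r - 1) :=
      Real.continuous_mul_log.comp (continuous_id.sub continuous_const)
    have h2 : ContinuousOn (fun r : ℝ => Real.log (1 + r)) (Ioi 0) :=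
      ContinuousOn.log (by fun_prop) fun x hx => by
        have : (0 : ℝ) < x := hx
        positivity
    have h3 : ContinuousOn (fun r : ℝ => r⁻¹) (Ioi 0) :=
      continuousOn_inv₀.mono fun x hx => (ne_of_gt hx : x ≠ 0)
    have h4 := h1.continuousOn (s := Ioi (0 : ℝ))
    fun_prop
  exact h.congr fun r hr => oddK_eq hr

lemma evenK_nonneg_of_lt {r : ℝ} (h0 : 0 < r) (h1 : r < 1) : 0 ≤ evenK r := by
  have h := ell_lower h0.le h1
  have h2 : 1 ≤ (r + r⁻¹) / 2 * (2 * r) := by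
    have : (r + r⁻¹) / 2 * (2 * r) = r ^ 2 + 1 := by field_simp
    nlinarith
  have h3 : (r + r⁻¹) / 2 * (2 * r) ≤ (r + r⁻¹) / 2 * ell r := by gcongr
  unfold evenK; linarith

/-- The point `r = 1` must be excluded: the junk value of `ell` there is 0, so `evenK 1 = -1`. -/
lemma evenK_nonneg {r : ℝ} (h0 : 0 < r) (h1 : r ≠ 1) : 0 ≤ evenK r := by
  rcases lt_or_gt_of_ne h1 with h | h
  · exact evenK_nonneg_of_lt h0 h
  · rw [← evenK_inv h0.ne']
    exact evenK_nonneg_of_lt (inv_pos.2 h0) (inv_lt_one_of_one_lt₀ h)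

lemma oddK_nonpos {r : ℝ} (h0 : 0 < r) (h1 : r ≤ 1) : oddK r ≤ 0 := by
  rcases h1.eq_or_lt with rfl | h1
  · simp [oddK]
  have h := ell_lower h0.le h1
  have h2 : r - r⁻¹ ≤ 0 := by
    have := one_lt_inv₀ h0 |>.2 h1
    linarith
  exact mul_nonpos_of_nonpos_of_nonneg (by linarith) (by linarith)

lemma neg_one_le_oddK_of_le {r : ℝ} (h0 : 0 < r) (h1 : r ≤ 1) : -1 ≤ oddK r := by
  rcases h1.eq_or_lt with rfl | h1
  · simp [oddK]
  have h := ell_upper h0.le h1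
  have h2 : 0 < r⁻¹ - r := by
    have := one_lt_inv₀ h0 |>.2 h1
    linarith
  have h3 : (r⁻¹ - r) / 2 * ell r ≤ (r⁻¹ - r) / 2 * (2 * r / (1 - r ^ 2)) := by gcongr
  have h4 : (r⁻¹ - r) / 2 * (2 * r / (1 - r ^ 2)) = 1 := by
    have : 1 - r ^ 2 ≠ 0 := by nlinarith
    field_simp
  unfold oddK; linarith

lemma oddK_le_of_le {r : ℝ} (h0 : 0 < r) (h1 : r ≤ 1) : oddK r ≤ -1 + r ^ 2 := by
  rcases h1.eq_or_lt with rfl | h1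
  · simp [oddK]
  have h := ell_lower h0.le h1
  have h2 : 0 < r⁻¹ - r := by
    have := one_lt_inv₀ h0 |>.2 h1
    linarith
  have h3 : (r⁻¹ - r) / 2 * (2 * r) ≤ (r⁻¹ - r) / 2 * ell r := by gcongr
  have h4 : (r⁻¹ - r) / 2 * (2 * r) = 1 - r ^ 2 := by field_simp
  unfold oddK; linarith

lemma abs_oddK_le {r : ℝ} (h0 : 0 < r) : |oddK r| ≤ 1 := by
  rcases le_total r 1 with h | h
  · rw [abs_le]
    exact ⟨neg_one_le_oddK_of_le h0 h, (oddK_nonpos h0 h).trans zero_le_one⟩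
  · have h1 := neg_one_le_oddK_of_le (inv_pos.2 h0) (inv_le_one_of_one_le₀ h)
    have h2 := oddK_nonpos (inv_pos.2 h0) (inv_le_one_of_one_le₀ h)
    rw [oddK_inv h0.ne'] at h1 h2
    rw [abs_le]; constructor <;> linarith

lemma monotoneOn_oddK : MonotoneOn oddK (Ioi 0) := by
  have h1 : MonotoneOn oddK (Ioc 0 1) := by
    refine monotoneOn_of_deriv_nonneg (convex_Ioc 0 1)
      (continuousOn_oddK.mono fun x hx => hx.1) ?_ ?_ <;> rw [interior_Ioc] <;> intro x hx
    · exact (hasDerivAt_oddK hx.1 hx.2.ne).differentiableAt.differentiableWithinAt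
    · rw [(hasDerivAt_oddK hx.1 hx.2.ne).deriv]
      exact div_nonneg (evenK_nonneg hx.1 hx.2.ne) hx.1.le
  have h2 : MonotoneOn oddK (Ici 1) := by
    refine monotoneOn_of_deriv_nonneg (convex_Ici 1)
      (continuousOn_oddK.mono fun x hx => zero_lt_one.trans_le (mem_Ici.1 hx)) ?_ ?_ <;>
      rw [interior_Ici] <;> intro x (hx : 1 < x)
    all_goals have hx0 : 0 < x := zero_lt_one.trans hx
    · exact (hasDerivAt_oddK hx0 hx.ne').differentiableAt.differentiableWithinAt
    · rw [(hasDerivAt_oddK hx0 hx.ne').deriv]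
      exact div_nonneg (evenK_nonneg hx0 hx.ne') hx0.le
  intro x hx y hy hxy
  rcases le_total y 1 with h | h
  · exact h1 ⟨hx, hxy.trans h⟩ ⟨hy, h⟩ hxy
  rcases le_total x 1 with h' | h'
  · exact (h1 ⟨hx, h'⟩ ⟨one_pos, le_rfl⟩ h').trans (h2 self_mem_Ici h h)
  · exact h2 h' h hxy

lemma tendsto_oddK_zero : Tendsto oddK (𝓝[>] 0) (𝓝 (-1)) := by
  have h : Tendsto (fun r : ℝ => -1 + r ^ 2) (𝓝[>] 0) (𝓝 (-1)) := by
    have : Tendsto (fun r : ℝ => -1 + r ^ 2) (𝓝 0) (𝓝 (-1 + 0 ^ 2)) :=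
      Continuous.tendsto (by fun_prop) 0
    simp at this
    exact this.mono_left nhdsWithin_le_nhds
  have hI : Ioc (0 : ℝ) 1 ∈ 𝓝[>] (0 : ℝ) := Ioc_mem_nhdsGT one_pos
  refine tendsto_of_tendsto_of_tendsto_of_le_of_le' tendsto_const_nhds h ?_ ?_
  · filter_upwards [hI] with r hr using neg_one_le_oddK_of_le hr.1 hr.2
  · filter_upwards [hI] with r hr using oddK_le_of_le hr.1 hr.2

lemma tendsto_oddK_atTop : Tendsto oddK atTop (𝓝 1) := by
  have h := (tendsto_oddK_zero.comp tendsto_inv_atTop_nhdsGT_zero).neg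
  rw [neg_neg] at h
  refine h.congr' ?_
  filter_upwards [eventually_gt_atTop 0] with r hr
  simp [oddK_inv hr.ne']

/-- The function is the nonnegative derivative of the bounded function `oddK` on either side of 1.
This absorbs the logarithmic singularity at 1 with no estimate. -/
lemma integrableOn_evenK_div : IntegrableOn (fun r => evenK r / r) (Ioi 0) := by
  have h1 : IntegrableOn (fun r => evenK r / r) (Ioc 0 1) := by
    -- The junk value `oddK 0 = 0` is replaced by the limit `-1` to obtain continuity up to 0.
    have hc : ContinuousOn (Function.update oddK 0 (-1)) (Icc 0 1) := by
      intro x hx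
      rcases hx.1.eq_or_lt with rfl | h0
      · rw [continuousWithinAt_update_same]
        exact tendsto_oddK_zero.mono_left (nhdsWithin_mono _ fun y hy =>
          lt_of_le_of_ne hy.1.1 (Ne.symm hy.2))
      · exact ((continuousAt_update_of_ne h0.ne').2
          (continuousOn_oddK.continuousAt (Ioi_mem_nhds h0))).continuousWithinAt
    refine intervalIntegral.integrableOn_deriv_of_nonneg hc (fun x hx => ?_) (fun x hx => ?_)
    · refine (hasDerivAt_oddK hx.1 hx.2.ne).congr_of_eventuallyEq ?_
      filter_upwards [isOpen_ne.mem_nhds hx.1.ne'] with y hy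
      simp [Function.update_of_ne hy]
    · exact div_nonneg (evenK_nonneg hx.1 hx.2.ne) hx.1.le
  have h2 : IntegrableOn (fun r => evenK r / r) (Ioi 1) := by
    refine integrableOn_Ioi_deriv_of_nonneg
      (continuousOn_oddK.continuousAt (Ioi_mem_nhds one_pos)).continuousWithinAt
      (fun x (hx : 1 < x) => hasDerivAt_oddK (zero_lt_one.trans hx) hx.ne')
      (fun x (hx : 1 < x) => div_nonneg (evenK_nonneg (zero_lt_one.trans hx) hx.ne')
        (zero_lt_one.trans hx).le) tendsto_oddK_atTop
  rw [← Ioc_union_Ioi_eq_Ioi (zero_le_one' ℝ)]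
  exact h1.union h2

/-- The fundamental theorem of calculus on `(0, ∞)` with countably many exceptional points. -/
lemma integral_Ioi_of_hasDerivAt_off_countable {F F' : ℝ → ℝ} {s : Set ℝ} {m : ℝ}
    (hs : s.Countable) (hc : ContinuousOn F (Ici 0)) (hd : ∀ x ∈ Ioi 0 \ s, HasDerivAt F (F' x) x)
    (hi : IntegrableOn F' (Ioi 0)) (hm : Tendsto F atTop (𝓝 m)) :
    ∫ x in Ioi 0, F' x = m - F 0 := by
  have h := intervalIntegral_tendsto_integral_Ioi 0 hi tendsto_id
  refine tendsto_nhds_unique h ((hm.sub_const (F 0)).congr' ?_)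
  filter_upwards [eventually_ge_atTop 0] with X hX
  refine (integral_eq_of_hasDerivAt_off_countable_of_le F F' hX hs
    (hc.mono Icc_subset_Ici_self) (fun x hx => hd x ⟨hx.1.1, hx.2⟩) ?_).symm
  rw [intervalIntegrable_iff_integrableOn_Ioc_of_le hX]
  exact hi.mono_set Ioc_subset_Ioi_self

/-! ### The primitive of the kernel of `T` -/

/-- An antiderivative of `kerT`. -/
def primT (s : ℝ) : ℝ := s * (oddK s - 1)

lemma hasDerivAt_primT {r : ℝ} (h0 : 0 < r) (h1 : r ≠ 1) : HasDerivAt primT (kerT r) r := by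
  have h := (hasDerivAt_id r).mul ((hasDerivAt_oddK h0 h1).sub_const 1)
  refine h.congr_deriv ?_
  rw [kerT_eq, id]
  field_simp
  ring

lemma continuousOn_primT : ContinuousOn primT (Ici 0) := by
  intro x (hx : 0 ≤ x)
  rcases hx.eq_or_lt with rfl | h0
  · have h : Tendsto primT (𝓝[≥] 0) (𝓝 0) := by
      have h2 : Tendsto (fun r : ℝ => 2 * |r|) (𝓝[≥] 0) (𝓝 0) := by
        have : Tendsto (fun r : ℝ => 2 * |r|) (𝓝 0) (𝓝 (2 * |0|)) :=
          Continuous.tendsto (by fun_prop) 0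
        simp at this
        exact this.mono_left nhdsWithin_le_nhds
      refine squeeze_zero_norm' ?_ h2
      filter_upwards [self_mem_nhdsWithin] with r (hr : 0 ≤ r)
      rcases hr.eq_or_lt with rfl | hr
      · simp [primT]
      rw [primT, Real.norm_eq_abs, abs_mul, mul_comm]
      gcongr
      have := abs_oddK_le hr
      rw [abs_le] at this ⊢
      constructor <;> linarith
    have h0 : primT 0 = 0 := by simp [primT]
    rw [ContinuousWithinAt, h0]; exact h
  · exact (continuousAt_id.mul ((continuousOn_oddK.continuousAt (Ioi_mem_nhds h0)).sub
      continuousAt_const)).continuousWithinAt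

/-- By oddness `1 - oddK r = 1 + oddK r⁻¹ ≤ r⁻²` for `r ≥ 1`, so `primT` is `O(1/r)`. -/
lemma tendsto_primT_atTop : Tendsto primT atTop (𝓝 0) := by
  refine squeeze_zero_norm' ?_ tendsto_inv_atTop_zero
  filter_upwards [eventually_ge_atTop 1] with r hr
  have h0 : 0 < r := zero_lt_one.trans_le hr
  have h1 := neg_one_le_oddK_of_le (inv_pos.2 h0) (inv_le_one_of_one_le₀ hr)
  have h2 := oddK_le_of_le (inv_pos.2 h0) (inv_le_one_of_one_le₀ hr)
  rw [oddK_inv h0.ne'] at h1 h2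
  rw [primT, Real.norm_eq_abs, abs_mul, abs_of_pos h0, abs_of_nonpos (by linarith)]
  calc r * -(oddK r - 1) ≤ r * r⁻¹ ^ 2 := by gcongr; linarith
    _ = r⁻¹ := by field_simp

lemma kerT_nonneg {r : ℝ} (h : 1 < r) : 0 ≤ kerT r := by
  have h0 : 0 < r := zero_lt_one.trans h
  have := ell_lower (inv_pos.2 h0).le (inv_lt_one_of_one_lt₀ h)
  rw [ell_inv h0.ne'] at this
  have h2 : r * (2 * r⁻¹) ≤ r * ell r := by gcongr
  have h3 : r * (2 * r⁻¹) = 2 := by field_simp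
  unfold kerT; linarith

lemma neg_two_le_kerT {r : ℝ} (h0 : 0 < r) : -2 ≤ kerT r := by
  unfold kerT
  have : 0 ≤ ell r := by
    rcases lt_trichotomy r 1 with h | rfl | h
    · linarith [ell_lower h0.le h]
    · simp [ell]
    · rw [← ell_inv h0.ne']
      have := ell_lower (inv_pos.2 h0).le (inv_lt_one_of_one_lt₀ h)
      have := inv_pos.2 h0
      linarith
  nlinarith

lemma integrableOn_kerT : IntegrableOn kerT (Ioi 0) := by
  have h1 : IntegrableOn kerT (Ioc 0 1) := by
    have hb : IntegrableOn (fun r => |evenK r / r| + 2) (Ioc 0 1) :=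
      (integrableOn_evenK_div.mono_set Ioc_subset_Ioi_self).abs.add
        (integrableOn_const (by simp))
    refine Integrable.mono' hb measurable_kerT.aestronglyMeasurable ?_
    filter_upwards [ae_restrict_mem measurableSet_Ioc] with r hr
    have h2 := abs_oddK_le hr.1
    have h3 : |evenK r| ≤ |evenK r / r| := by
      rw [abs_div, abs_of_pos hr.1]
      exact le_div_self (abs_nonneg _) hr.1 hr.2
    rw [kerT_eq, Real.norm_eq_abs]
    rw [abs_le] at h2 ⊢
    constructor <;> linarith [le_abs_self (evenK r), neg_abs_le (evenK r)]
  have h2 : IntegrableOn kerT (Ioi 1) := by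
    refine integrableOn_Ioi_deriv_of_nonneg
      (continuousOn_primT.mono (Ici_subset_Ici.2 zero_le_one) 1 self_mem_Ici)
      (fun x (hx : 1 < x) => hasDerivAt_primT (zero_lt_one.trans hx) hx.ne')
      (fun x hx => kerT_nonneg hx) tendsto_primT_atTop
  rw [← Ioc_union_Ioi_eq_Ioi (zero_le_one' ℝ)]
  exact h1.union h2

/-- This is why `T` annihilates constants and sees `f` only through `f - f(+∞)`. -/
lemma integral_kerT : ∫ r in Ioi 0, kerT r = 0 := by
  rw [integral_Ioi_of_hasDerivAt_off_countable (F := primT) (s := {1}) (countable_singleton 1)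
    continuousOn_primT (fun x hx => hasDerivAt_primT hx.1 hx.2) integrableOn_kerT
    tendsto_primT_atTop]
  simp [primT]

lemma integrableOn_kerT_div {x : ℝ} (hx : 0 < x) : IntegrableOn (fun y => kerT (y / x)) (Ioi 0) := by
  have := (integrableOn_Ioi_comp_mul_left_iff kerT 0 (inv_pos.2 hx)).2 (by simpa using integrableOn_kerT)
  simpa [div_eq_inv_mul] using this

/-- The explicit partial integrals are nonpositive and nonincreasing in `x`; sign and monotonicity
of `T f` rest on these two facts. -/
lemma integral_kerT_div {x Y : ℝ} (hx : 0 < x) (hY : 0 ≤ Y) :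
    ∫ y in (0 : ℝ)..Y, kerT (y / x) = Y * (oddK (Y / x) - 1) := by
  have hx0 : x ≠ 0 := hx.ne'
  have hmap : MapsTo (fun y : ℝ => y / x) (Icc 0 Y) (Ici 0) := fun y hy => div_nonneg hy.1 hx.le
  rw [integral_eq_of_hasDerivAt_off_countable_of_le (fun y => x * primT (y / x))
    (fun y => kerT (y / x)) hY (countable_singleton x)
    (continuousOn_const.mul (continuousOn_primT.comp (by fun_prop) hmap)) ?_ ?_]
  · simp [primT]; field_simp
  · intro y hy
    have hy0 := hy.1.1
    have h1 : y / x ≠ 1 := by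
      rw [Ne, div_eq_one_iff_eq hx0]; exact hy.2
    have h := ((hasDerivAt_primT (div_pos hy0 hx) h1).comp y
      ((hasDerivAt_id y).div_const x)).const_mul x
    refine h.congr_deriv ?_
    field_simp
  · rw [intervalIntegrable_iff_integrableOn_Ioc_of_le hY]
    exact (integrableOn_kerT_div hx).mono_set Ioc_subset_Ioi_self

lemma T_eq (f : ℝ → ℝ) {x : ℝ} (hx : 0 < x) :
    T f x = 1 / Real.pi * ∫ y in Ioi (0 : ℝ), f y * kerT (y / x) := by
  rw [T, if_neg hx.ne']
  congr 1
  refine integral_congr_ae (Eventually.of_forall fun y => ?_)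
  have : (x + y) / (x - y) = (1 + y / x) / (1 - y / x) := by
    have h1 : 1 + y / x = (x + y) / x := by field_simp
    have h2 : 1 - y / x = (x - y) / x := by field_simp
    rw [h1, h2, div_div_div_cancel_right₀ hx.ne']
  simp only [kerT, ell, this]

/-! ### Integrals of antitone functions against kernels with nonpositive primitive -/

/-- A superlevel set of an antitone function is, up to a null set, empty, an initial interval, or
the whole half-line. -/
lemma setIntegral_superlevel_nonpos {f k : ℝ → ℝ} (hf : AntitoneOn f (Ioi 0))
    (hk : IntegrableOn k (Ioi 0)) (hK : ∀ Y, 0 ≤ Y → ∫ y in (0 : ℝ)..Y, k y ≤ 0) (t : ℝ) :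
    ∫ y in Ioi 0 ∩ {y | t < f y}, k y ≤ 0 := by
  set S := Ioi 0 ∩ {y | t < f y} with hS
  have hdown : ∀ y ∈ S, ∀ z, 0 < z → z ≤ y → z ∈ S := fun y hy z hz hzy =>
    ⟨hz, hy.2.trans_le (hf hz hy.1 hzy)⟩
  rcases S.eq_empty_or_nonempty with h | hne
  · simp [h]
  by_cases hb : BddAbove S
  · have h1 : Ioo 0 (sSup S) ⊆ S := fun y hy => by
      obtain ⟨z, hz, hyz⟩ := exists_lt_of_lt_csSup hne hy.2
      exact hdown z hz y hy.1 hyz.le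
    have h2 : S ⊆ Ioc 0 (sSup S) := fun y hy => ⟨hy.1, le_csSup hb hy⟩
    have h3 : S =ᵐ[volume] Ioc 0 (sSup S) :=
      (h2.eventuallyLE).antisymm (Ioo_ae_eq_Ioc.symm.le.trans h1.eventuallyLE)
    have h0 : 0 ≤ sSup S := by
      obtain ⟨y, hy⟩ := hne
      exact (le_of_lt hy.1).trans (le_csSup hb hy)
    rw [setIntegral_congr_set h3, ← intervalIntegral.integral_of_le h0]
    exact hK _ h0
  · have h1 : S = Ioi 0 := by
      refine Subset.antisymm inter_subset_left fun y hy => ?_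
      obtain ⟨z, hz, hyz⟩ := not_bddAbove_iff.1 hb y
      exact hdown z hz y hy hyz.le
    rw [h1]
    refine le_of_tendsto (intervalIntegral_tendsto_integral_Ioi 0 hk tendsto_id) ?_
    filter_upwards [eventually_ge_atTop 0] with Y hY using hK Y hY

/-- Layer-cake formula: `f(y)` is the integral over `t ∈ (0, 1]` of the indicator of `t < f(y)`;
Fubini reduces the claim to superlevel sets. -/
lemma integral_mul_nonpos_of_antitoneOn {f k : ℝ → ℝ} (hf : AntitoneOn f (Ioi 0))
    (hm : Measurable f) (h0 : ∀ y, 0 < y → 0 ≤ f y) (h1 : ∀ y, 0 < y → f y ≤ 1)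
    (hk : IntegrableOn k (Ioi 0)) (hK : ∀ Y, 0 ≤ Y → ∫ y in (0 : ℝ)..Y, k y ≤ 0) :
    ∫ y in Ioi 0, f y * k y ≤ 0 := by
  have hS : MeasurableSet {p : ℝ × ℝ | p.2 < f p.1} :=
    measurableSet_lt measurable_snd (hm.comp measurable_fst)
  have hint : Integrable (Function.uncurry fun y t : ℝ => {t | t < f y}.indicator (fun _ => k y) t)
      ((volume.restrict (Ioi 0)).prod (volume.restrict (Ioc (0 : ℝ) 1))) := by
    have h : Integrable (fun p : ℝ × ℝ => k p.1)
        ((volume.restrict (Ioi 0)).prod (volume.restrict (Ioc (0 : ℝ) 1))) := hk.comp_fst _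
    exact h.indicator hS
  have hL : ∫ y in Ioi 0, f y * k y =
      ∫ y in Ioi 0, ∫ t in Ioc (0 : ℝ) 1, {t | t < f y}.indicator (fun _ => k y) t := by
    refine setIntegral_congr_fun measurableSet_Ioi fun y (hy : 0 < y) => ?_
    have hset : Ioc (0 : ℝ) 1 ∩ {t | t < f y} = Ioo 0 (f y) := by
      ext t; simp only [mem_inter_iff, mem_Ioc, mem_ofPred_eq, mem_Ioo]
      exact ⟨fun h => ⟨h.1.1, h.2⟩, fun h => ⟨⟨h.1, h.2.le.trans (h1 y hy)⟩, h.2⟩⟩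
    have hms : MeasurableSet {t | t < f y} := measurableSet_Iio
    rw [setIntegral_indicator hms, hset, setIntegral_const]
    simp [h0 y hy]
  rw [hL, integral_integral_swap hint]
  refine integral_nonpos fun t => ?_
  have hms : MeasurableSet {y | t < f y} := measurableSet_lt measurable_const hm
  have : (fun y => {t | t < f y}.indicator (fun _ => k y) t) = {y | t < f y}.indicator k := by
    ext y; simp [indicator]
  simp only [Pi.zero_apply]
  rw [this, setIntegral_indicator hms]
  exact setIntegral_superlevel_nonpos hf hk hK t

/-! ### Elementary properties of the elements of `𝔻` -/

section setD

/-- Membership in `𝔻`, as a predicate. -/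
def MemD (f : ℝ → ℝ) : Prop := f ∈ setD

variable {f : ℝ → ℝ}

lemma MemD.continuous (hf : MemD f) : Continuous f := hf.1.1
lemma MemD.even (hf : MemD f) (x : ℝ) : f (-x) = f x := hf.1.2.1 x
lemma MemD.map_zero (hf : MemD f) : f 0 = 1 := hf.2.1
lemma MemD.nonneg (hf : MemD f) (x : ℝ) : 0 ≤ f x := (le_max_right _ _).trans (hf.2.2.1 x).1
lemma MemD.le_one (hf : MemD f) (x : ℝ) : f x ≤ 1 := (hf.2.2.1 x).2
lemma MemD.parabola_le (hf : MemD f) (x : ℝ) : max (1 - x ^ 2) 0 ≤ f x := (hf.2.2.1 x).1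
lemma MemD.antitoneOn (hf : MemD f) : AntitoneOn f (Ici 0) := hf.2.2.2.1
lemma MemD.convexOn (hf : MemD f) : ConvexOn ℝ (Ici 0) fun s => f (Real.sqrt s) := hf.2.2.2.2.1

lemma MemD.anti (hf : MemD f) {x y : ℝ} (hx : 0 ≤ x) (hxy : x ≤ y) : f y ≤ f x :=
  hf.antitoneOn hx (hx.trans hxy) hxy

lemma MemD.antitoneOn_Ioi (hf : MemD f) : AntitoneOn f (Ioi 0) :=
  hf.antitoneOn.mono Ioi_subset_Ici_self

/-- The slope condition in `𝔻` enters only here: it makes `f` non-constant, since otherwise `f = 1`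
on `[0, 1/2]` and the left derivative would be 0. -/
lemma MemD.lt_one (hf : MemD f) : f (1 / 2) < 1 := by
  by_contra hlt
  have h1 : f (1 / 2) = 1 := le_antisymm (hf.le_one _) (not_lt.1 hlt)
  have hd : derivWithin f (Iio (1 / 2)) (1 / 2) = 0 := by
    have heq : f =ᶠ[𝓝[<] (1 / 2 : ℝ)] fun _ => 1 := by
      filter_upwards [Ioo_mem_nhdsLT (show (0 : ℝ) < 1 / 2 by norm_num)] with y hy
      exact le_antisymm (hf.le_one _) (h1 ▸ hf.anti hy.1.le hy.2.le)
    rw [heq.derivWithin_eq h1]; simp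
  have h2 := hf.2.2.2.2.2
  have h3 : 0 < eta := by unfold eta; positivity
  rw [hd] at h2
  linarith

lemma MemD.tendsto (hf : MemD f) : Tendsto f atTop (𝓝 (atInfty f)) := by
  refine tendsto_nhds_limUnder ?_
  have hanti : Antitone fun x => f (max x 0) := fun x y hxy =>
    hf.anti (le_max_right _ _) (max_le_max_right 0 hxy)
  have h := tendsto_atTop_ciInf hanti ⟨0, by rintro _ ⟨x, rfl⟩; exact hf.nonneg _⟩
  refine ⟨_, h.congr' ?_⟩
  filter_upwards [eventually_ge_atTop 0] with x hx
  simp [max_eq_left hx]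

lemma MemD.atInfty_le (hf : MemD f) {x : ℝ} (hx : 0 ≤ x) : atInfty f ≤ f x := by
  refine le_of_tendsto hf.tendsto ?_
  filter_upwards [eventually_ge_atTop x] with y hy using hf.anti hx hy

lemma MemD.atInfty_nonneg (hf : MemD f) : 0 ≤ atInfty f :=
  ge_of_tendsto' hf.tendsto fun x => hf.nonneg x

/-- The bound `1 - x² ≤ f` makes the integrand at most 1 on `(0, 1]`; beyond 1 it is at most `y⁻²`.
-/
lemma MemD.integrableOn_c (hf : MemD f) :
    IntegrableOn (fun y => (f 0 - f y) / y ^ 2) (Ioi 0) := by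
  have hm : Measurable fun y => (f 0 - f y) / y ^ 2 := by
    have := hf.continuous.measurable; fun_prop
  have hn : ∀ y, ‖(f 0 - f y) / y ^ 2‖ = (1 - f y) / y ^ 2 := fun y => by
    rw [Real.norm_of_nonneg, hf.map_zero]
    rw [hf.map_zero]
    exact div_nonneg (sub_nonneg.2 (hf.le_one y)) (sq_nonneg y)
  rw [← Ioc_union_Ioi_eq_Ioi (zero_le_one' ℝ)]
  refine IntegrableOn.union ?_ ?_
  · refine Integrable.mono' (g := fun _ => (1 : ℝ)) (integrableOn_const (by simp))
      hm.aestronglyMeasurable ?_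
    filter_upwards [ae_restrict_mem measurableSet_Ioc] with y hy
    rw [hn, div_le_one (by have := hy.1; positivity)]
    linarith [(le_max_left _ _).trans (hf.parabola_le y)]
  · refine Integrable.mono' (integrableOn_Ioi_rpow_of_lt (show (-2 : ℝ) < -1 by norm_num) one_pos)
      hm.aestronglyMeasurable ?_
    filter_upwards [ae_restrict_mem measurableSet_Ioi] with y (hy : 1 < y)
    have hy0 : 0 < y := zero_lt_one.trans hy
    rw [hn, Real.rpow_neg hy0.le, div_eq_mul_inv]
    norm_cast
    exact mul_le_of_le_one_left (by positivity) (by linarith [hf.nonneg y])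

lemma MemD.c_pos (hf : MemD f) : 0 < c f := by
  unfold c
  refine mul_pos (by positivity) ?_
  have hn : ∀ y, 0 ≤ (f 0 - f y) / y ^ 2 := fun y => by
    rw [hf.map_zero]; exact div_nonneg (sub_nonneg.2 (hf.le_one y)) (sq_nonneg y)
  rw [setIntegral_pos_iff_support_of_nonneg_ae (Eventually.of_forall hn) hf.integrableOn_c]
  have hsub : Ioo (1 / 2 : ℝ) 1 ⊆ Function.support (fun y => (f 0 - f y) / y ^ 2) ∩ Ioi 0 := by
    intro y hy
    have hy0 : (0 : ℝ) < y := lt_trans (by norm_num) hy.1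
    refine ⟨?_, hy0⟩
    have := (hf.anti (by norm_num) hy.1.le).trans_lt hf.lt_one
    rw [Function.mem_support, hf.map_zero]
    exact (div_pos (by linarith) (by positivity)).ne'
  refine lt_of_lt_of_le ?_ (measure_mono hsub)
  simp; norm_num

/-- Slopes of the convex function `s ↦ f(√s)` are compared on the points `(y/2)² < y² < z²`; the
first gap is `3y²/4`. -/
lemma MemD.sub_le (hf : MemD f) {y z : ℝ} (hy : 0 < y) (hyz : y ≤ z) :
    f y - f z ≤ (z ^ 2 - y ^ 2) * (4 / (3 * y ^ 2)) * f (y / 2) := by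
  rcases hyz.eq_or_lt with rfl | hlt
  · simp
  have h := hf.convexOn.slope_mono_adjacent (x := (y / 2) ^ 2) (y := y ^ 2) (z := z ^ 2)
    (mem_Ici.2 (sq_nonneg _)) (mem_Ici.2 (sq_nonneg _)) (by nlinarith) (by nlinarith)
  simp only [Real.sqrt_sq hy.le, Real.sqrt_sq (half_pos hy).le, Real.sqrt_sq (hy.le.trans hyz)] at h
  have h1 : y ^ 2 - (y / 2) ^ 2 = 3 / 4 * y ^ 2 := by ring
  rw [h1, div_le_div_iff₀ (by positivity) (by nlinarith)] at h
  have h2 := hf.nonneg y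
  have h3 : 0 < z ^ 2 - y ^ 2 := by nlinarith
  have h4 : f y - f z ≤ (z ^ 2 - y ^ 2) * (f (y / 2) - f y) / (3 / 4 * y ^ 2) := by
    rw [le_div_iff₀ (by positivity)]
    linarith
  refine h4.trans ?_
  rw [div_le_iff₀ (by positivity)]
  have : (z ^ 2 - y ^ 2) * (4 / (3 * y ^ 2)) * f (y / 2) * (3 / 4 * y ^ 2) =
    (z ^ 2 - y ^ 2) * f (y / 2) := by field_simp
  rw [this]
  gcongr
  linarith

lemma MemD.ae_differentiableAt (hf : MemD f) :
    ∀ᵐ y ∂volume.restrict (Ioi 0), DifferentiableAt ℝ f y := by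
  have h := MonotoneOn.ae_differentiableWithinAt (f := fun y => -f y)
    (hf.antitoneOn_Ioi.neg) measurableSet_Ioi
  filter_upwards [h, ae_restrict_mem measurableSet_Ioi] with y hy hy0
  have := (hy.differentiableAt (Ioi_mem_nhds hy0)).neg
  simpa using this

end setD

/-! ### The map `T` -/

section T

variable {f : ℝ → ℝ}

lemma integrableOn_mul_kerT (hm : Measurable f) (h1 : ∀ y, 0 < y → |f y| ≤ 1) {x : ℝ} (hx : 0 < x) :
    IntegrableOn (fun y => f y * kerT (y / x)) (Ioi 0) := by
  refine Integrable.mono' (integrableOn_kerT_div hx).norm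
    (hm.aestronglyMeasurable.mul (measurable_kerT.comp (measurable_id.div_const x)).aestronglyMeasurable) ?_
  filter_upwards [ae_restrict_mem measurableSet_Ioi] with y hy
  rw [norm_mul]
  exact mul_le_of_le_one_left (norm_nonneg _) (h1 y hy)

lemma MemD.abs_le_one (hf : MemD f) (x : ℝ) : |f x| ≤ 1 :=
  abs_le.2 ⟨by linarith [hf.nonneg x], hf.le_one x⟩

lemma MemD.integrableOn_mul_kerT (hf : MemD f) {x : ℝ} (hx : 0 < x) :
    IntegrableOn (fun y => f y * kerT (y / x)) (Ioi 0) :=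
  GCLM.integrableOn_mul_kerT hf.continuous.measurable (fun y _ => hf.abs_le_one y) hx

/-- The substitution moves `x` from the singular kernel to `f`, so that differentiating in `x` only
needs local Lipschitz bounds for `f`. -/
lemma T_eq_scaled (f : ℝ → ℝ) {x : ℝ} (hx : 0 < x) :
    T f x = x / Real.pi * ∫ z in Ioi (0 : ℝ), f (x * z) * kerT z := by
  have h := integral_comp_mul_left_Ioi (fun y => f y * kerT (y / x)) 0 hx
  simp only [mul_zero, mul_div_cancel_left₀ _ hx.ne', smul_eq_mul] at h
  rw [T_eq f hx, h]
  field_simp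

lemma MemD.abs_T_le (hf : MemD f) {x : ℝ} (hx : 0 < x) :
    |T f x| ≤ x * ((∫ z in Ioi 0, |kerT z|) / Real.pi) := by
  rw [T_eq_scaled f hx, abs_mul, abs_of_pos (by positivity)]
  have : |∫ z in Ioi (0 : ℝ), f (x * z) * kerT z| ≤ ∫ z in Ioi 0, |kerT z| := by
    rw [← Real.norm_eq_abs]
    refine norm_integral_le_of_norm_le integrableOn_kerT.abs (Eventually.of_forall fun z => ?_)
    rw [norm_mul]
    exact mul_le_of_le_one_left (norm_nonneg _) (hf.abs_le_one _)
  calc _ ≤ x / Real.pi * ∫ z in Ioi 0, |kerT z| := by gcongr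
    _ = _ := by ring

lemma T_zero (f : ℝ → ℝ) : T f 0 = 0 := by simp [T]

lemma oddK_le_one {r : ℝ} (h0 : 0 < r) : oddK r ≤ 1 := (abs_le.1 (abs_oddK_le h0)).2

lemma integral_mul_kerT_nonpos (hf : AntitoneOn f (Ioi 0))
    (hm : Measurable f) (h0 : ∀ y, 0 < y → 0 ≤ f y) (h1 : ∀ y, 0 < y → f y ≤ 1) {x : ℝ}
    (hx : 0 < x) : ∫ y in Ioi 0, f y * kerT (y / x) ≤ 0 := by
  refine integral_mul_nonpos_of_antitoneOn hf hm h0 h1 (integrableOn_kerT_div hx) fun Y hY => ?_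
  rw [integral_kerT_div hx hY]
  rcases hY.eq_or_lt with rfl | hY
  · simp
  · exact mul_nonpos_of_nonneg_of_nonpos hY.le (by linarith [oddK_le_one (div_pos hY hx)])

lemma MemD.T_nonpos (hf : MemD f) {x : ℝ} (hx : 0 ≤ x) : T f x ≤ 0 := by
  rcases hx.eq_or_lt with rfl | hx
  · rw [T_zero]
  rw [T_eq f hx]
  exact mul_nonpos_of_nonneg_of_nonpos (by positivity)
    (integral_mul_kerT_nonpos hf.antitoneOn_Ioi hf.continuous.measurable (fun y _ => hf.nonneg y)
      (fun y _ => hf.le_one y) hx)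

/-- The difference of the two kernels has primitive `Y (oddK (Y/z) - oddK (Y/x))`, which is
nonpositive because `oddK` is increasing. -/
lemma MemD.T_antitone (hf : MemD f) {x z : ℝ} (hx : 0 ≤ x) (hxz : x ≤ z) : T f z ≤ T f x := by
  rcases hx.eq_or_lt with rfl | hx
  · rw [T_zero]; exact hf.T_nonpos hxz
  have hz := hx.trans_le hxz
  rw [T_eq f hx, T_eq f hz]
  refine mul_le_mul_of_nonneg_left ?_ (by positivity)
  rw [← sub_nonpos, ← integral_sub (hf.integrableOn_mul_kerT hz) (hf.integrableOn_mul_kerT hx)]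
  simp only [← mul_sub]
  have hi := (integrableOn_kerT_div hz).sub (integrableOn_kerT_div hx)
  refine integral_mul_nonpos_of_antitoneOn hf.antitoneOn_Ioi hf.continuous.measurable
    (fun y _ => hf.nonneg y) (fun y _ => hf.le_one y) hi fun Y hY => ?_
  have hii : ∀ {w : ℝ}, 0 < w → IntervalIntegrable (fun y => kerT (y / w)) volume 0 Y := fun hw =>
    (intervalIntegrable_iff_integrableOn_Ioc_of_le hY).2
      ((integrableOn_kerT_div hw).mono_set Ioc_subset_Ioi_self)
  rw [intervalIntegral.integral_sub (hii hz) (hii hx), integral_kerT_div hz hY,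
    integral_kerT_div hx hY]
  rcases hY.eq_or_lt with rfl | hY
  · simp
  have := monotoneOn_oddK (mem_Ioi.2 (div_pos hY hz)) (mem_Ioi.2 (div_pos hY hx))
    (div_le_div_of_nonneg_left hY.le hx hxz)
  nlinarith

/-- Split `f = (f - f x)₊ + min f (f x)`. The second part contributes a nonpositive amount to `T f
x`. The first lives on `(0, x]`, where `kerT (y/x) + 1` has primitive `Y oddK (Y/x) ≤ 0`, so pairing
it with `kerT` gives at most minus its own integral. -/
lemma MemD.integral_sub_le (hf : MemD f) {x : ℝ} (hx : 0 < x) :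
    ∫ y in (0 : ℝ)..x, (f y - f x) ≤ -(Real.pi * T f x) := by
  have hmf := hf.continuous.measurable
  set h : ℝ → ℝ := fun y => max (f y - f x) 0 with hh
  set l : ℝ → ℝ := fun y => min (f y) (f x) with hl
  have hsum : ∀ y, f y = h y + l y := fun y => by
    simp only [hh, hl]
    rcases le_total (f y) (f x) with h | h
    · rw [max_eq_right (by linarith), min_eq_left h, zero_add]
    · rw [max_eq_left (by linarith), min_eq_right h]; ring
  have hmh : Measurable h := (hmf.sub_const _).max measurable_const
  have hml : Measurable l := hmf.min measurable_const
  have hh0 : ∀ y, 0 ≤ h y := fun y => le_max_right _ _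
  have hl0 : ∀ y, 0 ≤ l y := fun y => le_min (hf.nonneg y) (hf.nonneg x)
  have hh1 : ∀ y, h y ≤ 1 := fun y => by linarith [hsum y, hl0 y, hf.le_one y]
  have hl1 : ∀ y, l y ≤ 1 := fun y => by linarith [hsum y, hh0 y, hf.le_one y]
  have hhx : ∀ y, x < y → h y = 0 := fun y hy => by
    simp only [hh]; exact max_eq_right (by linarith [hf.anti hx.le hy.le])
  have hih : IntegrableOn (fun y => h y * kerT (y / x)) (Ioi 0) :=
    GCLM.integrableOn_mul_kerT hmh (fun y _ => abs_le.2 ⟨by linarith [hh0 y], hh1 y⟩) hx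
  have hil : IntegrableOn (fun y => l y * kerT (y / x)) (Ioi 0) :=
    GCLM.integrableOn_mul_kerT hml (fun y _ => abs_le.2 ⟨by linarith [hl0 y], hl1 y⟩) hx
  have h1 : Real.pi * T f x =
      (∫ y in Ioi 0, h y * kerT (y / x)) + ∫ y in Ioi 0, l y * kerT (y / x) := by
    rw [← integral_add hih hil, T_eq f hx, ← mul_assoc, mul_one_div_cancel Real.pi_ne_zero, one_mul]
    exact integral_congr_ae (Eventually.of_forall fun y => by
      simp only [← add_mul]; rw [← hsum])
  have h2 : ∫ y in Ioi 0, l y * kerT (y / x) ≤ 0 :=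
    integral_mul_kerT_nonpos (fun y hy z hz hyz => min_le_min_right _ (hf.antitoneOn_Ioi hy hz hyz))
      hml (fun y _ => hl0 y) (fun y _ => hl1 y) hx
  have hik : IntegrableOn (fun y => kerT (y / x) + (Ioc 0 x).indicator (fun _ => (1 : ℝ)) y)
      (Ioc 0 x) :=
    ((integrableOn_kerT_div hx).mono_set Ioc_subset_Ioi_self).add
      ((integrable_indicator_iff measurableSet_Ioc).2 (integrableOn_const (by simp))).integrableOn
  have h3 : ∫ y in Ioi 0, h y * (Ioc 0 x).indicator (fun y => kerT (y / x) + 1) y ≤ 0 := by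
    refine integral_mul_nonpos_of_antitoneOn
      (fun y hy z hz hyz => max_le_max_right _ (sub_le_sub_right (hf.antitoneOn_Ioi hy hz hyz) _))
      hmh (fun y _ => hh0 y) (fun y _ => hh1 y) ?_ fun Y hY => ?_
    · refine Integrable.integrableOn ((integrable_indicator_iff measurableSet_Ioc).2 ?_)
      exact ((integrableOn_kerT_div hx).mono_set Ioc_subset_Ioi_self).add
        (integrableOn_const (by simp))
    · rw [intervalIntegral.integral_of_le hY, setIntegral_indicator measurableSet_Ioc,
        Ioc_inter_Ioc, sup_idem]
      set m := min Y x with hm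
      have hm0 : 0 ≤ m := le_min hY hx.le
      rw [← intervalIntegral.integral_of_le hm0, intervalIntegral.integral_add _ (by simp),
        integral_kerT_div hx hm0]
      · simp only [intervalIntegral.integral_const, smul_eq_mul, sub_zero, mul_one]
        rcases hm0.eq_or_lt with h | h
        · rw [← h]; simp
        · have := oddK_nonpos (div_pos h hx) ((div_le_one hx).2 (min_le_right _ _))
          nlinarith
      · exact (intervalIntegrable_iff_integrableOn_Ioc_of_le hm0).2
          ((integrableOn_kerT_div hx).mono_set Ioc_subset_Ioi_self)
  have h4 : ∫ y in Ioi 0, h y * (Ioc 0 x).indicator (fun y => kerT (y / x) + 1) y =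
      (∫ y in Ioi 0, h y * kerT (y / x)) + ∫ y in (0 : ℝ)..x, (f y - f x) := by
    rw [intervalIntegral.integral_of_le hx.le]
    have hc : ∫ y in Ioc 0 x, (f y - f x) = ∫ y in Ioi 0, (Ioc 0 x).indicator (fun y => f y - f x) y := by
      rw [setIntegral_indicator measurableSet_Ioc, inter_eq_right.2 Ioc_subset_Ioi_self]
    rw [hc, ← integral_add hih]
    · refine setIntegral_congr_fun measurableSet_Ioi fun y (hy : 0 < y) => ?_
      by_cases hyx : y ≤ x
      · have hmem : y ∈ Ioc 0 x := ⟨hy, hyx⟩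
        have : h y = f y - f x := max_eq_left (by linarith [hf.anti hy.le hyx])
        simp only [indicator_of_mem hmem, this]; ring
      · have hmem : y ∉ Ioc 0 x := fun h => hyx h.2
        simp [indicator_of_notMem hmem, hhx y (not_le.1 hyx)]
    · refine Integrable.integrableOn ((integrable_indicator_iff measurableSet_Ioc).2 ?_)
      exact ((hf.continuous.sub continuous_const).integrableOn_Ioc)
  linarith

/-- Let `x → ∞` in `MemD.integral_sub_le` on a fixed interval `(0, X)`, then let `X` grow. -/
lemma MemD.integrableOn_sub_atInfty (hf : MemD f) {B : ℝ} (hB : ∀ x, 0 < x → -B ≤ T f x) :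
    IntegrableOn (fun y => f y - atInfty f) (Ioi 0) := by
  have hc : ∀ a b : ℝ, ∀ w : ℝ, IntervalIntegrable (fun y => f y - w) volume a b := fun a b w =>
    (hf.continuous.sub continuous_const).intervalIntegrable _ _
  have hn : ∀ y, 0 ≤ y → 0 ≤ f y - atInfty f := fun y hy => sub_nonneg.2 (hf.atInfty_le hy)
  have key : ∀ X, 0 ≤ X → ∫ y in (0 : ℝ)..X, (f y - atInfty f) ≤ Real.pi * B := by
    intro X hX
    have hlim : Tendsto (fun x => ∫ y in (0 : ℝ)..X, (f y - f x)) atTop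
        (𝓝 (∫ y in (0 : ℝ)..X, (f y - atInfty f))) := by
      have : ∀ w : ℝ, ∫ y in (0 : ℝ)..X, (f y - w) = (∫ y in (0 : ℝ)..X, f y) - X * w := fun w => by
        rw [intervalIntegral.integral_sub (hf.continuous.intervalIntegrable _ _) (by simp)]
        simp
      simp only [this]
      exact (hf.tendsto.const_mul X).const_sub _
    refine le_of_tendsto hlim ?_
    filter_upwards [eventually_ge_atTop X, eventually_gt_atTop 0] with x hx hx0
    have h1 := hf.integral_sub_le hx0
    rw [← intervalIntegral.integral_add_adjacent_intervals (hc 0 X _) (hc X x _)] at h1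
    have h2 : 0 ≤ ∫ y in X..x, (f y - f x) :=
      intervalIntegral.integral_nonneg hx fun y hy => sub_nonneg.2 (hf.anti (hX.trans hy.1) hy.2)
    have h3 := mul_le_mul_of_nonneg_left (hB x hx0) Real.pi_pos.le
    linarith
  refine integrableOn_Ioi_of_intervalIntegral_norm_bounded (Real.pi * B) 0
    (fun i : ℝ => (hf.continuous.sub continuous_const).integrableOn_Ioc) tendsto_id ?_
  filter_upwards [eventually_ge_atTop 0] with X hX
  refine le_trans (le_of_eq ?_) (key X hX)
  refine intervalIntegral.integral_congr fun y hy => ?_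
  rw [id, uIcc_of_le hX] at hy
  exact Real.norm_of_nonneg (hn y hy.1)

/-- On `[w, 4w]` one has `z + x ≤ 8w`, so `MemD.sub_le` gives the constant `32/3`, rounded up to 11.
The factor `f (w/2)` is kept because it yields integrable majorants once `f` is integrable. -/
lemma MemD.abs_sub_le (hf : MemD f) {w x z : ℝ} (hw : 0 < w) (hx : w ≤ x) (hxz : x ≤ z)
    (hz : z ≤ 4 * w) : |f x - f z| ≤ 11 / w * |x - z| * f (w / 2) := by
  have hx0 := hw.trans_le hx
  rw [abs_of_nonneg (sub_nonneg.2 (hf.anti hx0.le hxz)), abs_of_nonpos (by linarith)]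
  refine (hf.sub_le hx0 hxz).trans ?_
  have h2 : f (x / 2) ≤ f (w / 2) := hf.anti (by positivity) (by linarith)
  have h3 : (z ^ 2 - x ^ 2) * (4 / (3 * x ^ 2)) ≤ 11 / w * -(x - z) := by
    have h4 : 4 / (3 * x ^ 2) ≤ 4 / (3 * w ^ 2) := by gcongr
    calc (z ^ 2 - x ^ 2) * (4 / (3 * x ^ 2)) = (z - x) * ((z + x) * (4 / (3 * x ^ 2))) := by ring
      _ ≤ (z - x) * ((8 * w) * (4 / (3 * w ^ 2))) := by
        gcongr
        linarith
      _ = (z - x) * (32 / 3 / w) := by field_simp; ring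
      _ ≤ (z - x) * (11 / w) := by
        gcongr
        norm_num
      _ = _ := by ring
  have := hf.nonneg (x / 2)
  gcongr
  exact mul_nonneg (by positivity) (by linarith)

lemma MemD.abs_sub_le' (hf : MemD f) {w x z : ℝ} (hw : 0 < w) (hx : w ≤ x) (hx' : x ≤ 4 * w)
    (hz : w ≤ z) (hz' : z ≤ 4 * w) : |f x - f z| ≤ 11 / w * |x - z| * f (w / 2) := by
  rcases le_total x z with h | h
  · exact hf.abs_sub_le hw hx h hz'
  · rw [abs_sub_comm, abs_sub_comm x]; exact hf.abs_sub_le hw hz h hx'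

lemma ae_comp_mul {p : ℝ → Prop} (hp : ∀ᵐ y ∂volume.restrict (Ioi 0), p y) {x : ℝ} (hx : 0 < x) :
    ∀ᵐ z ∂volume.restrict (Ioi 0), p (x * z) := by
  rw [ae_restrict_iff' measurableSet_Ioi, ae_iff] at hp ⊢
  have h := Real.volume_preimage_mul_left hx.ne' {a | ¬(a ∈ Ioi (0 : ℝ) → p a)}
  rw [hp, mul_zero] at h
  refine measure_mono_null (fun z hz => ?_) h
  simp only [mem_ofPred_eq, mem_Ioi, preimage_ofPred_eq, mul_pos_iff_of_pos_left hx] at hz ⊢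
  exact hz

/-- Differentiation under the integral in `T_eq_scaled`. The window `[x/2, 2x]` times `z` is an
interval `[w, 4w]` with `w = xz/2`, which gives the majorant `(22/x) |kerT z|`. -/
lemma MemD.differentiableAt_T (hf : MemD f) {x : ℝ} (hx : 0 < x) : DifferentiableAt ℝ (T f) x := by
  have hmf := hf.continuous.measurable
  have hmk := measurable_kerT
  have hD := ae_comp_mul hf.ae_differentiableAt hx
  have h := hasDerivAt_integral_of_dominated_loc_of_lip (μ := volume.restrict (Ioi 0)) (𝕜 := ℝ)
    (F := fun x z => f (x * z) * kerT z) (x₀ := x) (s := Icc (x / 2) (2 * x))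
    (bound := fun z => 22 / x * |kerT z|)
    (F' := fun z => z * deriv f (x * z) * kerT z) (Icc_mem_nhds (by linarith) (by linarith))
    (Eventually.of_forall fun w => Measurable.aestronglyMeasurable (by fun_prop))
    ?_ (by have := measurable_deriv f; exact Measurable.aestronglyMeasurable (by fun_prop)) ?_
    (integrableOn_kerT.abs.const_mul _) ?_
  · have h2 : HasDerivAt (fun x => x / Real.pi * ∫ z in Ioi (0 : ℝ), f (x * z) * kerT z) _ x :=
      ((hasDerivAt_id x).div_const Real.pi).mul h.2
    refine (h2.congr_of_eventuallyEq ?_).differentiableAt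
    filter_upwards [Ioi_mem_nhds hx] with w hw using T_eq_scaled f hw
  · refine Integrable.mono' integrableOn_kerT.norm
      (Measurable.aestronglyMeasurable (by fun_prop)) (Eventually.of_forall fun z => ?_)
    rw [norm_mul]
    exact mul_le_of_le_one_left (norm_nonneg _) (hf.abs_le_one _)
  · filter_upwards [ae_restrict_mem measurableSet_Ioi] with z (hz : 0 < z)
    refine LipschitzOnWith.of_dist_le_mul fun u hu v hv => ?_
    rw [Real.coe_nnabs, abs_of_nonneg (by positivity), Real.dist_eq, Real.dist_eq, ← sub_mul, abs_mul]
    have := hf.abs_sub_le' (w := x / 2 * z) (x := u * z) (z := v * z) (by positivity)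
      (by have := hu.1; gcongr) (by nlinarith [hu.2]) (by have := hv.1; gcongr) (by nlinarith [hv.2])
    have h1 := hf.le_one (x / 2 * z / 2)
    have h2 : 11 / (x / 2 * z) * |u * z - v * z| = 22 / x * |u - v| := by
      rw [← sub_mul, abs_mul, abs_of_pos hz]; field_simp; ring
    rw [h2] at this
    calc |f (u * z) - f (v * z)| * |kerT z| ≤ (22 / x * |u - v| * 1) * |kerT z| := by
          gcongr; exact this.trans (by gcongr)
      _ = _ := by ring
  · filter_upwards [hD] with z hz
    have h1 : HasDerivAt (fun w : ℝ => w * z) z x := by simpa using (hasDerivAt_id x).mul_const z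
    have h2 := (hz.hasDerivAt.comp x h1).mul_const (kerT z)
    exact h2.congr_deriv (by ring)

lemma MemD.continuousOn_T (hf : MemD f) : ContinuousOn (T f) (Ici 0) := by
  intro x (hx : 0 ≤ x)
  rcases hx.eq_or_lt with rfl | hx
  · rw [ContinuousWithinAt, T_zero]
    have h2 : Tendsto (fun r : ℝ => r * ((∫ z in Ioi 0, |kerT z|) / Real.pi)) (𝓝[≥] 0) (𝓝 0) := by
      have : Tendsto (fun r : ℝ => r * ((∫ z in Ioi 0, |kerT z|) / Real.pi)) (𝓝 0) (𝓝 (0 * _)) :=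
        Continuous.tendsto (by fun_prop) 0
      rw [zero_mul] at this
      exact this.mono_left nhdsWithin_le_nhds
    refine squeeze_zero_norm' ?_ h2
    filter_upwards [self_mem_nhdsWithin] with r (hr : 0 ≤ r)
    rcases hr.eq_or_lt with rfl | hr
    · simp [T_zero]
    · exact hf.abs_T_le hr
  · exact (hf.differentiableAt_T hx).continuousAt.continuousWithinAt

end T

/-! ### Decay of integrable antitone functions -/

section Antitone

variable {h : ℝ → ℝ}

lemma mul_le_integral_of_antitoneOn (ha : AntitoneOn h (Ioi 0)) (h0 : ∀ y, 0 < y → 0 ≤ h y)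
    (hi : IntegrableOn h (Ioi 0)) {x : ℝ} (hx : 0 < x) : x * h x ≤ ∫ y in Ioi 0, h y := by
  have h1 : ∫ y in Ioc 0 x, h x ≤ ∫ y in Ioc 0 x, h y :=
    setIntegral_mono_on (integrableOn_const (by simp)) (hi.mono_set Ioc_subset_Ioi_self)
      measurableSet_Ioc fun y hy => ha hy.1 hx hy.2
  have h2 : ∫ y in Ioc 0 x, h y ≤ ∫ y in Ioi 0, h y :=
    setIntegral_mono_set hi (by
      filter_upwards [ae_restrict_mem measurableSet_Ioi] with y hy using h0 y hy)
      Ioc_subset_Ioi_self.eventuallyLE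
  rw [setIntegral_const] at h1
  simp [hx.le] at h1
  exact h1.trans h2

/-- `x h(x)` is at most twice the integral of `h` over `[x/2, x]`, which tends to 0. -/
lemma tendsto_mul_of_antitoneOn (ha : AntitoneOn h (Ioi 0)) (h0 : ∀ y, 0 < y → 0 ≤ h y)
    (hi : IntegrableOn h (Ioi 0)) : Tendsto (fun x => x * h x) atTop (𝓝 0) := by
  have h1 := intervalIntegral_tendsto_integral_Ioi 0 hi tendsto_id
  have h2 := intervalIntegral_tendsto_integral_Ioi 0 hi
    (tendsto_id.atTop_div_const (show (0 : ℝ) < 2 by norm_num))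
  have h3 := (h1.sub h2).const_mul 2
  rw [sub_self, mul_zero] at h3
  have hii : ∀ a b : ℝ, 0 ≤ a → 0 ≤ b → IntervalIntegrable h volume a b := fun a b h1 h2 =>
    intervalIntegrable_iff.2 (hi.mono_set fun y hy => lt_of_le_of_lt (le_min h1 h2) hy.1)
  refine squeeze_zero' ?_ ?_ h3
  · filter_upwards [eventually_gt_atTop 0] with x hx using mul_nonneg hx.le (h0 x hx)
  · filter_upwards [eventually_gt_atTop 0] with x hx
    simp only [id]
    rw [intervalIntegral.integral_interval_sub_left (hii _ _ le_rfl hx.le)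
      (hii _ _ le_rfl (by positivity))]
    have h4 : ∫ y in (x / 2)..x, h x ≤ ∫ y in (x / 2)..x, h y :=
      intervalIntegral.integral_mono_on (by linarith) (by simp) (hii _ _ (by positivity) hx.le)
        fun y hy => ha (mem_Ioi.2 ((half_pos hx).trans_le hy.1)) hx hy.2
    rw [intervalIntegral.integral_const, smul_eq_mul] at h4
    linarith

end Antitone

/-! ### Fixed points of `R_a` -/

section FixedPoint

variable {f : ℝ → ℝ} {a : ℝ}

/-- The denominator `(1 - a / 3) c(f)`. -/
def den (a : ℝ) (f : ℝ → ℝ) : ℝ := (1 - a / 3) * c f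

/-- `T_a(f)` before taking the positive part. -/
def preT (a : ℝ) (f : ℝ → ℝ) (x : ℝ) : ℝ := 1 + 2 * a / den a f * T f x

lemma Ta_eq (a : ℝ) (f : ℝ → ℝ) (x : ℝ) : Ta a f x = max (preT a f x) 0 := by
  unfold Ta preT den
  congr 2
  ring

lemma Ta_zero (a : ℝ) (f : ℝ → ℝ) : Ta a f 0 = 1 := by simp [Ta, T_zero]

lemma MemD.den_pos (hf : MemD f) (ha : a ≤ 1) : 0 < den a f := mul_pos (by linarith) hf.c_pos

/-- `preT` is antitone for `a ≥ 0` and at least 1 for `a ≤ 0`, so positivity at `x` propagates, with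
a uniform lower bound, to all of `[0, x]`. -/
lemma MemD.min_le_preT (hf : MemD f) (ha : a ≤ 1) {x y : ℝ} (hy : 0 ≤ y) (hyx : y ≤ x) :
    min 1 (preT a f x) ≤ preT a f y := by
  have hd := hf.den_pos ha
  have h1 := hf.T_nonpos hy
  have h2 := hf.T_antitone hy hyx
  unfold preT
  rcases le_total 0 a with h | h
  · refine (min_le_right _ _).trans ?_
    have : 0 ≤ 2 * a / den a f := by positivity
    nlinarith
  · refine (min_le_left _ _).trans ?_
    have : 2 * a / den a f ≤ 0 := div_nonpos_of_nonpos_of_nonneg (by linarith) hd.le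
    nlinarith

/-- The common integrand in the exponents of `R_a`. -/
def expInt (a : ℝ) (f : ℝ → ℝ) (y : ℝ) : ℝ := T f y / (y * preT a f y)

lemma MemD.continuousOn_preT (hf : MemD f) (a : ℝ) : ContinuousOn (preT a f) (Ici 0) :=
  continuousOn_const.add (continuousOn_const.mul hf.continuousOn_T)

lemma MemD.isOpen_pos (hf : MemD f) (a : ℝ) : IsOpen (Ioi 0 ∩ {x | 0 < preT a f x}) :=
  ((hf.continuousOn_preT a).mono Ioi_subset_Ici_self).isOpen_inter_preimage isOpen_Ioi isOpen_Ioi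

lemma MemD.continuousOn_expInt (hf : MemD f) (a : ℝ) :
    ContinuousOn (expInt a f) (Ioi 0 ∩ {x | 0 < preT a f x}) := by
  refine ContinuousOn.div (hf.continuousOn_T.mono fun x hx => (mem_Ioi.1 hx.1).le)
    (continuousOn_id.mul ((hf.continuousOn_preT a).mono fun x hx => (mem_Ioi.1 hx.1).le)) fun x hx => ?_
  exact mul_ne_zero (ne_of_gt hx.1) (ne_of_gt hx.2)

lemma MemD.intervalIntegrable_expInt (hf : MemD f) (ha : a ≤ 1) {x : ℝ} (hx : 0 < x)
    (hpos : 0 < preT a f x) : IntervalIntegrable (expInt a f) volume 0 x := by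
  rw [intervalIntegrable_iff_integrableOn_Ioc_of_le hx.le]
  set m := min 1 (preT a f x)
  have hm : 0 < m := lt_min one_pos hpos
  have hsub : Ioc 0 x ⊆ Ioi 0 ∩ {x | 0 < preT a f x} := fun y hy =>
    ⟨hy.1, hm.trans_le (hf.min_le_preT ha hy.1.le hy.2)⟩
  refine Integrable.mono' (g := fun _ => (∫ z in Ioi 0, |kerT z|) / Real.pi / m)
    (integrableOn_const (by simp))
    (((hf.continuousOn_expInt a).mono hsub).aestronglyMeasurable measurableSet_Ioc) ?_
  filter_upwards [ae_restrict_mem measurableSet_Ioc] with y hy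
  have h1 := hf.abs_T_le hy.1
  have h2 := hf.min_le_preT ha hy.1.le hy.2
  have hy0 := hy.1
  have hp : 0 < preT a f y := hm.trans_le h2
  rw [expInt, Real.norm_eq_abs, abs_div, abs_of_pos (mul_pos hy0 hp),
    div_le_div_iff₀ (mul_pos hy0 hp) hm]
  calc |T f y| * m ≤ (y * ((∫ z in Ioi 0, |kerT z|) / Real.pi)) * preT a f y := by gcongr
    _ = _ := by ring

/-- The local factor of `R_a` as a function of the value of `T`. -/
def locFac (a d t : ℝ) : ℝ :=
  if a = 0 then Real.exp (2 / d * t) else (1 + 2 * a / d * t) ^ (1 / a)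

lemma hasDerivAt_locFac {d t : ℝ} (hd : 0 < d) (hpos : 0 < 1 + 2 * a / d * t) :
    HasDerivAt (locFac a d) (locFac a d t * (2 / d / (1 + 2 * a / d * t))) t := by
  unfold locFac
  rcases eq_or_ne a 0 with rfl | ha
  · simp only [if_true]
    have h := ((hasDerivAt_id t).const_mul (2 / d)).exp
    refine h.congr_deriv ?_
    simp
  · simp only [if_neg ha]
    have h := (((hasDerivAt_id t).const_mul (2 * a / d)).const_add 1).rpow_const (p := 1 / a)
      (Or.inl hpos.ne')
    refine h.congr_deriv ?_
    simp only [id]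
    rw [Real.rpow_sub_one hpos.ne']
    field_simp

/-- The factor `a` in `T_a - 1` cancels the `1/a` of the exponent, so `a = 0` and `a ≠ 0` share one
formula for the exponent. -/
lemma MemD.R_eq (hf : MemD f) (ha : a ≤ 1) {x : ℝ} (hx : 0 < x) (hpos : 0 < preT a f x) :
    R a f x = locFac a (den a f) (T f x) *
      Real.exp (2 * (1 - a) / den a f * ∫ y in (0 : ℝ)..x, expInt a f y) := by
  have hd := hf.den_pos ha
  unfold R locFac
  rcases eq_or_ne a 0 with rfl | h0
  · simp only [if_true, ← Real.exp_add]
    have : ∀ y, expInt 0 f y = T f y / y := fun y => by simp [expInt, preT]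
    simp only [this]
    simp [den]
    ring
  · simp only [if_neg h0]
    rw [Ta_eq, max_eq_left hpos.le, Ta_zero]
    congr 2
    have : ∫ y in (0 : ℝ)..x, (Ta a f y - 1) / (y * Ta a f y) =
        ∫ y in (0 : ℝ)..x, 2 * a / den a f * expInt a f y := by
      refine intervalIntegral.integral_congr_ae (Eventually.of_forall fun y hy => ?_)
      rw [uIoc_of_le hx.le] at hy
      have hp : 0 < preT a f y :=
        (lt_min one_pos hpos).trans_le (hf.min_le_preT ha hy.1.le hy.2)
      rw [Ta_eq, max_eq_left hp.le, expInt, ← mul_div_assoc]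
      congr 1
      unfold preT
      ring
    rw [this, intervalIntegral.integral_const_mul]
    field_simp

lemma MemD.R_eq_zero {x : ℝ} (hpos : preT a f x ≤ 0) : R a f x = 0 := by
  have h0 : a ≠ 0 := by
    rintro rfl
    simp [preT] at hpos
    linarith
  rw [R, if_neg h0, Ta_eq, max_eq_right hpos, Real.zero_rpow (one_div_ne_zero h0), zero_mul]

/-- A fixed point inherits differentiability from `T f` through the formula for `R`. -/
lemma MemD.hasDerivAt_of_fixed (hf : MemD f) (ha : a ≤ 1) (hfix : R a f = f) {x : ℝ} (hx : 0 < x)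
    (hpos : 0 < preT a f x) :
    HasDerivAt f (f x * (2 / den a f * (x * deriv (T f) x + (1 - a) * T f x) / (x * preT a f x)))
      x := by
  have hd := hf.den_pos ha
  have hU := (hf.isOpen_pos a).mem_nhds (⟨hx, hpos⟩ : x ∈ Ioi 0 ∩ {x | 0 < preT a f x})
  have hI : HasDerivAt (fun x => ∫ y in (0 : ℝ)..x, expInt a f y) (expInt a f x) x :=
    intervalIntegral.integral_hasDerivAt_right (hf.intervalIntegrable_expInt ha hx hpos)
      ((hf.continuousOn_expInt a).stronglyMeasurableAtFilter (hf.isOpen_pos a) x ⟨hx, hpos⟩)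
      ((hf.continuousOn_expInt a).continuousAt hU)
  have hT := (hf.differentiableAt_T hx).hasDerivAt
  have hL := (hasDerivAt_locFac hd hpos).comp x hT
  have h := hL.mul (hI.const_mul (2 * (1 - a) / den a f)).exp
  have hfx : f x = _ := (congrFun hfix x).symm.trans (hf.R_eq ha hx hpos)
  have h2 : HasDerivAt f _ x := h.congr_of_eventuallyEq (by
    filter_upwards [hU] with y hy
    exact (congrFun hfix y).symm.trans (hf.R_eq ha hy.1 hy.2))
  refine h2.congr_deriv ?_
  rw [hfx]
  simp only [Function.comp, expInt]
  have hp : 1 + 2 * a / den a f * T f x = preT a f x := rfl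
  rw [hp]
  field_simp

lemma MemD.deriv_T_nonpos (hf : MemD f) {x : ℝ} (hx : 0 < x) : deriv (T f) x ≤ 0 := by
  have h : AntitoneOn (T f) (Ioi 0) := fun y hy z _ hyz => hf.T_antitone (le_of_lt hy) hyz
  rw [← derivWithin_of_mem_nhds (Ioi_mem_nhds hx)]
  exact h.derivWithin_nonpos

/-- `x^p f(x)` is nonincreasing on `[X, ∞)`: in its derivative the term with `(T f)'` is
nonpositive, and `hp` controls the rest. -/
lemma MemD.decay (hf : MemD f) (ha : a ≤ 1) (hfix : R a f = f) {X p : ℝ} (hX : 0 < X)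
    (hpos : ∀ x, X ≤ x → 0 < preT a f x)
    (hp : ∀ x, X ≤ x → p * preT a f x ≤ -(2 * (1 - a) / den a f * T f x)) {x : ℝ} (hx : X ≤ x) :
    f x ≤ f X * X ^ p * x ^ (-p) := by
  have hd := hf.den_pos ha
  have hder : ∀ y, X ≤ y → HasDerivAt (fun y => y ^ p * f y)
      (p * y ^ (p - 1) * f y + y ^ p *
        (f y * (2 / den a f * (y * deriv (T f) y + (1 - a) * T f y) / (y * preT a f y)))) y :=
    fun y hy => ((Real.hasDerivAt_rpow_const (Or.inl (hX.trans_le hy).ne'))).mul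
      (hf.hasDerivAt_of_fixed ha hfix (hX.trans_le hy) (hpos y hy))
  have hanti : AntitoneOn (fun y => y ^ p * f y) (Ici X) := by
    refine antitoneOn_of_deriv_nonpos (convex_Ici X)
      (fun y hy => (hder y hy).continuousAt.continuousWithinAt) (fun y hy => ?_) fun y hy => ?_ <;>
      rw [interior_Ici] at hy
    · exact (hder y (le_of_lt hy)).differentiableAt.differentiableWithinAt
    · have hy0 : 0 < y := hX.trans hy
      have hpy := hpos y (le_of_lt hy)
      rw [(hder y (le_of_lt hy)).deriv, Real.rpow_sub_one hy0.ne']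
      have h1 := hp y (le_of_lt hy)
      have h2 : 2 / den a f * (y * deriv (T f) y) ≤ 0 :=
        mul_nonpos_of_nonneg_of_nonpos (by positivity)
          (mul_nonpos_of_nonneg_of_nonpos hy0.le (hf.deriv_T_nonpos hy0))
      have h3 : p * (y ^ p / y) * f y + y ^ p *
          (f y * (2 / den a f * (y * deriv (T f) y + (1 - a) * T f y) / (y * preT a f y))) =
          (y ^ p * f y / (y * preT a f y)) * (p * preT a f y + 2 * (1 - a) / den a f * T f y +
            2 / den a f * (y * deriv (T f) y)) := by
        field_simp
        ring
      rw [h3]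
      have := hf.nonneg y
      exact mul_nonpos_of_nonneg_of_nonpos (by positivity) (by linarith)
  have h := hanti self_mem_Ici hx hx
  have hx0 := hX.trans_le hx
  have hxp : 0 < x ^ p := Real.rpow_pos_of_pos hx0 p
  rw [Real.rpow_neg hx0.le, ← div_eq_mul_inv, le_div_iff₀ hxp]
  simp only at h
  linarith

lemma MemD.T_one_neg (hf : MemD f) : T f 1 < 0 := by
  have h := hf.integral_sub_le one_pos
  have h1 : 0 < ∫ y in (0 : ℝ)..1, (f y - f 1) := by
    refine intervalIntegral.integral_pos one_pos
      (hf.continuous.sub continuous_const).continuousOn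
      (fun y hy => sub_nonneg.2 (hf.anti hy.1.le hy.2)) ⟨0, by simp, ?_⟩
    rw [hf.map_zero]
    have := hf.anti (show (0 : ℝ) ≤ 1 / 2 by norm_num) (show (1 / 2 : ℝ) ≤ 1 by norm_num)
    linarith [hf.lt_one]
  have := Real.pi_pos
  nlinarith

lemma MemD.integrableOn_of_decay (hf : MemD f) {X p B : ℝ} (hX : 0 < X) (hp : 1 < p)
    (h : ∀ x, X ≤ x → f x ≤ B * x ^ (-p)) : IntegrableOn f (Ioi 0) := by
  rw [← Ioc_union_Ioi_eq_Ioi hX.le]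
  refine hf.continuous.integrableOn_Ioc.union ?_
  refine Integrable.mono' ((integrableOn_Ioi_rpow_of_lt (show -p < -1 by linarith) hX).const_mul B)
    hf.continuous.aestronglyMeasurable ?_
  filter_upwards [ae_restrict_mem measurableSet_Ioi] with x (hx : X < x)
  rw [Real.norm_of_nonneg (hf.nonneg x)]
  exact h x hx.le

lemma MemD.tendsto_zero_of_decay (hf : MemD f) {X p B : ℝ} (hp : 0 < p)
    (h : ∀ x, X ≤ x → f x ≤ B * x ^ (-p)) : Tendsto f atTop (𝓝 0) := by
  have h1 := (tendsto_rpow_neg_atTop hp).const_mul B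
  rw [mul_zero] at h1
  refine squeeze_zero' (Eventually.of_forall hf.nonneg) ?_ h1
  filter_upwards [eventually_ge_atTop X] with x hx using h x hx

lemma MemD.tendsto_zero_of_integrableOn (hf : MemD f) (hi : IntegrableOn f (Ioi 0)) :
    Tendsto f atTop (𝓝 0) := by
  have h := tendsto_mul_of_antitoneOn hf.antitoneOn_Ioi (fun y _ => hf.nonneg y) hi
  refine squeeze_zero' (Eventually.of_forall hf.nonneg) ?_ h
  filter_upwards [eventually_ge_atTop 1] with x hx
  exact le_mul_of_one_le_left (hf.nonneg x) hx

lemma MemD.integrableOn_of_bounded_of_tendsto (hf : MemD f) {B : ℝ}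
    (hB : ∀ x, 0 < x → -B ≤ T f x) (h0 : Tendsto f atTop (𝓝 0)) : IntegrableOn f (Ioi 0) := by
  have h := hf.integrableOn_sub_atInfty hB
  rw [tendsto_nhds_unique hf.tendsto h0] at h
  simpa using h

/-- Dichotomy on whether `T f` is bounded below. If so, any positive decay exponent suffices, since
`f - f(+∞)` is already integrable; if not, the decay exponent must exceed 1. -/
lemma MemD.integrableOn_of_fixed_of_lt (hf : MemD f) (ha : a < 1) (hfix : R a f = f)
    (hpos : ∀ x, 0 < x → 0 < preT a f x) : IntegrableOn f (Ioi 0) := by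
  have hd := hf.den_pos ha.le
  by_cases hB : ∃ B, ∀ x, 0 < x → -B ≤ T f x
  · obtain ⟨B, hB⟩ := hB
    have hB0 : 0 < B := by linarith [hB 1 one_pos, hf.T_one_neg]
    refine hf.integrableOn_of_bounded_of_tendsto hB ?_
    -- An upper bound for `preT`; the exponent `p` below is `2(1 - a)(-T f 1)/(den · D)`, using `T f
    -- x ≤ T f 1 < 0` for `x ≥ 1`.
    set D := 1 + |2 * a / den a f| * B
    have hD : 0 < D := by positivity
    have hT1 := hf.T_one_neg
    have hk : 0 < 2 * (1 - a) / den a f := div_pos (by linarith) hd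
    refine hf.tendsto_zero_of_decay (X := 1) (p := 2 * (1 - a) / den a f * (-T f 1) / D)
      (div_pos (mul_pos hk (by linarith)) hD) fun x hx =>
      hf.decay ha.le hfix one_pos (fun x hx => hpos x (one_pos.trans_le hx)) (fun x hx => ?_) hx
    have hx0 : 0 < x := one_pos.trans_le hx
    have h1 := hf.T_antitone zero_le_one hx
    have h2 : preT a f x ≤ D := by
      have h3 : |T f x| ≤ B := abs_le.2 ⟨hB x hx0, by linarith [hf.T_nonpos hx0.le]⟩
      have h4 := le_abs_self (2 * a / den a f * T f x)
      rw [abs_mul] at h4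
      have h5 : |2 * a / den a f| * |T f x| ≤ |2 * a / den a f| * B := by gcongr
      simp only [preT, D]
      linarith
    calc 2 * (1 - a) / den a f * (-T f 1) / D * preT a f x
        ≤ 2 * (1 - a) / den a f * (-T f 1) / D * D := by
          have : 0 ≤ -T f 1 := by linarith
          gcongr
      _ = 2 * (1 - a) / den a f * (-T f 1) := by field_simp
      _ ≤ _ := by nlinarith
  · push Not at hB
    have ha0 : a ≤ 0 := by
      by_contra! h
      obtain ⟨x, hx, hlt⟩ := hB (den a f / (2 * a))
      have h1 := hpos x hx
      have h2 : 0 < 2 * a / den a f := by positivity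
      have h3 : 2 * a / den a f * T f x < 2 * a / den a f * -(den a f / (2 * a)) := by gcongr
      have h4 : 2 * a / den a f * -(den a f / (2 * a)) = -1 := by field_simp
      unfold preT at h1
      linarith
    obtain ⟨X, hX, hlt⟩ := hB (2 * den a f)
    -- With `T f x = -τ den` the decay condition is `p (1 - 2aτ) ≤ 2(1 - a)τ`. Since `-a p ≤ -a +
    -- 1/2`, it follows from `p ≤ τ`, which holds because `p ≤ 3/2` and `τ ≥ 2` past `X`.
    set p : ℝ := 1 + 1 / (2 * (1 - a)) with hp
    have h1a : 0 < 1 - a := by linarith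
    have hp1 : 1 < p := by
      have : 0 < 1 / (2 * (1 - a)) := by positivity
      linarith
    refine hf.integrableOn_of_decay hX hp1 fun x hx =>
      hf.decay ha.le hfix hX (fun x hx => hpos x (hX.trans_le hx)) (fun x hx => ?_) hx
    have hTx := (hf.T_antitone hX.le hx).trans hlt.le
    set τ := -T f x / den a f with hτ
    have hT : T f x = -(τ * den a f) := by rw [hτ]; field_simp
    have hτ2 : 2 ≤ τ := by
      rw [hτ, le_div_iff₀ hd]; linarith
    have hpa : p * -a ≤ -a + 1 / 2 := by
      have : 1 / (2 * (1 - a)) * -a ≤ 1 / 2 := by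
        rw [one_div_mul_eq_div, div_le_iff₀ (by positivity)]; linarith
      rw [hp]; linarith
    have hp2 : p ≤ 3 / 2 := by
      have : 1 / (2 * (1 - a)) ≤ 1 / 2 := by
        apply one_div_le_one_div_of_le <;> linarith
      linarith
    have e1 : preT a f x = 1 + 2 * -a * τ := by
      rw [preT, hT]; field_simp
    have e2 : -(2 * (1 - a) / den a f * T f x) = 2 * (1 - a) * τ := by
      rw [hT]; field_simp
    rw [e1, e2]
    nlinarith

lemma MemD.T_eq_sub (hf : MemD f) (w : ℝ) {x : ℝ} (hx : 0 < x) :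
    Real.pi * T f x = ∫ y in Ioi 0, (f y - w) * kerT (y / x) := by
  have hk : ∫ y in Ioi 0, kerT (y / x) = 0 := by
    have h := integral_comp_mul_left_Ioi kerT 0 (inv_pos.2 hx)
    simp only [mul_zero, integral_kerT, smul_zero] at h
    simpa [div_eq_inv_mul] using h
  simp only [sub_mul]
  rw [integral_sub (hf.integrableOn_mul_kerT hx) ((integrableOn_kerT_div hx).const_mul w),
    integral_const_mul, hk, T_eq f hx]
  field_simp
  ring

end FixedPoint

/-! ### The even part of the kernel -/

section EvenPart

variable {g : ℝ → ℝ}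

/-- This form pairs `y g(y)`, bounded by `∫ g` and vanishing at infinity for antitone integrable `g
≥ 0`, with the integrable `evenK r / r`. Boundedness and decay of the even potential follow. -/
lemma integral_mul_evenK_eq (g : ℝ → ℝ) {x : ℝ} (hx : 0 < x) :
    ∫ y in Ioi 0, g y * evenK (y / x) = ∫ r in Ioi 0, (x * r * g (x * r)) * (evenK r / r) := by
  have h := integral_comp_mul_left_Ioi (fun y => g y * evenK (y / x)) 0 hx
  simp only [mul_zero, mul_div_cancel_left₀ _ hx.ne', smul_eq_mul] at h
  rw [eq_inv_mul_iff_mul_eq₀ hx.ne', ← integral_const_mul] at h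
  rw [← h]
  refine setIntegral_congr_fun measurableSet_Ioi fun r (hr : 0 < r) => ?_
  field_simp

lemma integrableOn_mul_evenK (hm : Measurable g) (ha : AntitoneOn g (Ioi 0))
    (h0 : ∀ y, 0 < y → 0 ≤ g y) (hi : IntegrableOn g (Ioi 0)) {x : ℝ} (hx : 0 < x) :
    IntegrableOn (fun y => g y * evenK (y / x)) (Ioi 0) := by
  have hme := measurable_evenK
  rw [← mul_zero x, ← integrableOn_Ioi_comp_mul_left_iff _ 0 hx]
  simp only [mul_div_cancel_left₀ _ hx.ne']
  refine Integrable.mono' ((integrableOn_evenK_div.norm.const_mul (∫ y in Ioi 0, g y)).const_mul x⁻¹)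
    (Measurable.aestronglyMeasurable (by fun_prop)) ?_
  filter_upwards [ae_restrict_mem measurableSet_Ioi] with r (hr : 0 < r)
  have h1 := mul_le_integral_of_antitoneOn ha h0 hi (mul_pos hx hr)
  have h2 := h0 _ (mul_pos hx hr)
  rw [norm_mul, norm_div, Real.norm_of_nonneg h2, Real.norm_of_nonneg hr.le]
  calc g (x * r) * ‖evenK r‖ = x⁻¹ * ((x * r * g (x * r)) * (‖evenK r‖ / r)) := by field_simp
    _ ≤ _ := by gcongr

lemma abs_integral_mul_evenK_le (ha : AntitoneOn g (Ioi 0))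
    (h0 : ∀ y, 0 < y → 0 ≤ g y) (hi : IntegrableOn g (Ioi 0)) {x : ℝ} (hx : 0 < x) :
    |∫ y in Ioi 0, g y * evenK (y / x)| ≤ (∫ y in Ioi 0, g y) * ∫ r in Ioi 0, |evenK r / r| := by
  rw [integral_mul_evenK_eq g hx, ← integral_const_mul, ← Real.norm_eq_abs]
  refine norm_integral_le_of_norm_le (integrableOn_evenK_div.abs.const_mul _) ?_
  filter_upwards [ae_restrict_mem measurableSet_Ioi] with r (hr : 0 < r)
  have h1 := mul_le_integral_of_antitoneOn ha h0 hi (mul_pos hx hr)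
  have h2 := h0 _ (mul_pos hx hr)
  rw [norm_mul, Real.norm_of_nonneg (by positivity), Real.norm_eq_abs]
  gcongr

lemma tendsto_integral_mul_evenK (hm : Measurable g) (ha : AntitoneOn g (Ioi 0))
    (h0 : ∀ y, 0 < y → 0 ≤ g y) (hi : IntegrableOn g (Ioi 0)) :
    Tendsto (fun x => ∫ y in Ioi 0, g y * evenK (y / x)) atTop (𝓝 0) := by
  have hme := measurable_evenK
  have hlim : Tendsto (fun x : ℝ => ∫ r in Ioi 0, (x * r * g (x * r)) * (evenK r / r)) atTop
      (𝓝 (∫ _ in Ioi (0 : ℝ), (0 : ℝ))) := by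
    refine tendsto_integral_filter_of_dominated_convergence
      (fun r => (∫ y in Ioi 0, g y) * |evenK r / r|)
      (Eventually.of_forall fun x => Measurable.aestronglyMeasurable (by fun_prop)) ?_
      (integrableOn_evenK_div.abs.const_mul _) ?_
    · filter_upwards [eventually_gt_atTop 0] with x hx
      filter_upwards [ae_restrict_mem measurableSet_Ioi] with r (hr : 0 < r)
      have h1 := mul_le_integral_of_antitoneOn ha h0 hi (mul_pos hx hr)
      have h2 := h0 _ (mul_pos hx hr)
      rw [norm_mul, Real.norm_of_nonneg (by positivity), Real.norm_eq_abs]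
      gcongr
    · filter_upwards [ae_restrict_mem measurableSet_Ioi] with r (hr : 0 < r)
      have h := ((tendsto_mul_of_antitoneOn ha h0 hi).comp
        (tendsto_id.atTop_mul_const hr)).mul_const (evenK r / r)
      rw [zero_mul] at h
      exact h
  rw [integral_zero] at hlim
  refine hlim.congr' ?_
  filter_upwards [eventually_gt_atTop 0] with x hx using (integral_mul_evenK_eq g hx).symm

lemma ae_pos : ∀ᵐ y : ℝ ∂volume.restrict (Ioi 0), 0 < y := ae_restrict_mem measurableSet_Ioi

lemma integrableOn_mul_oddK (hm : Measurable g) (hi : IntegrableOn g (Ioi 0)) {x : ℝ} (hx : 0 < x) :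
    IntegrableOn (fun y => g y * oddK (y / x)) (Ioi 0) := by
  have hmo := measurable_oddK
  refine Integrable.mono' hi.norm (Measurable.aestronglyMeasurable (by fun_prop)) ?_
  filter_upwards [ae_pos] with y hy
  rw [norm_mul]
  exact mul_le_of_le_one_right (norm_nonneg _) (abs_oddK_le (div_pos hy hx))

lemma tendsto_integral_mul_oddK (hm : Measurable g) (hi : IntegrableOn g (Ioi 0)) :
    Tendsto (fun x => ∫ y in Ioi 0, g y * oddK (y / x)) atTop (𝓝 (-∫ y in Ioi 0, g y)) := by
  have hmo := measurable_oddK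
  rw [← integral_neg]
  refine tendsto_integral_filter_of_dominated_convergence (fun y => ‖g y‖)
    (Eventually.of_forall fun x => Measurable.aestronglyMeasurable (by fun_prop)) ?_ hi.norm ?_
  · filter_upwards [eventually_gt_atTop 0] with x hx
    filter_upwards [ae_pos] with y hy
    rw [norm_mul]
    exact mul_le_of_le_one_right (norm_nonneg _) (abs_oddK_le (div_pos hy hx))
  · filter_upwards [ae_pos] with y hy
    have h1 : Tendsto (fun x => y / x) atTop (𝓝[>] 0) := by
      refine tendsto_nhdsWithin_iff.2 ⟨tendsto_const_nhds.div_atTop tendsto_id, ?_⟩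
      filter_upwards [eventually_gt_atTop 0] with x hx using div_pos hy hx
    have := (tendsto_oddK_zero.comp h1).const_mul (g y)
    rw [mul_neg_one] at this
    exact this

lemma integral_mul_kerT_eq (hm : Measurable g) (ha : AntitoneOn g (Ioi 0))
    (h0 : ∀ y, 0 < y → 0 ≤ g y) (hi : IntegrableOn g (Ioi 0)) {x : ℝ} (hx : 0 < x) :
    ∫ y in Ioi 0, g y * kerT (y / x) = (∫ y in Ioi 0, g y * evenK (y / x)) +
      (∫ y in Ioi 0, g y * oddK (y / x)) - ∫ y in Ioi 0, g y := by
  have h1 := integrableOn_mul_evenK hm ha h0 hi hx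
  have h2 := integrableOn_mul_oddK hm hi hx
  have h3 : IntegrableOn (fun y => g y * evenK (y / x) + g y * oddK (y / x)) (Ioi 0) := h1.add h2
  rw [← integral_add h1 h2, ← integral_sub h3 hi]
  refine integral_congr_ae (Eventually.of_forall fun y => ?_)
  simp only [kerT_eq]; ring

lemma tendsto_integral_mul_kerT (hm : Measurable g) (ha : AntitoneOn g (Ioi 0))
    (h0 : ∀ y, 0 < y → 0 ≤ g y) (hi : IntegrableOn g (Ioi 0)) :
    Tendsto (fun x => ∫ y in Ioi 0, g y * kerT (y / x)) atTop (𝓝 (-(2 * ∫ y in Ioi 0, g y))) := by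
  have h := ((tendsto_integral_mul_evenK hm ha h0 hi).add
    (tendsto_integral_mul_oddK hm hi)).sub_const (∫ y in Ioi 0, g y)
  have e : 0 + -(∫ y in Ioi 0, g y) - ∫ y in Ioi 0, g y = -(2 * ∫ y in Ioi 0, g y) := by ring
  rw [e] at h
  refine h.congr' ?_
  filter_upwards [eventually_gt_atTop 0] with x hx using (integral_mul_kerT_eq hm ha h0 hi hx).symm

end EvenPart

/-! ### Integrability of fixed points -/

lemma kerT_add_two_lower {r : ℝ} (h0 : 0 < r) (h1 : r < 1) : 2 * r ^ 2 ≤ kerT r + 2 := by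
  have := ell_lower h0.le h1
  unfold kerT
  nlinarith

/-- The kernel `(y / x) ln |(x + y) / (x - y)|` has no integrable positive antitone
eigenfunction on `(0, ∞)`. -/
lemma not_eigenfunction_kerT {g : ℝ → ℝ} {κ c : ℝ} (hm : Measurable g)
    (ha : AntitoneOn g (Ioi 0)) (h0 : ∀ y, 0 < y → 0 ≤ g y) (h1 : ∀ y, 0 < y → g y ≤ 1)
    (hi : IntegrableOn g (Ioi 0)) (hκ : 0 < κ) (hc : 0 < c) (hc1 : c ≤ 1) (hgc : 0 < g c)
    (heq : ∀ x, 0 < x → g x = κ * ∫ y in Ioi 0, g y * (kerT (y / x) + 2)) : False := by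
  have hmk := measurable_kerT
  have hint : ∀ x, 0 < x → IntegrableOn (fun y => g y * (kerT (y / x) + 2)) (Ioi 0) := by
    intro x hx
    have := (GCLM.integrableOn_mul_kerT hm
      (fun y hy => abs_le.2 ⟨by linarith [h0 y hy], h1 y hy⟩) hx).add (hi.mul_const 2)
    refine this.congr (Eventually.of_forall fun y => ?_)
    simp only [Pi.add_apply]; ring
  have hnn : ∀ x y, 0 < x → 0 < y → 0 ≤ g y * (kerT (y / x) + 2) := fun x y hx hy =>
    mul_nonneg (h0 y hy) (by linarith [neg_two_le_kerT (div_pos hy hx)])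
  -- Integrate the eigenvalue equation in `x` and use Tonelli: the kernel is at least 1 for `x < y`,
  -- so its `x`-integral dominates `y`.
  have hy_int : IntegrableOn (fun y => y * g y) (Ioi 0) := by
    have hfin : ∫⁻ x in Ioi 0, ENNReal.ofReal (∫ y in Ioi 0, g y * (kerT (y / x) + 2)) < ⊤ := by
      have h2 : IntegrableOn (fun x => ∫ y in Ioi 0, g y * (kerT (y / x) + 2)) (Ioi 0) := by
        refine (hi.const_mul κ⁻¹).congr ?_
        filter_upwards [ae_pos] with x hx
        rw [heq x hx]; field_simp
      refine lt_of_le_of_lt (lintegral_mono fun x => ?_) h2.2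
      exact Real.ofReal_le_enorm _
    have hle : ∫⁻ y in Ioi 0, ENNReal.ofReal (y * g y) ≤
        ∫⁻ x in Ioi 0, ENNReal.ofReal (∫ y in Ioi 0, g y * (kerT (y / x) + 2)) := by
      calc ∫⁻ y in Ioi 0, ENNReal.ofReal (y * g y)
          ≤ ∫⁻ y in Ioi 0, ∫⁻ x in Ioi 0, ENNReal.ofReal (g y * (kerT (y / x) + 2)) := by
            refine lintegral_mono_ae ?_
            filter_upwards [ae_pos] with y hy
            calc ENNReal.ofReal (y * g y)
                = ∫⁻ _ in Ioo 0 y, ENNReal.ofReal (g y) := by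
                  rw [setLIntegral_const, Real.volume_Ioo, sub_zero, mul_comm,
                    ENNReal.ofReal_mul (h0 y hy)]
              _ ≤ ∫⁻ x in Ioo 0 y, ENNReal.ofReal (g y * (kerT (y / x) + 2)) := by
                  refine setLIntegral_mono' measurableSet_Ioo fun x hx => ?_
                  refine ENNReal.ofReal_le_ofReal (le_mul_of_one_le_right (h0 y hy) ?_)
                  have := kerT_nonneg ((one_lt_div hx.1).2 hx.2)
                  linarith
              _ ≤ _ := lintegral_mono_set fun x hx => hx.1
        _ = ∫⁻ x in Ioi 0, ∫⁻ y in Ioi 0, ENNReal.ofReal (g y * (kerT (y / x) + 2)) :=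
            lintegral_lintegral_swap (Measurable.aemeasurable (by
              simp only [Function.uncurry_def]; fun_prop))
        _ = _ := by
            refine lintegral_congr_ae ?_
            filter_upwards [ae_pos] with x hx
            rw [ofReal_integral_eq_lintegral_ofReal (hint x hx)]
            filter_upwards [ae_pos] with y hy using hnn x y hx hy
    refine ⟨Measurable.aestronglyMeasurable (by fun_prop), ?_⟩
    rw [hasFiniteIntegral_iff_ofReal]
    · exact hle.trans_lt hfin
    · filter_upwards [ae_pos] with y hy using mul_nonneg hy.le (h0 y hy)
  -- Keeping only `y ≤ c`, where `g y ≥ g c` and the kernel is at least `2 (y/x)²`, forces `g` to be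
  -- at least a multiple of `x⁻²`; this contradicts the integrability of `y g(y)`.
  have hlow : ∀ x, 1 < x → κ * (g c * (2 / 3 * c ^ 3)) * x⁻¹ ≤ x * g x := by
    intro x hx
    have hx0 : 0 < x := one_pos.trans hx
    have h3 : ∫ y in (0 : ℝ)..c, g c * (2 * (y / x) ^ 2) ≤ ∫ y in Ioi 0, g y * (kerT (y / x) + 2) := by
      rw [intervalIntegral.integral_of_le hc.le]
      calc _ ≤ ∫ y in Ioc 0 c, g y * (kerT (y / x) + 2) := by
            refine setIntegral_mono_on ?_ ((hint x hx0).mono_set Ioc_subset_Ioi_self)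
              measurableSet_Ioc fun y hy => ?_
            · exact Continuous.integrableOn_Ioc (by fun_prop)
            · have h4 := kerT_add_two_lower (div_pos hy.1 hx0)
                ((div_lt_one hx0).2 ((hy.2.trans hc1).trans_lt hx))
              have h5 := ha hy.1 hc hy.2
              have := h0 y hy.1
              gcongr
        _ ≤ _ := setIntegral_mono_set (hint x hx0) (by
              filter_upwards [ae_pos] with y hy using hnn x y hx0 hy)
              Ioc_subset_Ioi_self.eventuallyLE
    have h4 : ∫ y in (0 : ℝ)..c, g c * (2 * (y / x) ^ 2) = g c * (2 / 3 * c ^ 3) / x ^ 2 := by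
      simp only [div_pow, intervalIntegral.integral_const_mul, intervalIntegral.integral_div,
        integral_pow]
      field_simp
      norm_num
      ring
    rw [h4] at h3
    rw [heq x hx0]
    calc κ * (g c * (2 / 3 * c ^ 3)) * x⁻¹ = x * (κ * (g c * (2 / 3 * c ^ 3) / x ^ 2)) := by
          field_simp
      _ ≤ _ := by gcongr
  refine not_integrableOn_Ioi_inv (a := 1) ?_
  set k := κ * (g c * (2 / 3 * c ^ 3))
  have hk : 0 < k := by positivity
  refine Integrable.mono' ((hy_int.mono_set (Ioi_subset_Ioi zero_le_one)).const_mul k⁻¹)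
    measurable_inv.aestronglyMeasurable ?_
  filter_upwards [ae_restrict_mem measurableSet_Ioi] with x (hx : 1 < x)
  rw [Real.norm_of_nonneg (inv_nonneg.2 (zero_le_one.trans hx.le)), ← div_eq_inv_mul, le_div_iff₀ hk]
  linarith [hlow x hx]

section FixedPoint

variable {f : ℝ → ℝ} {a : ℝ}

/-- If `preT` stayed positive, `f = 1 + (2/den) T f` on the half-line, and `f ≥ 0` would bound `T f`
below. Subtracting the limits at infinity makes `f - f(+∞)` an eigenfunction for the kernel `kerT +
2`. -/
lemma MemD.exists_preT_nonpos_of_one (hf : MemD f) (hfix : R 1 f = f) :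
    ∃ x, 0 < x ∧ preT 1 f x ≤ 0 := by
  by_contra! hpos
  have hd := hf.den_pos le_rfl
  have hfx : ∀ x, 0 < x → f x = 1 + 2 / den 1 f * T f x := fun x hx => by
    have h := congrFun hfix x
    rw [R, if_neg one_ne_zero, Ta_eq, max_eq_left (hpos x hx).le] at h
    simp [preT] at h
    exact h.symm
  have hB : ∀ x, 0 < x → -(den 1 f / 2) ≤ T f x := fun x hx => by
    have h1 := hf.nonneg x
    rw [hfx x hx] at h1
    have h2 : 2 / den 1 f * (den 1 f / 2) = 1 := by field_simp
    by_contra! h3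
    have h4 : 2 / den 1 f * T f x < 2 / den 1 f * -(den 1 f / 2) := by gcongr
    linarith
  have hi := hf.integrableOn_sub_atInfty hB
  set g : ℝ → ℝ := fun y => f y - atInfty f with hg
  have hm : Measurable g := hf.continuous.measurable.sub_const _
  have hga : AntitoneOn g (Ioi 0) := fun y hy z hz hyz => sub_le_sub_right (hf.antitoneOn_Ioi hy hz hyz) _
  have hg0 : ∀ y, 0 < y → 0 ≤ g y := fun y hy => sub_nonneg.2 (hf.atInfty_le hy.le)
  have hg1 : ∀ y, 0 < y → g y ≤ 1 := fun y hy => by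
    linarith [hf.le_one y, hf.atInfty_nonneg]
  have hTlim : Tendsto (T f) atTop (𝓝 (Real.pi⁻¹ * -(2 * ∫ y in Ioi 0, g y))) := by
    refine ((tendsto_integral_mul_kerT hm hga hg0 hi).const_mul Real.pi⁻¹).congr' ?_
    filter_upwards [eventually_gt_atTop 0] with x hx
    rw [← hf.T_eq_sub _ hx]; field_simp
  have hinf : atInfty f = 1 + 2 / den 1 f * (Real.pi⁻¹ * -(2 * ∫ y in Ioi 0, g y)) := by
    refine tendsto_nhds_unique hf.tendsto (((hTlim.const_mul _).const_add 1).congr' ?_)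
    filter_upwards [eventually_gt_atTop 0] with x hx using (hfx x hx).symm
  obtain ⟨c, hc, hgc⟩ : ∃ c ∈ Ioc (0 : ℝ) 1, 0 < g c := by
    have h0 : 0 < g 0 := by
      have := hf.atInfty_le (x := 1 / 2) (by norm_num)
      simp only [hg, hf.map_zero]
      linarith [hf.lt_one]
    have hcont : ContinuousAt g 0 := (hf.continuous.sub continuous_const).continuousAt
    have h1 : ∀ᶠ c in 𝓝[>] (0 : ℝ), 0 < g c :=
      (hcont.eventually (lt_mem_nhds h0)).filter_mono nhdsWithin_le_nhds
    obtain ⟨c, hc⟩ := (h1.and (Ioc_mem_nhdsGT one_pos)).exists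
    exact ⟨c, hc.2, hc.1⟩
  refine not_eigenfunction_kerT (κ := 2 / (Real.pi * den 1 f)) hm hga hg0 hg1 hi
    (by positivity) hc.1 hc.2 hgc fun x hx => ?_
  have h2 : ∫ y in Ioi 0, g y * (kerT (y / x) + 2) =
      Real.pi * T f x + 2 * ∫ y in Ioi 0, g y := by
    rw [hf.T_eq_sub (atInfty f) hx, ← integral_const_mul, ← integral_add]
    · exact integral_congr_ae (Eventually.of_forall fun y => by simp only [hg]; ring)
    · exact GCLM.integrableOn_mul_kerT hm
        (fun y hy => abs_le.2 ⟨by linarith [hg0 y hy], hg1 y hy⟩) hx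
    · exact hi.const_mul 2
  rw [h2]
  have h3 : g x = f x - atInfty f := rfl
  rw [h3, hinf, hfx x hx]
  field_simp
  ring

lemma MemD.eq_zero_of_preT_nonpos (hf : MemD f) (hfix : R a f = f) {x y : ℝ} (hx : 0 < x)
    (h : preT a f x ≤ 0) (hy : x ≤ y) : f y = 0 := by
  refine le_antisymm ?_ (hf.nonneg y)
  have h1 : f x = 0 := (congrFun hfix x).symm.trans (R_eq_zero h)
  exact h1 ▸ hf.anti hx.le hy

lemma MemD.integrableOn_of_fixed (hf : MemD f) (ha : a ≤ 1) (hfix : R a f = f) :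
    IntegrableOn f (Ioi 0) := by
  by_cases h : ∃ x, 0 < x ∧ preT a f x ≤ 0
  · obtain ⟨x, hx, hp⟩ := h
    refine hf.integrableOn_of_decay (X := x) (p := 2) (B := 0) hx one_lt_two fun y hy => ?_
    rw [hf.eq_zero_of_preT_nonpos hfix hx hp hy, zero_mul]
  · rcases ha.eq_or_lt with rfl | ha
    · exact absurd (hf.exists_preT_nonpos_of_one hfix) h
    · push Not at h
      exact hf.integrableOn_of_fixed_of_lt ha hfix h

/-- `L` is the infimum of the points where `preT ≤ 0`; to its right `f` vanishes. If there are none,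
`sInf ∅ = 0` is harmless because only `x > 0` is considered. -/
lemma MemD.exists_exceptional (hf : MemD f) (hfix : R a f = f) :
    ∃ L, ∀ x, 0 < x → x ≠ L → 0 < preT a f x ∨ (f =ᶠ[𝓝 x] fun _ => 0) := by
  refine ⟨sInf {x | 0 < x ∧ preT a f x ≤ 0}, fun x hx hxL => ?_⟩
  by_contra! hcon
  set Z := {x | 0 < x ∧ preT a f x ≤ 0} with hZ
  have hxZ : x ∈ Z := ⟨hx, hcon.1⟩
  have hbdd : BddBelow Z := ⟨0, fun y hy => hy.1.le⟩
  have hlt : sInf Z < x := lt_of_le_of_ne (csInf_le hbdd hxZ) (Ne.symm hxL)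
  obtain ⟨z, hz, hzx⟩ := exists_lt_of_csInf_lt ⟨x, hxZ⟩ hlt
  refine hcon.2 ?_
  filter_upwards [Ioi_mem_nhds hzx] with y hy
  exact hf.eq_zero_of_preT_nonpos hfix hz.1 hz.2 (le_of_lt hy)

/-- With the denominator cleared, the equation remains true where `f` vanishes locally, so one
exceptional point suffices. -/
lemma MemD.exists_ode (hf : MemD f) (ha : a ≤ 1) (hfix : R a f = f) :
    ∃ L, ∀ x, 0 < x → x ≠ L → DifferentiableAt ℝ f x ∧
      (den a f + 2 * a * T f x) * (x * deriv f x) =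
        2 * f x * (x * deriv (T f) x + (1 - a) * T f x) := by
  obtain ⟨L, hL⟩ := hf.exists_exceptional hfix
  have hd := hf.den_pos ha
  refine ⟨L, fun x hx hxL => ?_⟩
  rcases hL x hx hxL with hp | h0
  · have h := hf.hasDerivAt_of_fixed ha hfix hx hp
    refine ⟨h.differentiableAt, ?_⟩
    have e : den a f + 2 * a * T f x = den a f * preT a f x := by unfold preT; field_simp
    rw [h.deriv, e]
    field_simp
  · refine ⟨(differentiableAt_const (0 : ℝ)).congr_of_eventuallyEq h0, ?_⟩
    rw [h0.deriv_eq, h0.eq_of_nhds]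
    simp

end FixedPoint

/-! ### The energy identities -/

/-- The even potential `∫ f(y) evenK(y / x) dy`. -/
def evenPot (f : ℝ → ℝ) (x : ℝ) : ℝ := ∫ y in Ioi 0, f y * evenK (y / x)

/-- The odd potential `∫ f(y) oddK(y / x) dy`. -/
def oddPot (f : ℝ → ℝ) (x : ℝ) : ℝ := ∫ y in Ioi 0, f y * oddK (y / x)

/-- The quadratic form `∫∫ f(x) f(y) evenK(y / x) dy dx`. -/
def energy (f : ℝ → ℝ) : ℝ := ∫ x in Ioi 0, f x * evenPot f x

/-- The derivative of `x f(x)`. -/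
def dilD (f : ℝ → ℝ) (x : ℝ) : ℝ := f x + x * deriv f x

section Energy

variable {f h : ℝ → ℝ} {L : ℝ}

lemma measurable_evenPot (hm : Measurable f) : Measurable (evenPot f) := by
  have := measurable_evenK
  refine (StronglyMeasurable.integral_prod_right (f := fun x y => f y * evenK (y / x)) ?_).measurable
  refine Measurable.stronglyMeasurable ?_
  simp only [Function.uncurry_def]; fun_prop

lemma measurable_oddPot (hm : Measurable f) : Measurable (oddPot f) := by
  have := measurable_oddK
  refine (StronglyMeasurable.integral_prod_right (f := fun x y => f y * oddK (y / x)) ?_).measurable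
  refine Measurable.stronglyMeasurable ?_
  simp only [Function.uncurry_def]; fun_prop

lemma integrable_mul_of_bound {k p : ℝ → ℝ} {B : ℝ} (hk : IntegrableOn k (Ioi 0))
    (hp : AEStronglyMeasurable p (volume.restrict (Ioi 0))) (hB : ∀ x, 0 < x → |p x| ≤ B) :
    IntegrableOn (fun x => p x * k x) (Ioi 0) := by
  refine Integrable.mono' (hk.norm.const_mul B) (hp.mul hk.aestronglyMeasurable) ?_
  filter_upwards [ae_pos] with x hx
  rw [norm_mul]
  exact mul_le_mul_of_nonneg_right (hB x hx) (norm_nonneg _)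

lemma MemD.abs_evenPot_le (hf : MemD f) (hi : IntegrableOn f (Ioi 0)) {x : ℝ} (hx : 0 < x) :
    |evenPot f x| ≤ (∫ y in Ioi 0, f y) * ∫ r in Ioi 0, |evenK r / r| :=
  abs_integral_mul_evenK_le hf.antitoneOn_Ioi (fun y _ => hf.nonneg y) hi hx

lemma MemD.abs_oddPot_le (hf : MemD f) (hi : IntegrableOn f (Ioi 0)) {x : ℝ} (hx : 0 < x) :
    |oddPot f x| ≤ ∫ y in Ioi 0, f y := by
  rw [oddPot, ← Real.norm_eq_abs]
  refine norm_integral_le_of_norm_le hi ?_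
  filter_upwards [ae_pos] with y hy
  rw [norm_mul, Real.norm_of_nonneg (hf.nonneg y)]
  exact mul_le_of_le_one_right (hf.nonneg y) (abs_oddK_le (div_pos hy hx))

lemma MemD.integrableOn_mul_evenK (hf : MemD f) (hi : IntegrableOn f (Ioi 0)) {x : ℝ} (hx : 0 < x) :
    IntegrableOn (fun y => f y * evenK (y / x)) (Ioi 0) :=
  GCLM.integrableOn_mul_evenK hf.continuous.measurable hf.antitoneOn_Ioi (fun y _ => hf.nonneg y) hi hx

lemma ae_ne_pos (x : ℝ) : ∀ᵐ y : ℝ ∂volume.restrict (Ioi 0), 0 < y ∧ y ≠ x := by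
  filter_upwards [ae_pos, ae_restrict_of_ae (Measure.ae_ne volume x)] with y hy hyx using ⟨hy, hyx⟩

lemma evenK_div_nonneg {x y : ℝ} (hx : 0 < x) (hy : 0 < y) (h : y ≠ x) : 0 ≤ evenK (y / x) :=
  evenK_nonneg (div_pos hy hx) (by rwa [Ne, div_eq_one_iff_eq hx.ne'])

lemma MemD.evenPot_nonneg (hf : MemD f) {x : ℝ} (hx : 0 < x) : 0 ≤ evenPot f x := by
  refine integral_nonneg_of_ae ?_
  filter_upwards [ae_ne_pos x] with y hy
  exact mul_nonneg (hf.nonneg y) (evenK_div_nonneg hx hy.1 hy.2)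

lemma MemD.integrable_prod_evenK (hf : MemD f) (hi : IntegrableOn f (Ioi 0)) (hm : Measurable h)
    (hh : IntegrableOn h (Ioi 0)) :
    Integrable (Function.uncurry fun x y => h x * (f y * evenK (y / x)))
      ((volume.restrict (Ioi 0)).prod (volume.restrict (Ioi 0))) := by
  have hmf := hf.continuous.measurable
  have hme := measurable_evenK
  refine (integrable_prod_iff (Measurable.aestronglyMeasurable (by
    simp only [Function.uncurry_def]; fun_prop))).2 ⟨?_, ?_⟩
  · filter_upwards [ae_pos] with x hx
    exact (hf.integrableOn_mul_evenK hi hx).const_mul (h x)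
  · refine (integrable_mul_of_bound hh.norm (measurable_evenPot hmf).aestronglyMeasurable
      fun x hx => hf.abs_evenPot_le hi hx).congr ?_
    filter_upwards [ae_pos] with x hx
    simp only [Function.uncurry_apply_pair, norm_mul (h x), integral_const_mul]
    rw [mul_comm]
    congr 1
    refine integral_congr_ae ?_
    filter_upwards [ae_ne_pos x] with y hy
    exact (Real.norm_of_nonneg (mul_nonneg (hf.nonneg y) (evenK_div_nonneg hx hy.1 hy.2))).symm

lemma MemD.integral_mul_evenPot (hf : MemD f) (hi : IntegrableOn f (Ioi 0)) (hm : Measurable h)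
    (hh : IntegrableOn h (Ioi 0)) :
    ∫ x in Ioi 0, h x * evenPot f x = ∫ y in Ioi 0, f y * evenPot h y := by
  have h1 := integral_integral_swap (hf.integrable_prod_evenK hi hm hh)
  simp only [integral_const_mul] at h1
  refine h1.trans (integral_congr_ae ?_)
  filter_upwards [ae_pos] with y hy
  rw [evenPot, ← integral_const_mul]
  refine integral_congr_ae ?_
  filter_upwards [ae_pos] with x hx
  rw [← evenK_inv (div_pos hx hy).ne', inv_div]
  ring

/-- The right side is a dilate of `f`, so `x f'` is integrable whenever `f` is. -/
lemma MemD.abs_mul_deriv_le (hf : MemD f) {x : ℝ} (hx : 0 < x) :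
    |x * deriv f x| ≤ 22 * f (x / 4) := by
  have hn := hf.nonneg (x / 4)
  have h := norm_deriv_le_of_lipschitzOn (f := f) (x₀ := x) (s := Icc (x / 2) (2 * x))
    (C := Real.nnabs (22 / x * f (x / 4))) (Icc_mem_nhds (by linarith) (by linarith))
    (LipschitzOnWith.of_dist_le_mul fun u hu v hv => by
      rw [Real.coe_nnabs, abs_of_nonneg (by positivity), Real.dist_eq, Real.dist_eq]
      have := hf.abs_sub_le' (w := x / 2) (by positivity) hu.1 (by linarith [hu.2]) hv.1
        (by linarith [hv.2])
      refine this.trans (le_of_eq ?_)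
      have e : x / 2 / 2 = x / 4 := by ring
      rw [e]; field_simp; ring)
  rw [Real.coe_nnabs, abs_of_nonneg (by positivity), Real.norm_eq_abs] at h
  rw [abs_mul, abs_of_pos hx]
  calc x * |deriv f x| ≤ x * (22 / x * f (x / 4)) := by gcongr
    _ = _ := by field_simp

lemma integrableOn_comp_mul_left (hi : IntegrableOn f (Ioi 0)) {l : ℝ} (hl : 0 < l) :
    IntegrableOn (fun x => f (l * x)) (Ioi 0) := by
  rw [integrableOn_Ioi_comp_mul_left_iff _ 0 hl, mul_zero]; exact hi

lemma MemD.integrableOn_mul_deriv (hf : MemD f) (hi : IntegrableOn f (Ioi 0)) :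
    IntegrableOn (fun x => x * deriv f x) (Ioi 0) := by
  have h1 := (integrableOn_comp_mul_left hi (show (0 : ℝ) < 1 / 4 by norm_num)).const_mul 22
  refine Integrable.mono' h1
    (measurable_id.mul (measurable_deriv f)).aestronglyMeasurable ?_
  filter_upwards [ae_pos] with x hx
  have := hf.abs_mul_deriv_le hx
  rwa [div_eq_inv_mul, ← one_div] at this

lemma MemD.integrableOn_dilD (hf : MemD f) (hi : IntegrableOn f (Ioi 0)) :
    IntegrableOn (dilD f) (Ioi 0) := hi.add (hf.integrableOn_mul_deriv hi)

lemma measurable_dilD (hm : Measurable f) : Measurable (dilD f) := by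
  have := measurable_deriv f
  unfold dilD; fun_prop

/-- Boundary terms vanish because `φ` is bounded and `x f(x)` tends to 0 at both ends. -/
lemma MemD.integral_by_parts (hf : MemD f) (hi : IntegrableOn f (Ioi 0))
    (hL : ∀ x, 0 < x → x ≠ L → DifferentiableAt ℝ f x) {φ φ' : ℝ → ℝ} {B : ℝ} {s : Set ℝ}
    (hs : s.Countable) (hc : ContinuousOn φ (Ioi 0)) (hB : ∀ x, 0 < x → |φ x| ≤ B)
    (hd : ∀ x ∈ Ioi 0 \ s, HasDerivAt φ (φ' x) x)
    (hφ' : IntegrableOn (fun x => φ' x * (x * f x)) (Ioi 0)) :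
    (∫ x in Ioi 0, φ' x * (x * f x)) + ∫ x in Ioi 0, φ x * dilD f x = 0 := by
  have h2 : IntegrableOn (fun x => φ x * dilD f x) (Ioi 0) :=
    integrable_mul_of_bound (hf.integrableOn_dilD hi)
      (hc.aestronglyMeasurable measurableSet_Ioi) hB
  rw [← integral_add hφ' h2]
  have hbound : ∀ x, 0 < x → |φ x * (x * f x)| ≤ B * (x * f x) := fun x hx => by
    have := hf.nonneg x
    rw [abs_mul, abs_of_nonneg (a := x * f x) (by positivity)]
    exact mul_le_mul_of_nonneg_right (hB x hx) (by positivity)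
  have h := integral_Ioi_of_hasDerivAt_off_countable (F := fun x => φ x * (x * f x))
    (F' := fun x => φ' x * (x * f x) + φ x * dilD f x) (s := s ∪ {L}) (m := 0)
    (hs.union (countable_singleton L)) ?_ ?_ (hφ'.add h2) ?_
  · rw [h]; simp
  · intro x (hx : 0 ≤ x)
    rcases hx.eq_or_lt with rfl | hx
    · rw [ContinuousWithinAt, zero_mul, mul_zero]
      have h3 : Tendsto (fun x => B * (x * f x)) (𝓝[≥] 0) (𝓝 0) := by
        have : Tendsto (fun x => B * (x * f x)) (𝓝 0) (𝓝 (B * (0 * f 0))) :=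
          Continuous.tendsto (by have := hf.continuous; fun_prop) 0
        rw [zero_mul, mul_zero] at this
        exact this.mono_left nhdsWithin_le_nhds
      refine squeeze_zero_norm' ?_ h3
      filter_upwards [self_mem_nhdsWithin] with r (hr : 0 ≤ r)
      rcases hr.eq_or_lt with rfl | hr
      · simp
      · exact hbound r hr
    · exact ((hc.continuousAt (Ioi_mem_nhds hx)).mul
        (continuousAt_id.mul hf.continuous.continuousAt)).continuousWithinAt
  · rintro x ⟨hx, hxs⟩
    rw [mem_union, not_or] at hxs
    exact (hd x ⟨hx, hxs.1⟩).mul (((hasDerivAt_id x).mul (hL x hx hxs.2).hasDerivAt).congr_deriv (by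
      simp [dilD]))
  · have h3 := (tendsto_mul_of_antitoneOn hf.antitoneOn_Ioi (fun y _ => hf.nonneg y) hi).const_mul B
    rw [mul_zero] at h3
    refine squeeze_zero_norm' ?_ h3
    filter_upwards [eventually_gt_atTop 0] with x hx using hbound x hx

lemma MemD.integral_dilD (hf : MemD f) (hi : IntegrableOn f (Ioi 0))
    (hL : ∀ x, 0 < x → x ≠ L → DifferentiableAt ℝ f x) : ∫ x in Ioi 0, dilD f x = 0 := by
  have h := hf.integral_by_parts hi hL (φ := fun _ => 1) (φ' := fun _ => 0) (B := 1) countable_empty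
    continuousOn_const (by simp) (fun x _ => hasDerivAt_const x 1) (by simp)
  simpa using h

/-- Integration by parts with `oddK' = evenK / r` turns the odd kernel into the even one. -/
lemma MemD.integral_dilD_mul_oddK (hf : MemD f) (hi : IntegrableOn f (Ioi 0))
    (hL : ∀ x, 0 < x → x ≠ L → DifferentiableAt ℝ f x) {y : ℝ} (hy : 0 < y) :
    ∫ x in Ioi 0, oddK (y / x) * dilD f x = evenPot f y := by
  have hev : ∀ x, 0 < x → x ≠ y →
      -(evenK (y / x) / x) * (x * f x) = -(f x * evenK (x / y)) := fun x hx _ => by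
    rw [← evenK_inv (div_pos hx hy).ne', inv_div]; field_simp
  have hint : IntegrableOn (fun x => -(evenK (y / x) / x) * (x * f x)) (Ioi 0) := by
    refine (hf.integrableOn_mul_evenK hi hy).neg.congr ?_
    filter_upwards [ae_ne_pos y] with x hx using (hev x hx.1 hx.2).symm
  have h := hf.integral_by_parts hi hL (φ := fun x => oddK (y / x))
    (φ' := fun x => -(evenK (y / x) / x)) (B := 1) (countable_singleton y)
    (continuousOn_oddK.comp (continuousOn_const.div continuousOn_id fun x hx => (ne_of_gt hx))
      fun x hx => div_pos hy hx)
    (fun x hx => abs_oddK_le (div_pos hy hx)) ?_ hint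
  · have h2 : ∫ x in Ioi 0, -(evenK (y / x) / x) * (x * f x) = -evenPot f y := by
      rw [evenPot, ← integral_neg]
      refine integral_congr_ae ?_
      filter_upwards [ae_ne_pos y] with x hx using hev x hx.1 hx.2
    linarith
  · rintro x ⟨hx, hxy⟩
    have hx' : (0 : ℝ) < x := hx
    have hne : y / x ≠ 1 := by
      rw [Ne, div_eq_one_iff_eq hx'.ne']; exact fun h => hxy h.symm
    have h3 := (hasDerivAt_oddK (div_pos hy hx') hne).comp x
      ((hasDerivAt_const x y).div (hasDerivAt_id x) hx'.ne')
    refine h3.congr_deriv ?_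
    field_simp
    ring

lemma MemD.integral_dilD_mul_oddPot (hf : MemD f) (hi : IntegrableOn f (Ioi 0))
    (hL : ∀ x, 0 < x → x ≠ L → DifferentiableAt ℝ f x) :
    ∫ x in Ioi 0, dilD f x * oddPot f x = energy f := by
  have hmf := hf.continuous.measurable
  have hmo := measurable_oddK
  have hmd := measurable_dilD hmf
  have hint : Integrable (Function.uncurry fun x y => dilD f x * (f y * oddK (y / x)))
      ((volume.restrict (Ioi 0)).prod (volume.restrict (Ioi 0))) := by
    refine Integrable.mono ((hf.integrableOn_dilD hi).mul_prod hi)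
      (Measurable.aestronglyMeasurable (by simp only [Function.uncurry_def]; fun_prop)) ?_
    rw [Measure.prod_restrict]
    filter_upwards [ae_restrict_mem (measurableSet_Ioi.prod measurableSet_Ioi)] with p hp
    simp only [Function.uncurry_def, norm_mul]
    gcongr
    exact mul_le_of_le_one_right (norm_nonneg _) (abs_oddK_le (div_pos hp.2 hp.1))
  have h1 := integral_integral_swap hint
  simp only [integral_const_mul] at h1
  refine h1.trans (integral_congr_ae ?_)
  filter_upwards [ae_pos] with y hy
  rw [← hf.integral_dilD_mul_oddK hi hL hy, ← integral_const_mul]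
  exact integral_congr_ae (Eventually.of_forall fun x => by simp only; ring)

/-- The kernel `oddK (y/x)` is antisymmetric under exchange of `x` and `y`. -/
lemma MemD.integral_mul_oddPot (hf : MemD f) (hi : IntegrableOn f (Ioi 0)) :
    ∫ x in Ioi 0, f x * oddPot f x = 0 := by
  have hmf := hf.continuous.measurable
  have hmo := measurable_oddK
  have hint : Integrable (Function.uncurry fun x y => f x * (f y * oddK (y / x)))
      ((volume.restrict (Ioi 0)).prod (volume.restrict (Ioi 0))) := by
    refine Integrable.mono (hi.mul_prod hi)
      (Measurable.aestronglyMeasurable (by simp only [Function.uncurry_def]; fun_prop)) ?_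
    rw [Measure.prod_restrict]
    filter_upwards [ae_restrict_mem (measurableSet_Ioi.prod measurableSet_Ioi)] with p hp
    simp only [Function.uncurry_def, norm_mul]
    gcongr
    exact mul_le_of_le_one_right (norm_nonneg _) (abs_oddK_le (div_pos hp.2 hp.1))
  have h1 := integral_integral_swap hint
  simp only [integral_const_mul] at h1
  have h2 : ∫ x in Ioi 0, f x * oddPot f x = -∫ x in Ioi 0, f x * oddPot f x := by
    refine h1.trans ?_
    rw [← integral_neg]
    refine integral_congr_ae ?_
    filter_upwards [ae_pos] with y hy
    rw [oddPot, ← mul_neg, ← integral_neg, ← integral_const_mul]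
    refine integral_congr_ae ?_
    filter_upwards [ae_pos] with x hx
    rw [← inv_div x y, oddK_inv (div_pos hx hy).ne']
    ring
  linarith

/-- The pairing of `f` with its dilates. -/
def dilPair (f : ℝ → ℝ) (l : ℝ) : ℝ := ∫ x in Ioi 0, f (l * x) * evenPot f x

lemma MemD.hasDerivAt_dilPair (hf : MemD f) (hi : IntegrableOn f (Ioi 0))
    (hL : ∀ x, 0 < x → x ≠ L → DifferentiableAt ℝ f x) :
    HasDerivAt (dilPair f) (∫ x in Ioi 0, x * deriv f x * evenPot f x) 1 := by
  have hmf := hf.continuous.measurable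
  have hme := measurable_evenPot hmf
  have hmd := measurable_deriv f
  set B := (∫ y in Ioi 0, f y) * ∫ r in Ioi 0, |evenK r / r|
  have hB : ∀ x, 0 < x → |evenPot f x| ≤ B := fun x hx => hf.abs_evenPot_le hi hx
  have h4 := integrableOn_comp_mul_left hi (show (0 : ℝ) < 1 / 4 by norm_num)
  refine (hasDerivAt_integral_of_dominated_loc_of_lip (μ := volume.restrict (Ioi 0)) (𝕜 := ℝ)
    (F := fun l x => f (l * x) * evenPot f x) (x₀ := 1) (s := Icc (1 / 2) 2)
    (bound := fun x => 22 * (B * f (1 / 4 * x)))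
    (Icc_mem_nhds (by norm_num) (by norm_num))
    (Eventually.of_forall fun w => Measurable.aestronglyMeasurable (by fun_prop))
    ?_ (Measurable.aestronglyMeasurable (by fun_prop)) ?_ ((h4.const_mul _).const_mul _) ?_).2
  · simp only [one_mul, mul_comm (f _)]
    exact integrable_mul_of_bound hi hme.aestronglyMeasurable hB
  · filter_upwards [ae_pos] with x hx
    have hB0 : 0 ≤ B := (abs_nonneg _).trans (hB x hx)
    have hn := hf.nonneg (1 / 4 * x)
    refine LipschitzOnWith.of_dist_le_mul fun u hu v hv => ?_
    rw [Real.coe_nnabs, abs_of_nonneg (by positivity), Real.dist_eq, Real.dist_eq, ← sub_mul, abs_mul]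
    have := hf.abs_sub_le' (w := x / 2) (x := u * x) (z := v * x) (by positivity)
      (by nlinarith [hu.1]) (by nlinarith [hu.2]) (by nlinarith [hv.1]) (by nlinarith [hv.2])
    have h2 : 11 / (x / 2) * |u * x - v * x| = 22 * |u - v| := by
      rw [← sub_mul, abs_mul, abs_of_pos hx]; field_simp; ring
    have e : x / 2 / 2 = 1 / 4 * x := by ring
    rw [h2, e] at this
    calc |f (u * x) - f (v * x)| * |evenPot f x| ≤ (22 * |u - v| * f (1 / 4 * x)) * B := by
          gcongr; exact hB x hx
      _ = _ := by ring
  · filter_upwards [ae_ne_pos L] with x hx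
    have h1 : HasDerivAt (fun w : ℝ => w * x) x 1 := by simpa using (hasDerivAt_id (1 : ℝ)).mul_const x
    have h0 : HasDerivAt f (deriv f x) (1 * x) := by
      rw [one_mul]; exact (hL x hx.1 hx.2).hasDerivAt
    have h2 := (h0.comp 1 h1).mul_const (evenPot f x)
    exact h2.congr_deriv (by ring)

/-- Symmetry of the even form moves the dilation to the other factor; homogeneity of degree 0 of the
kernel moves it back inverted. -/
lemma MemD.dilPair_inv (hf : MemD f) (hi : IntegrableOn f (Ioi 0)) {l : ℝ} (hl : 0 < l) :
    dilPair f l = l⁻¹ ^ 2 * dilPair f l⁻¹ := by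
  have hmf := hf.continuous.measurable
  have h1 : dilPair f l = ∫ y in Ioi 0, f y * evenPot (fun x => f (l * x)) y :=
    hf.integral_mul_evenPot hi (h := fun x => f (l * x)) (by fun_prop)
      (integrableOn_comp_mul_left hi hl)
  have h2 : ∀ y, 0 < y → evenPot (fun x => f (l * x)) y = l⁻¹ * evenPot f (l * y) := fun y hy => by
    have h := integral_comp_mul_left_Ioi (fun x => f x * evenK (x / (l * y))) 0 hl
    simp only [mul_zero, smul_eq_mul, mul_div_mul_left _ _ hl.ne'] at h
    exact h
  have h3 : ∫ y in Ioi 0, f y * evenPot (fun x => f (l * x)) y =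
      ∫ y in Ioi 0, l⁻¹ * (f (l⁻¹ * (l * y)) * evenPot f (l * y)) := by
    refine setIntegral_congr_fun measurableSet_Ioi fun y hy => ?_
    rw [h2 y hy, inv_mul_cancel_left₀ hl.ne']; ring
  have h4 := integral_comp_mul_left_Ioi (fun z => f (l⁻¹ * z) * evenPot f z) 0 hl
  simp only [mul_zero, smul_eq_mul] at h4
  rw [h1, h3, integral_const_mul, h4, dilPair]
  ring

/-- Differentiating `A(l) = l⁻² A(1/l)` at `l = 1` gives `A'(1) = -A(1)`, and the integral is `A(1)
+ A'(1)`. This avoids differentiating the logarithmically singular `evenK`. -/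
lemma MemD.integral_dilD_mul_evenPot (hf : MemD f) (hi : IntegrableOn f (Ioi 0))
    (hL : ∀ x, 0 < x → x ≠ L → DifferentiableAt ℝ f x) :
    ∫ x in Ioi 0, dilD f x * evenPot f x = 0 := by
  have hme := measurable_evenPot hf.continuous.measurable
  have hA := hf.hasDerivAt_dilPair hi hL
  set A' := ∫ x in Ioi 0, x * deriv f x * evenPot f x
  have hinv : HasDerivAt (fun l : ℝ => l⁻¹) (-1) 1 := by
    simpa using hasDerivAt_inv (one_ne_zero (α := ℝ))
  have hA2 : HasDerivAt (dilPair f) A' (1 : ℝ)⁻¹ := by rw [inv_one]; exact hA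
  have h2 := (hinv.pow 2).mul (hA2.comp 1 hinv)
  have h3 : HasDerivAt (dilPair f) _ 1 := h2.congr_of_eventuallyEq (by
    filter_upwards [Ioi_mem_nhds (show (0 : ℝ) < 1 from one_pos)] with l hl
    exact hf.dilPair_inv hi hl)
  have h4 := hA.unique h3
  have h5 : A' = -dilPair f 1 := by
    simp at h4
    linarith
  have h6 : dilPair f 1 = ∫ x in Ioi 0, f x * evenPot f x := by simp [dilPair]
  have hb : ∀ {k : ℝ → ℝ}, IntegrableOn k (Ioi 0) →
      IntegrableOn (fun x => k x * evenPot f x) (Ioi 0) := fun hk => by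
    simp only [mul_comm _ (evenPot f _)]
    exact integrable_mul_of_bound hk hme.aestronglyMeasurable fun x hx => hf.abs_evenPot_le hi hx
  have h7 : ∫ x in Ioi 0, dilD f x * evenPot f x = (∫ x in Ioi 0, f x * evenPot f x) + A' := by
    rw [← integral_add (hb hi) (hb (hf.integrableOn_mul_deriv hi))]
    exact integral_congr_ae (Eventually.of_forall fun x => by simp only [dilD]; ring)
  rw [h7, h5, h6]; ring

/-! ### Moments of `T f` and the integrated fixed point equation -/

lemma MemD.pi_mul_T (hf : MemD f) (hi : IntegrableOn f (Ioi 0)) {x : ℝ} (hx : 0 < x) :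
    Real.pi * T f x = evenPot f x + oddPot f x - ∫ y in Ioi 0, f y := by
  have h := hf.T_eq_sub 0 hx
  simp only [sub_zero] at h
  rw [h]
  exact integral_mul_kerT_eq hf.continuous.measurable hf.antitoneOn_Ioi (fun y _ => hf.nonneg y) hi hx

lemma MemD.integral_T_mul (hf : MemD f) (hi : IntegrableOn f (Ioi 0)) {k : ℝ → ℝ}
    (hk : IntegrableOn k (Ioi 0)) :
    Real.pi * ∫ x in Ioi 0, T f x * k x = (∫ x in Ioi 0, k x * evenPot f x) +
      (∫ x in Ioi 0, k x * oddPot f x) - (∫ y in Ioi 0, f y) * ∫ x in Ioi 0, k x := by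
  have hmf := hf.continuous.measurable
  have h1 : IntegrableOn (fun x => k x * evenPot f x) (Ioi 0) := by
    simp only [mul_comm _ (evenPot f _)]
    exact integrable_mul_of_bound hk (measurable_evenPot hmf).aestronglyMeasurable
      fun x hx => hf.abs_evenPot_le hi hx
  have h2 : IntegrableOn (fun x => k x * oddPot f x) (Ioi 0) := by
    simp only [mul_comm _ (oddPot f _)]
    exact integrable_mul_of_bound hk (measurable_oddPot hmf).aestronglyMeasurable
      fun x hx => hf.abs_oddPot_le hi hx
  have h3 : IntegrableOn (fun x => k x * evenPot f x + k x * oddPot f x) (Ioi 0) := h1.add h2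
  rw [← integral_add h1 h2, ← integral_const_mul, ← integral_const_mul,
    ← integral_sub h3 (hk.const_mul _)]
  refine setIntegral_congr_fun measurableSet_Ioi fun x hx => ?_
  rw [← mul_assoc, hf.pi_mul_T hi hx]
  ring

lemma MemD.abs_T_le_of_integrable (hf : MemD f) (hi : IntegrableOn f (Ioi 0)) {x : ℝ} (hx : 0 < x) :
    |T f x| ≤ 2 / Real.pi * ∫ y in Ioi 0, f y := by
  have h1 : -(2 * ∫ y in Ioi 0, f y) ≤ Real.pi * T f x := by
    have h := hf.T_eq_sub 0 hx
    simp only [sub_zero] at h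
    rw [h, ← integral_const_mul, ← integral_neg]
    refine integral_mono_ae (hi.const_mul 2).neg (hf.integrableOn_mul_kerT hx) ?_
    filter_upwards [ae_pos] with y hy
    have := neg_two_le_kerT (div_pos hy hx)
    nlinarith [hf.nonneg y]
  have h2 := hf.T_nonpos hx.le
  rw [abs_of_nonpos h2, div_mul_eq_mul_div, le_div_iff₀ Real.pi_pos]
  linarith

/-- `T f` is antitone with a finite limit at infinity, so its derivative is integrable. -/
lemma MemD.integrableOn_deriv_T (hf : MemD f) (hi : IntegrableOn f (Ioi 0)) :
    IntegrableOn (deriv (T f)) (Ioi 0) := by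
  have hlim : Tendsto (T f) atTop (𝓝 (Real.pi⁻¹ * -(2 * ∫ y in Ioi 0, f y))) := by
    refine ((tendsto_integral_mul_kerT hf.continuous.measurable hf.antitoneOn_Ioi
      (fun y _ => hf.nonneg y) hi).const_mul Real.pi⁻¹).congr' ?_
    filter_upwards [eventually_gt_atTop 0] with x hx
    rw [T_eq f hx, one_div]
  exact integrableOn_Ioi_deriv_of_nonpos (hf.continuousOn_T 0 self_mem_Ici)
    (fun x hx => (hf.differentiableAt_T hx).hasDerivAt) (fun x hx => hf.deriv_T_nonpos hx) hlim

lemma MemD.integrableOn_deriv_T_mul (hf : MemD f) (hi : IntegrableOn f (Ioi 0)) :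
    IntegrableOn (fun x => deriv (T f) x * (x * f x)) (Ioi 0) := by
  simp only [mul_comm (deriv (T f) _)]
  refine integrable_mul_of_bound (hf.integrableOn_deriv_T hi)
    (continuous_id.mul hf.continuous).aestronglyMeasurable (B := ∫ y in Ioi 0, f y) fun x hx => ?_
  have := hf.nonneg x
  rw [abs_of_nonneg (by positivity)]
  exact mul_le_integral_of_antitoneOn hf.antitoneOn_Ioi (fun y _ => hf.nonneg y) hi hx

lemma MemD.integral_deriv_T_mul (hf : MemD f) (hi : IntegrableOn f (Ioi 0))
    (hL : ∀ x, 0 < x → x ≠ L → DifferentiableAt ℝ f x) :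
    Real.pi * ∫ x in Ioi 0, deriv (T f) x * (x * f x) = -energy f := by
  have h1 := hf.integral_by_parts hi hL (φ := T f) (φ' := deriv (T f)) countable_empty
    (hf.continuousOn_T.mono Ioi_subset_Ici_self) (fun x hx => hf.abs_T_le_of_integrable hi hx)
    (fun x hx => (hf.differentiableAt_T hx.1).hasDerivAt) (hf.integrableOn_deriv_T_mul hi)
  have h2 := hf.integral_T_mul hi (hf.integrableOn_dilD hi)
  rw [hf.integral_dilD_mul_evenPot hi hL, hf.integral_dilD_mul_oddPot hi hL,
    hf.integral_dilD hi hL] at h2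
  have h3 : ∫ x in Ioi 0, deriv (T f) x * (x * f x) = -∫ x in Ioi 0, T f x * dilD f x := by linarith
  rw [h3, mul_neg, h2]; ring

lemma MemD.integral_T_mul_self (hf : MemD f) (hi : IntegrableOn f (Ioi 0)) :
    Real.pi * ∫ x in Ioi 0, T f x * f x = energy f - (∫ y in Ioi 0, f y) ^ 2 := by
  rw [hf.integral_T_mul hi hi, hf.integral_mul_oddPot hi, energy]; ring

/-- By the differential equation, `(den + 2a T f)(x f)' = den f + 2 f T f + 2 x f (T f)'`.
Integrating, with parts on the left, leaves only moments expressed through `I` and `E`. -/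
lemma MemD.fixed_identity {a : ℝ} (hf : MemD f) (ha : a ≤ 1) (hfix : R a f = f) :
    Real.pi * (den a f * ∫ y in Ioi 0, f y) =
      2 * (∫ y in Ioi 0, f y) ^ 2 + 2 * a * energy f := by
  have hi := hf.integrableOn_of_fixed ha hfix
  obtain ⟨L, hode⟩ := hf.exists_ode ha hfix
  have hL : ∀ x, 0 < x → x ≠ L → DifferentiableAt ℝ f x := fun x hx h => (hode x hx h).1
  have hTi := hf.integrableOn_deriv_T_mul hi
  have hTf : IntegrableOn (fun x => T f x * f x) (Ioi 0) :=
    integrable_mul_of_bound hi ((hf.continuousOn_T.mono Ioi_subset_Ici_self).aestronglyMeasurable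
      measurableSet_Ioi) fun x hx => hf.abs_T_le_of_integrable hi hx
  have h1 := hf.integral_by_parts hi hL (φ := fun x => den a f + 2 * a * T f x)
    (φ' := fun x => 2 * a * deriv (T f) x)
    (B := |den a f| + |2 * a| * (2 / Real.pi * ∫ y in Ioi 0, f y)) countable_empty
    (continuousOn_const.add (continuousOn_const.mul (hf.continuousOn_T.mono Ioi_subset_Ici_self)))
    (fun x hx => (abs_add_le _ _).trans (by
      rw [abs_mul]; have := hf.abs_T_le_of_integrable hi hx; gcongr))
    (fun x hx => ((hf.differentiableAt_T hx.1).hasDerivAt.const_mul _).const_add _)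
    ((hTi.const_mul (2 * a)).congr (Eventually.of_forall fun x => by simp only; ring))
  have h2 : ∫ x in Ioi 0, 2 * a * deriv (T f) x * (x * f x) =
      2 * a * ∫ x in Ioi 0, deriv (T f) x * (x * f x) := by
    rw [← integral_const_mul]
    exact integral_congr_ae (Eventually.of_forall fun x => by simp only; ring)
  have h3 : ∫ x in Ioi 0, (den a f + 2 * a * T f x) * dilD f x =
      (den a f * ∫ x in Ioi 0, f x) + (2 * ∫ x in Ioi 0, T f x * f x) +
        2 * ∫ x in Ioi 0, deriv (T f) x * (x * f x) := by
    have h4 : IntegrableOn (fun x => den a f * f x + 2 * (T f x * f x)) (Ioi 0) :=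
      (hi.const_mul _).add (hTf.const_mul 2)
    rw [← integral_const_mul, ← integral_const_mul, ← integral_const_mul,
      ← integral_add (hi.const_mul _) (hTf.const_mul 2), ← integral_add h4 (hTi.const_mul 2)]
    refine integral_congr_ae ?_
    filter_upwards [ae_ne_pos L] with x hx
    have h4 := (hode x hx.1 hx.2).2
    simp only [dilD, mul_add, h4]
    ring
  rw [h2, h3] at h1
  have h5 := hf.integral_deriv_T_mul hi hL
  have h6 := hf.integral_T_mul_self hi
  linear_combination Real.pi * h1 - (2 * a + 2) * h5 - 2 * h6

end Energy

/-! ### The even kernel on `(0, 1)` -/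

/-- The series has positive coefficients: this gives the monotonicity of `evenK` on `(0, 1)` and,
termwise, the integral of `ell r / r`. -/
lemma hasSum_ell_div {r : ℝ} (h0 : 0 < r) (h1 : r < 1) :
    HasSum (fun k : ℕ => 2 * (1 / (2 * (k : ℝ) + 1)) * r ^ (2 * k)) (ell r / r) := by
  have h := (Real.hasSum_log_sub_log_of_abs_lt_one (abs_lt.2 ⟨by linarith, h1⟩)).div_const r
  have e : Real.log (1 + r) - Real.log (1 - r) = ell r := by
    rw [ell, Real.log_abs, Real.log_div (by linarith) (by linarith)]
  rw [e] at h
  refine h.congr_fun fun k => ?_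
  rw [pow_succ]; field_simp

lemma evenK_eq_ell_div {r : ℝ} (h0 : 0 < r) : evenK r = (1 + r ^ 2) / 2 * (ell r / r) - 1 := by
  unfold evenK; field_simp; ring

lemma monotoneOn_evenK : MonotoneOn evenK (Ioo 0 1) := by
  intro r hr s hs hrs
  have h0 := hr.1
  have h1 : ell r / r ≤ ell s / s :=
    hasSum_le (fun k => by gcongr) (hasSum_ell_div hr.1 hr.2) (hasSum_ell_div hs.1 hs.2)
  have h2 : 0 ≤ ell r / r := (hasSum_ell_div hr.1 hr.2).nonneg fun k => by positivity
  rw [evenK_eq_ell_div hr.1, evenK_eq_ell_div hs.1]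
  gcongr

lemma integrableOn_evenK : IntegrableOn evenK (Ioc 0 1) := by
  refine Integrable.mono' (integrableOn_evenK_div.mono_set Ioc_subset_Ioi_self).norm
    measurable_evenK.aestronglyMeasurable ?_
  filter_upwards [ae_restrict_mem measurableSet_Ioc] with r hr
  rw [norm_div, Real.norm_of_nonneg hr.1.le]
  exact le_div_self (norm_nonneg _) hr.1 hr.2

lemma integrableOn_ell_div : IntegrableOn (fun r => ell r / r) (Ioc 0 1) := by
  have hme := measurable_ell
  have h : IntegrableOn (fun r => |evenK r| + 1) (Ioc 0 1) :=
    integrableOn_evenK.abs.add (integrableOn_const (by simp))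
  refine Integrable.mono' (h.const_mul 2) (Measurable.aestronglyMeasurable (by fun_prop)) ?_
  filter_upwards [ae_restrict_mem measurableSet_Ioc] with r hr
  have h1 : ell r / r = 2 / (1 + r ^ 2) * (evenK r + 1) := by
    rw [evenK_eq_ell_div hr.1]; field_simp; ring
  rw [h1, norm_mul, Real.norm_of_nonneg (by positivity), Real.norm_eq_abs]
  have h2 : 2 / (1 + r ^ 2) ≤ 2 := by
    rw [div_le_iff₀ (by positivity)]; nlinarith [sq_nonneg r]
  have h3 : |evenK r + 1| ≤ |evenK r| + 1 := by simpa using abs_add_le (evenK r) 1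
  gcongr

lemma hasSum_inv_odd_sq : HasSum (fun k : ℕ => 1 / (2 * (k : ℝ) + 1) ^ 2) (Real.pi ^ 2 / 8) := by
  have hz := hasSum_zeta_two
  have he : HasSum (fun k : ℕ => 1 / ((2 * k : ℕ) : ℝ) ^ 2) (Real.pi ^ 2 / 6 / 4) := by
    refine (hz.div_const 4).congr_fun fun k => ?_
    push_cast
    rw [mul_pow, one_div, one_div, mul_inv]; ring
  have ho : Summable (fun k : ℕ => 1 / ((2 * k + 1 : ℕ) : ℝ) ^ 2) :=
    hz.summable.comp_injective (i := fun k : ℕ => 2 * k + 1) fun a b h => by simpa using h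
  have h := (he.even_add_odd (f := fun n : ℕ => 1 / (n : ℝ) ^ 2) ho.hasSum).unique hz
  have h2 : ∑' k : ℕ, 1 / ((2 * k + 1 : ℕ) : ℝ) ^ 2 = Real.pi ^ 2 / 8 := by linarith
  rw [← h2]
  simpa using ho.hasSum

lemma integral_ell_div : ∫ r in Ioc (0 : ℝ) 1, ell r / r = Real.pi ^ 2 / 4 := by
  have hint : ∀ k : ℕ, ∫ r in Ioc (0 : ℝ) 1, 2 * (1 / (2 * (k : ℝ) + 1)) * r ^ (2 * k) =
      2 * (1 / (2 * (k : ℝ) + 1) ^ 2) := fun k => by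
    rw [← intervalIntegral.integral_of_le zero_le_one, intervalIntegral.integral_const_mul,
      integral_pow]
    push_cast
    simp
    field_simp
  have hs := hasSum_inv_odd_sq.mul_left 2
  have h := hasSum_integral_of_summable_integral_norm (μ := volume.restrict (Ioc (0 : ℝ) 1))
    (F := fun (k : ℕ) (r : ℝ) => 2 * (1 / (2 * (k : ℝ) + 1)) * r ^ (2 * k))
    (fun k => Continuous.integrableOn_Ioc (by fun_prop)) (hs.summable.congr fun k => by
      rw [← hint k]
      refine setIntegral_congr_fun measurableSet_Ioc fun r hr => ?_
      have := hr.1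
      exact (Real.norm_of_nonneg (by positivity)).symm)
  simp only [hint] at h
  have h2 := h.unique hs
  have h3 : ∫ r in Ioc (0 : ℝ) 1, ell r / r =
      ∫ r in Ioc (0 : ℝ) 1, ∑' k : ℕ, 2 * (1 / (2 * (k : ℝ) + 1)) * r ^ (2 * k) := by
    rw [integral_Ioc_eq_integral_Ioo, integral_Ioc_eq_integral_Ioo]
    exact setIntegral_congr_fun measurableSet_Ioo fun r hr => (hasSum_ell_div hr.1 hr.2).tsum_eq.symm
  rw [h3, h2]; ring

lemma integral_evenK_parabola :
    ∫ r in Ioc (0 : ℝ) 1, evenK r * (3 - r ^ 2) = 8 / 3 * muBar := by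
  -- Expanding `(r + r⁻¹)(3 - r²)/2` leaves `3/(2r)` as the only singular coefficient of `ell`. Its
  -- integral is the source of `π²`; the remainder has the elementary primitive `Ψ` below.
  set p : ℝ → ℝ := fun r => evenK r * (3 - r ^ 2) - 3 / 2 * (ell r / r) with hp
  have hi1 : IntegrableOn (fun r => evenK r * (3 - r ^ 2)) (Ioc 0 1) := by
    have hme := measurable_evenK
    refine Integrable.mono' (integrableOn_evenK.norm.mul_const 3)
      (Measurable.aestronglyMeasurable (by fun_prop)) ?_
    filter_upwards [ae_restrict_mem measurableSet_Ioc] with r hr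
    rw [norm_mul]
    gcongr
    rw [Real.norm_of_nonneg (by nlinarith [hr.1, hr.2])]
    nlinarith [sq_nonneg r]
  have hi2 := integrableOn_ell_div.const_mul (3 / 2)
  have hcont : ContinuousOn (fun r => r * oddK r) (Ici 0) := by
    have : (fun r => r * oddK r) = fun r => primT r + r := by
      ext r; unfold primT; ring
    rw [this]; exact continuousOn_primT.add continuousOn_id
  set Ψ : ℝ → ℝ := fun r => r * oddK r * (1 - (r ^ 2 + 1) / 4) + (r ^ 3 / 4 - 9 / 4 * r) with hΨ
  have hftc : ∫ r in (0 : ℝ)..1, p r = Ψ 1 - Ψ 0 := by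
    refine integral_eq_of_hasDerivAt_off_countable_of_le Ψ p zero_le_one countable_empty ?_ ?_ ?_
    · exact ((hcont.mul (by fun_prop)).add (by fun_prop)).mono Icc_subset_Ici_self
    · rintro r ⟨⟨h0, h1⟩, -⟩
      have hd := ((((hasDerivAt_id r).mul (hasDerivAt_oddK h0 h1.ne)).mul
        ((((hasDerivAt_pow 2 r).add_const 1).div_const 4).const_sub 1))).add
        (((hasDerivAt_pow 3 r).div_const 4).sub ((hasDerivAt_id r).const_mul (9 / 4)))
      refine hd.congr_deriv ?_
      simp only [hp, id, Pi.mul_apply, oddK, evenK]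
      field_simp
      ring
    · rw [intervalIntegrable_iff_integrableOn_Ioc_of_le zero_le_one]
      exact hi1.sub hi2
  have h1 : ∫ r in Ioc (0 : ℝ) 1, p r =
      (∫ r in Ioc (0 : ℝ) 1, evenK r * (3 - r ^ 2)) - 3 / 2 * ∫ r in Ioc (0 : ℝ) 1, ell r / r := by
    rw [← integral_const_mul, ← integral_sub hi1 hi2]
  rw [intervalIntegral.integral_of_le zero_le_one, h1, integral_ell_div] at hftc
  have h2 : Ψ 1 = -2 := by simp [hΨ, oddK]; norm_num
  have h3 : Ψ 0 = 0 := by simp [hΨ]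
  rw [h2, h3] at hftc
  unfold muBar
  linarith

/-! ### Double integrals of homogeneous kernels -/

open scoped ENNReal

lemma lintegral_Ioi_scale {φ : ℝ → ℝ≥0∞} (hφ : Measurable φ) {x : ℝ} (hx : 0 < x) :
    ∫⁻ y in Ioi 0, φ y = ENNReal.ofReal x * ∫⁻ r in Ioi 0, φ (x * r) := by
  have h : ∫⁻ y, (Ioi (0 : ℝ)).indicator φ y =
      ∫⁻ y, (Ioi (0 : ℝ)).indicator φ y ∂(ENNReal.ofReal |x| • Measure.map (x * ·) volume) := by
    rw [Real.smul_map_volume_mul_left hx.ne']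
  rw [lintegral_smul_measure, abs_of_pos hx,
    lintegral_map (hφ.indicator measurableSet_Ioi) (measurable_const_mul x)] at h
  rw [← lintegral_indicator measurableSet_Ioi, h, ← lintegral_indicator measurableSet_Ioi, smul_eq_mul]
  congr 1
  refine lintegral_congr fun r => ?_
  simp [indicator, mul_pos_iff_of_pos_left hx]

/-- The form `∫∫ F(x) G(y) k(y / x)` on `(0, ∞)²`. -/
def homForm (k F G : ℝ → ℝ≥0∞) : ℝ≥0∞ :=
  ∫⁻ x in Ioi 0, ∫⁻ y in Ioi 0, F x * G y * k (y / x)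

/-- The multiplicative correlation `∫ x F(x) G(r x) dx`. -/
def corr (F G : ℝ → ℝ≥0∞) (r : ℝ) : ℝ≥0∞ :=
  ∫⁻ x in Ioi 0, ENNReal.ofReal x * F x * G (x * r)

/-- The part of `homForm` over `y < x`. -/
def homHalf (k F G : ℝ → ℝ≥0∞) : ℝ≥0∞ :=
  ∫⁻ x in Ioi 0, ∫⁻ y in Ioi 0, {p : ℝ × ℝ | p.2 < p.1}.indicator
    (fun p => F p.1 * G p.2 * k (p.2 / p.1)) (x, y)

section homForm

variable {k F G : ℝ → ℝ≥0∞}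

/-- Substitute `y = x r` and exchange the integrals: a kernel of degree 0 sees the pair only through
its correlation in the ratio. -/
lemma homHalf_eq (hk : Measurable k) (hF : Measurable F) (hG : Measurable G) :
    homHalf k F G = ∫⁻ r in Ioo 0 1, k r * corr F G r := by
  have hS : MeasurableSet {p : ℝ × ℝ | p.2 < p.1} := measurableSet_lt measurable_snd measurable_fst
  have hm : Measurable fun p : ℝ × ℝ => {p : ℝ × ℝ | p.2 < p.1}.indicator
      (fun p => F p.1 * G p.2 * k (p.2 / p.1)) p :=
    Measurable.indicator (by fun_prop) hS
  have h1 : homHalf k F G = ∫⁻ x in Ioi 0, ∫⁻ r in Ioi 0,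
      (Ioo 0 1).indicator (fun r => k r * (ENNReal.ofReal x * F x * G (x * r))) r := by
    refine setLIntegral_congr_fun measurableSet_Ioi fun x (hx : 0 < x) => ?_
    have hmx : Measurable fun y => {p : ℝ × ℝ | p.2 < p.1}.indicator
        (fun p => F p.1 * G p.2 * k (p.2 / p.1)) (x, y) := hm.comp measurable_prodMk_left
    rw [lintegral_Ioi_scale hmx hx, ← lintegral_const_mul]
    · refine setLIntegral_congr_fun measurableSet_Ioi fun r (hr : 0 < r) => ?_
      by_cases h : r < 1
      · have h2 : (x, x * r) ∈ {p : ℝ × ℝ | p.2 < p.1} := by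
          simp only [mem_ofPred_eq]; exact mul_lt_of_lt_one_right hx h
        rw [indicator_of_mem h2, indicator_of_mem (show r ∈ Ioo (0 : ℝ) 1 from ⟨hr, h⟩)]
        simp only [mul_div_cancel_left₀ _ hx.ne']
        ring
      · have h2 : (x, x * r) ∉ {p : ℝ × ℝ | p.2 < p.1} := by
          simp only [mem_ofPred_eq, not_lt]; exact le_mul_of_one_le_right hx.le (not_lt.1 h)
        rw [indicator_of_notMem h2, indicator_of_notMem (fun hc => h hc.2), mul_zero]
    · exact hmx.comp (measurable_const_mul x)
  rw [h1, lintegral_lintegral_swap]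
  · rw [← lintegral_indicator measurableSet_Ioo, ← lintegral_indicator measurableSet_Ioi]
    refine lintegral_congr fun r => ?_
    by_cases h : r ∈ Ioo (0 : ℝ) 1
    · have h0 : r ∈ Ioi (0 : ℝ) := h.1
      simp only [indicator_of_mem h, indicator_of_mem h0]
      rw [lintegral_const_mul _ (by fun_prop), corr]
    · simp [indicator_of_notMem h]
  · refine Measurable.aemeasurable ?_
    have : (Function.uncurry fun x r => (Ioo (0 : ℝ) 1).indicator
        (fun r => k r * (ENNReal.ofReal x * F x * G (x * r))) r) =
        (Prod.snd ⁻¹' Ioo (0 : ℝ) 1).indicator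
          fun p : ℝ × ℝ => k p.2 * (ENNReal.ofReal p.1 * F p.1 * G (p.1 * p.2)) := by
      ext p; simp [Function.uncurry_def, indicator]
    rw [this]
    exact Measurable.indicator (by fun_prop) (measurable_snd measurableSet_Ioo)

lemma homForm_eq_add (hk : Measurable k) (hF : Measurable F) (hG : Measurable G)
    (hinv : ∀ r, 0 < r → k r⁻¹ = k r) : homForm k F G = homHalf k F G + homHalf k G F := by
  have hS : MeasurableSet {p : ℝ × ℝ | p.2 < p.1} := measurableSet_lt measurable_snd measurable_fst
  have hm : ∀ {F G : ℝ → ℝ≥0∞}, Measurable F → Measurable G →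
      Measurable fun p : ℝ × ℝ => {p : ℝ × ℝ | p.2 < p.1}.indicator
        (fun p => F p.1 * G p.2 * k (p.2 / p.1)) p := fun hF hG =>
    Measurable.indicator (by fun_prop) hS
  have h1 : homHalf k G F = ∫⁻ x in Ioi 0, ∫⁻ y in Ioi 0, {p : ℝ × ℝ | p.2 < p.1}.indicator
      (fun p => G p.1 * F p.2 * k (p.2 / p.1)) (y, x) :=
    lintegral_lintegral_swap (hm hG hF).aemeasurable
  rw [h1, homHalf, ← lintegral_add_left]
  · refine setLIntegral_congr_fun measurableSet_Ioi fun x (hx : 0 < x) => ?_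
    have hmx : Measurable fun y => {p : ℝ × ℝ | p.2 < p.1}.indicator
        (fun p => F p.1 * G p.2 * k (p.2 / p.1)) (x, y) := (hm hF hG).comp measurable_prodMk_left
    rw [← lintegral_add_left hmx]
    refine lintegral_congr_ae ?_
    filter_upwards [ae_ne_pos x] with y hy
    rcases lt_or_gt_of_ne hy.2 with h | h
    · rw [indicator_of_mem (show (x, y) ∈ {p : ℝ × ℝ | p.2 < p.1} from h),
        indicator_of_notMem (show (y, x) ∉ {p : ℝ × ℝ | p.2 < p.1} from not_lt.2 (le_of_lt h)), add_zero]
    · rw [indicator_of_mem (show (y, x) ∈ {p : ℝ × ℝ | p.2 < p.1} from h),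
        indicator_of_notMem (show (x, y) ∉ {p : ℝ × ℝ | p.2 < p.1} from not_lt.2 (le_of_lt h)), zero_add]
      simp only
      rw [← hinv _ (div_pos hy.1 hx), inv_div, mul_comm (F x)]
  · exact (hm hF hG).lintegral_prod_right'

lemma homForm_eq (hk : Measurable k) (hF : Measurable F) (hG : Measurable G)
    (hinv : ∀ r, 0 < r → k r⁻¹ = k r) :
    homForm k F G = ∫⁻ r in Ioo 0 1, k r * (corr F G r + corr G F r) := by
  rw [homForm_eq_add hk hF hG hinv, homHalf_eq hk hF hG, homHalf_eq hk hG hF, ← lintegral_add_left]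
  · simp only [mul_add]
  · refine hk.mul ?_
    have : Measurable fun p : ℝ × ℝ => ENNReal.ofReal p.2 * F p.2 * G (p.2 * p.1) := by fun_prop
    exact this.lintegral_prod_right'

lemma homForm_one (hF : Measurable F) (hG : Measurable G) :
    homForm (fun _ => 1) F G = (∫⁻ x in Ioi 0, F x) * ∫⁻ y in Ioi 0, G y := by
  simp only [homForm, mul_one, lintegral_const_mul _ hG, lintegral_mul_const _ hF]

end homForm

/-! ### Truncated parabolas -/

/-- The truncated parabola `(s - x²)₊`. -/
def parab (s x : ℝ) : ℝ := max (s - x ^ 2) 0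

/-- The truncated parabola with values in `[0, ∞]`. -/
def eparab (s x : ℝ) : ℝ≥0∞ := ENNReal.ofReal (parab s x)

lemma measurable_eparab (s : ℝ) : Measurable (eparab s) := by
  unfold eparab parab; fun_prop

/-- `w` is the smaller of the support edges `√s` and `√t / r`; below it both truncations are
inactive and the integrand is a polynomial. -/
lemma corr_eparab_aux {s t r w : ℝ} (hw : 0 ≤ w) (hs : w ^ 2 ≤ s)
    (ht : r ^ 2 * w ^ 2 ≤ t) (h : w ^ 2 = s ∨ r ^ 2 * w ^ 2 = t) :
    corr (eparab s) (eparab t) r = ENNReal.ofReal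
      (s * t * w ^ 2 / 2 - (s * r ^ 2 + t) * w ^ 4 / 4 + r ^ 2 * w ^ 6 / 6) := by
  have hval : ∫ x in (0 : ℝ)..w, x * (s - x ^ 2) * (t - (x * r) ^ 2) =
      s * t * w ^ 2 / 2 - (s * r ^ 2 + t) * w ^ 4 / 4 + r ^ 2 * w ^ 6 / 6 := by
    have hd : ∀ x ∈ uIcc 0 w, HasDerivAt
        (fun x : ℝ => s * t * x ^ 2 / 2 - (s * r ^ 2 + t) * x ^ 4 / 4 + r ^ 2 * x ^ 6 / 6)
        (x * (s - x ^ 2) * (t - (x * r) ^ 2)) x := fun x _ => by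
      have h1 := ((((hasDerivAt_pow 2 x).const_mul (s * t)).div_const 2).sub
        (((hasDerivAt_pow 4 x).const_mul (s * r ^ 2 + t)).div_const 4)).add
        (((hasDerivAt_pow 6 x).const_mul (r ^ 2)).div_const 6)
      refine h1.congr_deriv ?_
      push_cast
      ring
    rw [intervalIntegral.integral_eq_sub_of_hasDerivAt hd (Continuous.intervalIntegrable (by fun_prop) _ _)]
    ring
  have hpos : ∀ x ∈ Ioc 0 w, 0 ≤ s - x ^ 2 ∧ 0 ≤ t - (x * r) ^ 2 := fun x hx => by
    have h1 : x ^ 2 ≤ w ^ 2 := pow_le_pow_left₀ hx.1.le hx.2 2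
    have h2 : (x * r) ^ 2 ≤ r ^ 2 * w ^ 2 := by
      rw [mul_pow, mul_comm]; gcongr
    constructor <;> linarith
  rw [← hval, intervalIntegral.integral_of_le hw, ofReal_integral_eq_lintegral_ofReal
    (Continuous.integrableOn_Ioc (by fun_prop))]
  · rw [corr, ← Ioc_union_Ioi_eq_Ioi hw, lintegral_union measurableSet_Ioi Ioc_disjoint_Ioi_same]
    have h0 : ∫⁻ x in Ioi w, ENNReal.ofReal x * eparab s x * eparab t (x * r) = 0 := by
      rw [setLIntegral_congr_fun (g := fun _ => 0) measurableSet_Ioi]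
      · simp
      · intro x (hx : w < x)
        have h1 : w ^ 2 ≤ x ^ 2 := pow_le_pow_left₀ hw hx.le 2
        rcases h with h | h
        · have : parab s x = 0 := max_eq_right (by linarith)
          simp [eparab, this]
        · have h2 : r ^ 2 * w ^ 2 ≤ (x * r) ^ 2 := by
            rw [mul_pow, mul_comm]; gcongr
          have : parab t (x * r) = 0 := max_eq_right (by linarith)
          simp [eparab, this]
    rw [h0, add_zero]
    refine setLIntegral_congr_fun measurableSet_Ioc fun x hx => ?_
    have hp := hpos x hx
    have hx0 := hx.1.le
    simp only [eparab, parab, max_eq_left hp.1, max_eq_left hp.2]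
    rw [← ENNReal.ofReal_mul hx0, ← ENNReal.ofReal_mul (mul_nonneg hx0 hp.1)]
  · filter_upwards [ae_restrict_mem measurableSet_Ioc] with x hx
    exact mul_nonneg (mul_nonneg hx.1.le (hpos x hx).1) (hpos x hx).2

/-- The correlation of two truncated parabolas as a function of `u = r²`. -/
def parCorr (s t u : ℝ) : ℝ :=
  if s * u ≤ t then s ^ 2 * t / 4 - u * s ^ 3 / 12 else s * t ^ 2 / (4 * u) - t ^ 3 / (12 * u ^ 2)

lemma corr_eparab {s t r : ℝ} (hs : 0 < s) (ht : 0 < t) (hr : 0 < r) :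
    corr (eparab s) (eparab t) r = ENNReal.ofReal (parCorr s t (r ^ 2)) := by
  unfold parCorr
  split_ifs with h
  · have e : Real.sqrt s ^ 2 = s := Real.sq_sqrt hs.le
    rw [corr_eparab_aux (w := Real.sqrt s) (Real.sqrt_nonneg _) e.le
      (by rw [e]; linarith) (Or.inl e)]
    have e4 : Real.sqrt s ^ 4 = s ^ 2 := by rw [show (4 : ℕ) = 2 * 2 from rfl, pow_mul, e]
    have e6 : Real.sqrt s ^ 6 = s ^ 3 := by rw [show (6 : ℕ) = 2 * 3 from rfl, pow_mul, e]
    rw [e, e4, e6]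
    congr 1
    ring
  · have e : (Real.sqrt t / r) ^ 2 = t / r ^ 2 := by rw [div_pow, Real.sq_sqrt ht.le]
    have h1 : t / r ^ 2 ≤ s := by rw [div_le_iff₀ (by positivity)]; linarith
    have h2 : r ^ 2 * (t / r ^ 2) = t := by field_simp
    rw [corr_eparab_aux (w := Real.sqrt t / r) (by positivity) (by rw [e]; exact h1)
      (by rw [e, h2]) (Or.inr (by rw [e, h2]))]
    have e4 : (Real.sqrt t / r) ^ 4 = (t / r ^ 2) ^ 2 := by
      rw [show (4 : ℕ) = 2 * 2 from rfl, pow_mul, e]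
    have e6 : (Real.sqrt t / r) ^ 6 = (t / r ^ 2) ^ 3 := by
      rw [show (6 : ℕ) = 2 * 3 from rfl, pow_mul, e]
    rw [e, e4, e6]
    congr 1
    field_simp
    ring

/-- The symmetrized correlation of two truncated parabolas. -/
def symCorr (s t u : ℝ) : ℝ := parCorr s t u + parCorr t s u

lemma symCorr_comm (s t u : ℝ) : symCorr s t u = symCorr t s u := add_comm _ _

lemma symCorr_self {u : ℝ} (s : ℝ) (hs : 0 < s) (hu : u ≤ 1) :
    symCorr s s u = s ^ 3 / 6 * (3 - u) := by
  have : s * u ≤ s := mul_le_of_le_one_right hs.le hu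
  simp only [symCorr, parCorr, if_pos this]
  ring

lemma parCorr_nonneg {s t u : ℝ} (hs : 0 < s) (ht : 0 < t) (hu : 0 < u) : 0 ≤ parCorr s t u := by
  unfold parCorr
  split_ifs with h
  · have : u * s ^ 3 ≤ s ^ 2 * t := by
      calc u * s ^ 3 = s ^ 2 * (s * u) := by ring
        _ ≤ _ := by gcongr
    nlinarith [mul_pos (pow_pos hs 2) ht]
  · have : t ^ 3 / (12 * u ^ 2) ≤ s * t ^ 2 / (12 * u) := by
      rw [div_le_div_iff₀ (by positivity) (by positivity)]
      have : t ≤ s * u := (not_le.1 h).le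
      calc t ^ 3 * (12 * u) = t * (12 * t ^ 2 * u) := by ring
        _ ≤ (s * u) * (12 * t ^ 2 * u) := by gcongr
        _ = _ := by ring
    have h2 : s * t ^ 2 / (12 * u) ≤ s * t ^ 2 / (4 * u) := by
      gcongr; norm_num
    linarith

lemma symCorr_left {s t u : ℝ} (hs : 0 < s) (hst : s ≤ t) (hu1 : u ≤ 1) (h : t * u ≤ s) :
    symCorr s t u = (3 * s * t * (s + t) - u * (s ^ 3 + t ^ 3)) / 12 := by
  have h1 : s * u ≤ t := (mul_le_of_le_one_right hs.le hu1).trans hst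
  simp only [symCorr, parCorr, if_pos h, if_pos h1]
  ring

lemma symCorr_right {s t u : ℝ} (hs : 0 < s) (hst : s ≤ t) (hu : 0 < u) (hu1 : u ≤ 1)
    (h : s ≤ t * u) :
    symCorr s t u = (3 * s ^ 2 * t - u * s ^ 3 + 3 * t * s ^ 2 / u - s ^ 3 / u ^ 2) / 12 := by
  rcases h.eq_or_lt with h | h
  · have ht : t = s / u := by field_simp; linarith
    rw [symCorr_left hs hst hu1 h.ge, ht]
    field_simp
    ring
  · have h1 : s * u ≤ t := (mul_le_of_le_one_right hs.le hu1).trans hst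
    simp only [symCorr, parCorr, if_neg (not_le.2 h), if_pos h1]
    field_simp
    ring

/-- The weight `3 - u` is the shape of the correlation of equal parabolas, for which the quotient is
constant. Monotonicity is checked on either side of `u = s/t`, where the formula for `symCorr`
changes. -/
lemma antitoneOn_symCorr_div {s t : ℝ} (hs : 0 < s) (hst : s ≤ t) :
    AntitoneOn (fun u => symCorr s t u / (3 - u)) (Ioc 0 1) := by
  have ht : 0 < t := hs.trans_le hst
  have hleft : AntitoneOn (fun u => symCorr s t u / (3 - u)) (Ioc 0 (s / t)) := by
    intro u hu v hv huv
    have hst1 : s / t ≤ 1 := (div_le_one ht).2 hst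
    have hv1 : v ≤ 1 := hv.2.trans hst1
    have hu' : t * u ≤ s := by have := (le_div_iff₀ ht).1 hu.2; linarith
    have hv' : t * v ≤ s := by have := (le_div_iff₀ ht).1 hv.2; linarith
    simp only
    rw [symCorr_left hs hst (huv.trans hv1) hu', symCorr_left hs hst hv1 hv',
      div_le_div_iff₀ (by linarith) (by linarith)]
    have h1 : 0 ≤ (s + t) * (s - t) ^ 2 := by positivity
    nlinarith [mul_nonneg (sub_nonneg.2 huv) h1]
  have hright : AntitoneOn (fun u => symCorr s t u / (3 - u)) (Icc (s / t) 1) := by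
    have hu0 : ∀ u ∈ Icc (s / t) 1, 0 < u := fun u hu => (div_pos hs ht).trans_le hu.1
    have heq : ∀ u ∈ Icc (s / t) 1, symCorr s t u / (3 - u) =
        (3 * s ^ 2 * t - u * s ^ 3 + 3 * t * s ^ 2 * u⁻¹ - s ^ 3 * (u ^ 2)⁻¹) / 12 / (3 - u) :=
      fun u hu => by
        rw [symCorr_right hs hst (hu0 u hu) hu.2
          (by have := (div_le_iff₀ ht).1 hu.1; linarith)]
        simp only [div_eq_mul_inv]
    refine AntitoneOn.congr ?_ fun u hu => (heq u hu).symm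
    have hd : ∀ u ∈ Icc (s / t) 1, HasDerivAt (fun u =>
        (3 * s ^ 2 * t - u * s ^ 3 + 3 * t * s ^ 2 * u⁻¹ - s ^ 3 * (u ^ 2)⁻¹) / 12 / (3 - u))
        ((s ^ 2 * (t * (3 * u ^ 3 + 6 * u ^ 2 - 9 * u) + s * (-3 * u ^ 3 + 6 - 3 * u)) / u ^ 3) /
          12 / (3 - u) ^ 2) u := fun u hu => by
      have h0 := (hu0 u hu).ne'
      have h3 : 3 - u ≠ 0 := by have := hu.2; linarith
      have hd := ((((((hasDerivAt_id u).mul_const (s ^ 3)).const_sub (3 * s ^ 2 * t)).add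
        ((hasDerivAt_inv h0).const_mul (3 * t * s ^ 2))).sub
        (((hasDerivAt_pow 2 u).inv (pow_ne_zero 2 h0)).const_mul (s ^ 3))).div_const 12).div
        ((hasDerivAt_id u).const_sub 3) h3
      refine hd.congr_deriv ?_
      simp only [id, Pi.add_apply, Pi.sub_apply, Pi.inv_apply]
      push_cast
      field_simp
      ring
    refine antitoneOn_of_deriv_nonpos (convex_Icc _ _)
      (fun u hu => (hd u hu).continuousAt.continuousWithinAt) (fun u hu => ?_) fun u hu => ?_
    · exact (hd u (interior_subset hu)).differentiableAt.differentiableWithinAt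
    · have hu := interior_subset hu
      rw [(hd u hu).deriv]
      have h0 := hu0 u hu
      have h1 := hu.2
      have h2 : s ≤ t * u := by have := (div_le_iff₀ ht).1 hu.1; linarith
      have h3 : 0 ≤ -3 * u ^ 3 + 6 - 3 * u := by
        have : u ^ 3 ≤ 1 := pow_le_one₀ h0.le h1
        linarith
      have h4 : s * (-3 * u ^ 3 + 6 - 3 * u) ≤ t * u * (-3 * u ^ 3 + 6 - 3 * u) := by gcongr
      have h5 : 0 ≤ t * (u * ((u - 1) ^ 2 * (u + 1))) := by positivity
      -- The worst case is `s = t u`, where the expression equals `-3 t u (u - 1)² (u + 1)`.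
      have h6 : t * (3 * u ^ 3 + 6 * u ^ 2 - 9 * u) + s * (-3 * u ^ 3 + 6 - 3 * u) ≤ 0 := by nlinarith
      refine div_nonpos_of_nonpos_of_nonneg (div_nonpos_of_nonpos_of_nonneg
        (div_nonpos_of_nonpos_of_nonneg ?_ (by positivity)) (by norm_num)) (by positivity)
      exact mul_nonpos_of_nonneg_of_nonpos (by positivity) h6
  intro u hu v hv huv
  have hm : s / t ∈ Ioc 0 (s / t) := ⟨div_pos hs ht, le_rfl⟩
  have hm1 : s / t ∈ Icc (s / t) 1 := ⟨le_rfl, (div_le_one ht).2 hst⟩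
  rcases le_total v (s / t) with h | h
  · exact hleft ⟨hu.1, huv.trans h⟩ ⟨hv.1, h⟩ huv
  rcases le_total u (s / t) with h' | h'
  · exact (hright hm1 ⟨h, hv.2⟩ h).trans (hleft ⟨hu.1, h'⟩ hm h')
  · exact hright ⟨h', hu.2⟩ ⟨h, hv.2⟩ huv

/-! ### The energy of parabolas -/

/-- The even kernel with values in `[0, ∞]`. -/
def eker (r : ℝ) : ℝ≥0∞ := ENNReal.ofReal (evenK r)

lemma measurable_eker : Measurable eker := measurable_evenK.ennreal_ofReal

lemma parCorr_le {s t u : ℝ} (hs : 0 < s) (ht : 0 < t) (hu : 0 < u) :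
    parCorr s t u ≤ s ^ 2 * t / 4 := by
  unfold parCorr
  split_ifs with h
  · have : 0 ≤ u * s ^ 3 / 12 := by positivity
    linarith
  · have h1 : s * t ^ 2 / (4 * u) ≤ s ^ 2 * t / 4 := by
      rw [div_le_div_iff₀ (by positivity) (by positivity)]
      calc s * t ^ 2 * 4 = t * (4 * s * t) := by ring
        _ ≤ (s * u) * (4 * s * t) := by gcongr; exact (not_le.1 h).le
        _ = _ := by ring
    have : 0 ≤ t ^ 3 / (12 * u ^ 2) := by positivity
    linarith

lemma measurable_parCorr (s t : ℝ) : Measurable (parCorr s t) := by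
  unfold parCorr
  refine Measurable.ite ?_ (by fun_prop) (by fun_prop)
  exact measurableSet_le (by fun_prop) measurable_const

lemma measurable_symCorr (s t : ℝ) : Measurable (symCorr s t) :=
  (measurable_parCorr s t).add (measurable_parCorr t s)

lemma corr_add_corr_eparab {s t r : ℝ} (hs : 0 < s) (ht : 0 < t) (hr : 0 < r) :
    corr (eparab s) (eparab t) r + corr (eparab t) (eparab s) r =
      ENNReal.ofReal (symCorr s t (r ^ 2)) := by
  rw [corr_eparab hs ht hr, corr_eparab ht hs hr, symCorr,
    ENNReal.ofReal_add (parCorr_nonneg hs ht (by positivity)) (parCorr_nonneg ht hs (by positivity))]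

lemma integrableOn_symCorr {s t : ℝ} (hs : 0 < s) (ht : 0 < t) {k : ℝ → ℝ}
    (hk : IntegrableOn k (Ioo 0 1)) :
    IntegrableOn (fun r => k r * symCorr s t (r ^ 2)) (Ioo 0 1) := by
  refine Integrable.mono' (hk.norm.mul_const (s ^ 2 * t / 4 + t ^ 2 * s / 4))
    (hk.aestronglyMeasurable.mul
      ((measurable_symCorr s t).comp (measurable_id.pow_const 2)).aestronglyMeasurable) ?_
  filter_upwards [ae_restrict_mem measurableSet_Ioo] with r hr
  have hr2 : 0 < r ^ 2 := by have := hr.1; positivity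
  rw [norm_mul]
  gcongr
  rw [symCorr, Real.norm_of_nonneg (add_nonneg (parCorr_nonneg hs ht hr2) (parCorr_nonneg ht hs hr2))]
  exact add_le_add (parCorr_le hs ht hr2) (parCorr_le ht hs hr2)

lemma homForm_eparab {s t : ℝ} (hs : 0 < s) (ht : 0 < t) {k : ℝ → ℝ} (hm : Measurable k)
    (hk : IntegrableOn k (Ioo 0 1)) (hk0 : ∀ r ∈ Ioo (0 : ℝ) 1, 0 ≤ k r)
    (hinv : ∀ r, 0 < r → k r⁻¹ = k r) :
    homForm (fun r => ENNReal.ofReal (k r)) (eparab s) (eparab t) =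
      ENNReal.ofReal (∫ r in Ioo 0 1, k r * symCorr s t (r ^ 2)) := by
  rw [homForm_eq hm.ennreal_ofReal (measurable_eparab s) (measurable_eparab t)
    (fun r hr => by rw [hinv r hr]),
    ofReal_integral_eq_lintegral_ofReal (integrableOn_symCorr hs ht hk)]
  · refine setLIntegral_congr_fun measurableSet_Ioo fun r hr => ?_
    rw [corr_add_corr_eparab hs ht hr.1, ENNReal.ofReal_mul (hk0 r hr)]
  · filter_upwards [ae_restrict_mem measurableSet_Ioo] with r hr
    have hr2 : 0 < r ^ 2 := by have := hr.1; positivity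
    exact mul_nonneg (hk0 r hr) (add_nonneg (parCorr_nonneg hs ht hr2) (parCorr_nonneg ht hs hr2))

lemma integrableOn_evenK_Ioo : IntegrableOn evenK (Ioo 0 1) :=
  integrableOn_evenK.mono_set Ioo_subset_Ioc_self

lemma muBar_pos : 0 < muBar := by
  unfold muBar
  have := Real.pi_gt_three
  nlinarith

lemma muBar_lt_one : muBar < 1 := by
  unfold muBar
  have := Real.pi_lt_d2
  have := Real.pi_pos
  nlinarith

/-- Supplies a point of `(0, 1)` where `evenK` does not exceed its weighted mean. -/
lemma evenK_le_muBar : evenK (1 / 4) ≤ muBar := by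
  have h := ell_upper (show (0 : ℝ) ≤ 1 / 4 by norm_num) (by norm_num)
  have h2 : muBar ≥ 1 / 2 := by
    unfold muBar
    have := Real.pi_gt_three
    nlinarith
  unfold evenK
  norm_num at h ⊢
  linarith

/-- Chebyshev's inequality for the weight `3 - r²`: `evenK` increases, `q = symCorr / (3 - r²)`
decreases, and `muBar` is the weighted mean of `evenK`. -/
lemma integral_evenK_symCorr_le {s t : ℝ} (hs : 0 < s) (hst : s ≤ t) :
    ∫ r in Ioo 0 1, evenK r * symCorr s t (r ^ 2) ≤
      muBar * ∫ r in Ioo 0 1, symCorr s t (r ^ 2) := by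
  have ht := hs.trans_le hst
  set q : ℝ → ℝ := fun r => symCorr s t (r ^ 2) / (3 - r ^ 2) with hq
  have hden : ∀ r ∈ Ioo (0 : ℝ) 1, 0 < 3 - r ^ 2 := fun r hr => by nlinarith [hr.1, hr.2]
  have hanti : ∀ r ∈ Ioo (0 : ℝ) 1, ∀ p ∈ Ioo (0 : ℝ) 1, r ≤ p → q p ≤ q r := fun r hr p hp h =>
    antitoneOn_symCorr_div hs hst ⟨pow_pos hr.1 2, pow_le_one₀ hr.1.le hr.2.le⟩
      ⟨pow_pos hp.1 2, pow_le_one₀ hp.1.le hp.2.le⟩ (pow_le_pow_left₀ hr.1.le h 2)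
  have hq0 : ∀ r ∈ Ioo (0 : ℝ) 1, 0 ≤ q r := fun r hr =>
    div_nonneg (add_nonneg (parCorr_nonneg hs ht (pow_pos hr.1 2))
      (parCorr_nonneg ht hs (pow_pos hr.1 2))) (hden r hr).le
  set Z := q '' {r | r ∈ Ioo (0 : ℝ) 1 ∧ evenK r ≤ muBar} with hZ
  have hZb : BddBelow Z := ⟨0, by rintro _ ⟨r, hr, rfl⟩; exact hq0 r hr.1⟩
  have hZn : Z.Nonempty := ⟨_, 1 / 4, ⟨by norm_num, evenK_le_muBar⟩, rfl⟩
  -- A threshold value of `q` at the crossing of `evenK` with `muBar`; it makes `(evenK - muBar)(q -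
  -- c) ≤ 0` everywhere without locating the crossing. The terms with `c` then integrate to 0.
  set c := sInf Z
  have hcross : ∀ r ∈ Ioo (0 : ℝ) 1, (evenK r - muBar) * (q r - c) ≤ 0 := fun r hr => by
    rcases le_or_gt (evenK r) muBar with h | h
    · exact mul_nonpos_of_nonpos_of_nonneg (by linarith)
        (sub_nonneg.2 (csInf_le hZb ⟨r, ⟨hr, h⟩, rfl⟩))
    · refine mul_nonpos_of_nonneg_of_nonpos (by linarith) (sub_nonpos.2 (le_csInf hZn ?_))
      rintro _ ⟨p, ⟨hp, hpm⟩, rfl⟩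
      refine hanti p hp r hr ?_
      by_contra! hlt
      linarith [monotoneOn_evenK hr hp hlt.le]
  have h1 : IntegrableOn (fun _ : ℝ => (1 : ℝ)) (Ioo 0 1) := integrableOn_const (by simp)
  have hi1 := integrableOn_symCorr hs ht integrableOn_evenK_Ioo
  have hi2 : IntegrableOn (fun r => symCorr s t (r ^ 2)) (Ioo 0 1) := by
    simpa using integrableOn_symCorr hs ht h1
  have hi3 : IntegrableOn (fun r => evenK r * (3 - r ^ 2)) (Ioo 0 1) := by
    have := integrableOn_symCorr one_pos one_pos integrableOn_evenK_Ioo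
    refine (this.const_mul 6).congr ?_
    filter_upwards [ae_restrict_mem measurableSet_Ioo] with r hr
    rw [symCorr_self 1 one_pos (pow_le_one₀ hr.1.le hr.2.le)]; ring
  have hi4 : IntegrableOn (fun r : ℝ => 3 - r ^ 2) (Ioo 0 1) :=
    (Continuous.integrableOn_Ioc (by fun_prop)).mono_set Ioo_subset_Ioc_self
  have hI : ∫ r in Ioo (0 : ℝ) 1, ((evenK r * symCorr s t (r ^ 2) - muBar * symCorr s t (r ^ 2)) -
      (c * (evenK r * (3 - r ^ 2)) - c * muBar * (3 - r ^ 2))) ≤ 0 := by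
    refine setIntegral_nonpos measurableSet_Ioo fun r hr => ?_
    have hd := hden r hr
    have e : symCorr s t (r ^ 2) = q r * (3 - r ^ 2) := by
      simp only [hq]; field_simp
    have := mul_nonpos_of_nonpos_of_nonneg (hcross r hr) hd.le
    rw [e]
    linarith
  have i1 : IntegrableOn (fun r => evenK r * symCorr s t (r ^ 2) - muBar * symCorr s t (r ^ 2))
      (Ioo 0 1) := hi1.sub (hi2.const_mul _)
  have i2 : IntegrableOn (fun r => c * (evenK r * (3 - r ^ 2)) - c * muBar * (3 - r ^ 2))
      (Ioo 0 1) := (hi3.const_mul _).sub (hi4.const_mul _)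
  rw [integral_sub i1 i2, integral_sub hi1 (hi2.const_mul _),
    integral_sub (hi3.const_mul _) (hi4.const_mul _), integral_const_mul, integral_const_mul,
    integral_const_mul, ← integral_Ioc_eq_integral_Ioo (f := fun r => evenK r * (3 - r ^ 2)),
    integral_evenK_parabola, ← integral_Ioc_eq_integral_Ioo (f := fun r : ℝ => 3 - r ^ 2),
    ← intervalIntegral.integral_of_le zero_le_one] at hI
  have h8 : ∫ r in (0 : ℝ)..1, (3 - r ^ 2) = 8 / 3 := by
    rw [intervalIntegral.integral_sub (by simp) (Continuous.intervalIntegrable (by fun_prop) _ _)]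
    simp [integral_pow]
    norm_num
  rw [h8] at hI
  linarith

lemma homForm_eparab_le {s t : ℝ} (hs : 0 < s) (ht : 0 < t) :
    homForm eker (eparab s) (eparab t) ≤
      ENNReal.ofReal muBar * ((∫⁻ x in Ioi 0, eparab s x) * ∫⁻ x in Ioi 0, eparab t x) := by
  have h1 : IntegrableOn (fun _ : ℝ => (1 : ℝ)) (Ioo 0 1) := integrableOn_const (by simp)
  have hA := homForm_eparab hs ht measurable_evenK integrableOn_evenK_Ioo
    (fun r hr => evenK_nonneg_of_lt hr.1 hr.2) (fun r hr => evenK_inv hr.ne')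
  have hB := homForm_eparab hs ht (k := fun _ => 1) measurable_const h1
    (fun _ _ => zero_le_one) (fun _ _ => rfl)
  simp only [ENNReal.ofReal_one, one_mul] at hB
  rw [← homForm_one (measurable_eparab s) (measurable_eparab t), hB,
    ← ENNReal.ofReal_mul muBar_pos.le]
  refine hA.le.trans (ENNReal.ofReal_le_ofReal ?_)
  rcases le_total s t with h | h
  · exact integral_evenK_symCorr_le hs h
  · simp only [symCorr_comm s t]
    exact integral_evenK_symCorr_le ht h

lemma homForm_eparab_one : homForm eker (eparab 1) (eparab 1) = ENNReal.ofReal (4 / 9 * muBar) := by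
  have hA := homForm_eparab one_pos one_pos measurable_evenK integrableOn_evenK_Ioo
    (fun r hr => evenK_nonneg_of_lt hr.1 hr.2) (fun r hr => evenK_inv hr.ne')
  refine hA.trans ?_
  congr 1
  have : ∫ r in Ioo (0 : ℝ) 1, evenK r * symCorr 1 1 (r ^ 2) =
      ∫ r in Ioo (0 : ℝ) 1, 1 / 6 * (evenK r * (3 - r ^ 2)) := by
    refine setIntegral_congr_fun measurableSet_Ioo fun r hr => ?_
    rw [symCorr_self 1 one_pos (pow_le_one₀ hr.1.le hr.2.le)]; ring
  rw [this, integral_const_mul, ← integral_Ioc_eq_integral_Ioo, integral_evenK_parabola]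
  ring

/-! ### Bilinearity and lower semicontinuity -/

section Form

lemma homForm_eq_prod {k F G : ℝ → ℝ≥0∞} (hk : Measurable k) (hF : Measurable F)
    (hG : Measurable G) : homForm k F G = ∫⁻ p, F p.1 * G p.2 * k (p.2 / p.1)
      ∂((volume.restrict (Ioi 0)).prod (volume.restrict (Ioi 0))) :=
  (lintegral_prod (fun p : ℝ × ℝ => F p.1 * G p.2 * k (p.2 / p.1))
    (Measurable.aemeasurable (by fun_prop))).symm

lemma homForm_mono {k F G F' G' : ℝ → ℝ≥0∞} (hF : ∀ x, F x ≤ F' x) (hG : ∀ x, G x ≤ G' x) :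
    homForm k F G ≤ homForm k F' G' :=
  lintegral_mono fun x => lintegral_mono fun y => by
    have := hF x; have := hG y
    gcongr

lemma homForm_sum {k : ℝ → ℝ≥0∞} (hk : Measurable k) {ι : Type*} (A : Finset ι) (w : ι → ℝ≥0∞)
    {F : ι → ℝ → ℝ≥0∞} (hF : ∀ i, Measurable (F i)) :
    homForm k (fun x => ∑ i ∈ A, w i * F i x) (fun x => ∑ i ∈ A, w i * F i x) =
      ∑ i ∈ A, ∑ j ∈ A, w i * w j * homForm k (F i) (F j) := by
  rw [homForm_eq_prod hk (by fun_prop) (by fun_prop)]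
  simp only [Finset.sum_mul]
  rw [lintegral_finsetSum _ fun i _ => by fun_prop]
  refine Finset.sum_congr rfl fun i _ => ?_
  simp only [Finset.mul_sum, Finset.sum_mul]
  rw [lintegral_finsetSum _ fun j _ => by fun_prop]
  refine Finset.sum_congr rfl fun j _ => ?_
  rw [homForm_eq_prod hk (hF i) (hF j), ← lintegral_const_mul _ (by fun_prop)]
  refine lintegral_congr fun p => ?_
  ring

lemma homForm_sum_eparab_le {ι : Type*} (A : Finset ι) (w : ι → ℝ≥0∞) {s : ι → ℝ}
    (hs : ∀ i, 0 < s i) :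
    homForm eker (fun x => ∑ i ∈ A, w i * eparab (s i) x) (fun x => ∑ i ∈ A, w i * eparab (s i) x) ≤
      ENNReal.ofReal muBar * (∫⁻ x in Ioi 0, ∑ i ∈ A, w i * eparab (s i) x) ^ 2 := by
  have hm := fun i => measurable_eparab (s i)
  rw [homForm_sum measurable_eker A w hm, lintegral_finsetSum _ fun i _ => (hm i).const_mul _, sq,
    Finset.sum_mul_sum, Finset.mul_sum]
  refine Finset.sum_le_sum fun i _ => ?_
  rw [Finset.mul_sum]
  refine Finset.sum_le_sum fun j _ => ?_
  rw [lintegral_const_mul _ (hm i), lintegral_const_mul _ (hm j)]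
  calc w i * w j * homForm eker (eparab (s i)) (eparab (s j)) ≤ w i * w j * (ENNReal.ofReal muBar *
      ((∫⁻ x in Ioi 0, eparab (s i) x) * ∫⁻ x in Ioi 0, eparab (s j) x)) := by
        gcongr; exact homForm_eparab_le (hs i) (hs j)
    _ = _ := by ring

/-- Fatou's lemma on the product space, so pointwise convergence of the mixtures is enough. -/
lemma homForm_le_of_tendsto {k : ℝ → ℝ≥0∞} (hk : Measurable k) {F : ℝ → ℝ≥0∞} {Φ : ℕ → ℝ → ℝ≥0∞}
    (hΦ : ∀ n, Measurable (Φ n)) (hF : Measurable F) (hfin : ∀ x, F x ≠ ⊤)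
    (hlim : ∀ x, Tendsto (fun n => Φ n x) atTop (𝓝 (F x))) (hkf : ∀ r, k r ≠ ⊤) {C : ℝ≥0∞}
    (hC : ∀ᶠ n in atTop, homForm k (Φ n) (Φ n) ≤ C) : homForm k F F ≤ C := by
  rw [homForm_eq_prod hk hF hF]
  have h : ∀ p : ℝ × ℝ, F p.1 * F p.2 * k (p.2 / p.1) =
      liminf (fun n => Φ n p.1 * Φ n p.2 * k (p.2 / p.1)) atTop := fun p => by
    refine (Tendsto.liminf_eq ?_).symm
    refine ENNReal.Tendsto.mul_const (ENNReal.Tendsto.mul (hlim _) (Or.inr (hfin _)) (hlim _)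
      (Or.inr (hfin _))) (Or.inr (hkf _))
  simp only [h]
  refine (lintegral_liminf_le fun n => by have := hΦ n; fun_prop).trans ?_
  simp only [← homForm_eq_prod hk (hΦ _) (hΦ _)]
  refine liminf_le_of_frequently_le' ?_
  exact hC.frequently

end Form

/-! ### Convex functions as limits of mixtures of parabolas -/

section Mixture

lemma sum_sub_mul_eq (d m : ℕ → ℝ) (N : ℕ) :
    ∑ j ∈ Finset.range N, (d j - d (j + 1)) * m (j + 1) =
      ∑ j ∈ Finset.range N, d j * (m (j + 1) - m j) + d 0 * m 0 - d N * m N := by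
  induction N with
  | zero => simp
  | succ N ih => rw [Finset.sum_range_succ, ih, Finset.sum_range_succ]; ring

variable {v : ℕ → ℝ} {σ : ℝ}

/-- The hinge function `(k - σ)₊`. -/
def hinge (σ : ℝ) (k : ℕ) : ℝ := max (k - σ) 0

lemma hinge_step_nonneg (σ : ℝ) (k : ℕ) : 0 ≤ hinge σ (k + 1) - hinge σ k := by
  unfold hinge
  push_cast
  exact sub_nonneg.2 (max_le_max_right _ (by linarith))

lemma hinge_step_le (σ : ℝ) (k : ℕ) : hinge σ (k + 1) - hinge σ k ≤ 1 := by
  unfold hinge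
  push_cast
  have h1 := le_max_left ((k : ℝ) - σ) 0
  have h2 := le_max_right ((k : ℝ) - σ) 0
  have : max ((k : ℝ) + 1 - σ) 0 ≤ max ((k : ℝ) - σ) 0 + 1 := max_le (by linarith) (by linarith)
  linarith

/-- Steps of the hinge are 0 up to `⌊σ⌋` and at most 1 afterwards, so the sum is dominated by a
telescoping one. -/
lemma sum_hinge_le (hv : Antitone v) (hσ : 0 ≤ σ) (N : ℕ) :
    ∑ j ∈ Finset.range N, (v j - v (j + 1)) * (hinge σ (j + 1) - hinge σ j) + v (max N ⌊σ⌋₊) ≤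
      v ⌊σ⌋₊ := by
  induction N with
  | zero => simp
  | succ N ih =>
    rw [Finset.sum_range_succ]
    rcases le_or_gt (N + 1) ⌊σ⌋₊ with h | h
    · have h1 : ((N : ℝ) + 1) ≤ σ := by exact_mod_cast (Nat.cast_le.2 h).trans (Nat.floor_le hσ)
      have h2 : hinge σ (N + 1) = 0 := max_eq_right (by push_cast; linarith)
      have h3 : hinge σ N = 0 := max_eq_right (by linarith)
      rw [max_eq_right h]
      rw [max_eq_right (by omega)] at ih
      rw [h2, h3]
      linarith
    · rw [max_eq_left h.le]
      rw [max_eq_left (by omega)] at ih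
      have h1 := hinge_step_le σ N
      have h2 : 0 ≤ v N - v (N + 1) := sub_nonneg.2 (hv (Nat.le_succ N))
      nlinarith

lemma le_sum_hinge (hv : Antitone v) (N : ℕ) :
    v ⌈σ⌉₊ - v N ≤ ∑ j ∈ Finset.range N, (v j - v (j + 1)) * (hinge σ (j + 1) - hinge σ j) := by
  have hd : ∀ j, 0 ≤ v j - v (j + 1) := fun j => sub_nonneg.2 (hv (Nat.le_succ j))
  induction N with
  | zero => simpa using hv (Nat.zero_le _)
  | succ N ih =>
    rcases le_or_gt ⌈σ⌉₊ N with h | h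
    · rw [Finset.sum_range_succ]
      have h1 : σ ≤ N := (Nat.le_ceil σ).trans (Nat.cast_le.2 h)
      have h2 : hinge σ (N + 1) - hinge σ N = 1 := by
        unfold hinge
        push_cast
        rw [max_eq_left (by linarith), max_eq_left (by linarith)]; ring
      rw [h2]; linarith
    · have h1 : v ⌈σ⌉₊ - v (N + 1) ≤ 0 := sub_nonpos.2 (hv h)
      exact h1.trans (Finset.sum_nonneg fun j _ => mul_nonneg (hd j) (hinge_step_nonneg σ j))

lemma mul_last_step_le (hc : ∀ j, v (j + 1) - v (j + 2) ≤ v j - v (j + 1)) (m N : ℕ) :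
    N * (v (m + N) - v (m + N + 1)) ≤ v m - v (m + N) := by
  have hanti : Antitone fun j => v j - v (j + 1) := antitone_nat_of_succ_le hc
  induction N with
  | zero => simp
  | succ N ih =>
    have h1 : v (m + N + 1) - v (m + N + 1 + 1) ≤ v (m + N) - v (m + N + 1) :=
      hanti (Nat.le_succ (m + N))
    have h2 : (N : ℝ) * (v (m + N + 1) - v (m + N + 1 + 1)) ≤ N * (v (m + N) - v (m + N + 1)) := by
      gcongr
    rw [← add_assoc]
    push_cast
    linarith

/-- Summation by parts reduces second differences of `v` against hinges to the previous sums plus a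
boundary term. Running to `2M` controls that term: convexity gives `M` times the last step at most
`v M - v (2M)`. -/
lemma mixture_bounds (hv : Antitone v) (h0 : ∀ j, 0 ≤ v j)
    (hc : ∀ j, v (j + 1) - v (j + 2) ≤ v j - v (j + 1)) (hσ : 0 ≤ σ) (M : ℕ) :
    v ⌈σ⌉₊ - 3 * v M ≤ ∑ j ∈ Finset.range (2 * M), ((v j - v (j + 1)) - (v (j + 1) - v (j + 2))) *
      hinge σ (j + 1) ∧
    ∑ j ∈ Finset.range (2 * M), ((v j - v (j + 1)) - (v (j + 1) - v (j + 2))) *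
      hinge σ (j + 1) ≤ v ⌊σ⌋₊ := by
  have hab := sum_sub_mul_eq (fun j => v j - v (j + 1)) (hinge σ) (2 * M)
  have hh0 : hinge σ 0 = 0 := max_eq_right (by simpa using hσ)
  have hd : 0 ≤ v (2 * M) - v (2 * M + 1) := sub_nonneg.2 (hv (Nat.le_succ _))
  have hh1 : 0 ≤ hinge σ (2 * M) := le_max_right _ _
  have hh2 : hinge σ (2 * M) ≤ 2 * M := max_le (by push_cast; linarith) (by positivity)
  simp only [hh0, mul_zero, add_zero, add_assoc, Nat.reduceAdd] at hab
  rw [hab]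
  constructor
  · have h1 := le_sum_hinge (σ := σ) hv (2 * M)
    have h2 := mul_last_step_le hc M M
    rw [← two_mul] at h2
    have h3 : v (2 * M) ≤ v M := hv (by omega)
    have h4 := h0 (2 * M)
    have h5 : (v (2 * M) - v (2 * M + 1)) * hinge σ (2 * M) ≤
        (v (2 * M) - v (2 * M + 1)) * (2 * M) := by gcongr
    linarith
  · have h1 := sum_hinge_le hv hσ (2 * M)
    have h2 := h0 (max (2 * M) ⌊σ⌋₊)
    have h3 := mul_nonneg hd hh1
    linarith

end Mixture

/-! ### Bounds on the energy -/

section Bounds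

variable {f : ℝ → ℝ}

lemma MemD.measurable_ofReal (hf : MemD f) : Measurable fun x => ENNReal.ofReal (f x) :=
  hf.continuous.measurable.ennreal_ofReal

lemma MemD.ofReal_energy (hf : MemD f) (hi : IntegrableOn f (Ioi 0)) :
    ENNReal.ofReal (energy f) =
      homForm eker (fun x => ENNReal.ofReal (f x)) (fun x => ENNReal.ofReal (f x)) := by
  have hint : IntegrableOn (fun x => f x * evenPot f x) (Ioi 0) := by
    simp only [mul_comm (f _)]
    exact integrable_mul_of_bound hi
      (measurable_evenPot hf.continuous.measurable).aestronglyMeasurable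
      fun x hx => hf.abs_evenPot_le hi hx
  rw [energy, ofReal_integral_eq_lintegral_ofReal hint]
  · refine setLIntegral_congr_fun measurableSet_Ioi fun x hx => ?_
    simp only [mul_assoc]
    rw [ENNReal.ofReal_mul (hf.nonneg x), evenPot,
      ofReal_integral_eq_lintegral_ofReal (hf.integrableOn_mul_evenK hi hx),
      ← lintegral_const_mul]
    · refine lintegral_congr fun y => ?_
      rw [ENNReal.ofReal_mul (hf.nonneg y), eker]
    · have := measurable_evenK
      have := hf.continuous.measurable
      fun_prop
    · filter_upwards [ae_ne_pos x] with y hy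
      exact mul_nonneg (hf.nonneg y) (evenK_div_nonneg hx hy.1 hy.2)
  · filter_upwards [ae_pos] with x hx using mul_nonneg (hf.nonneg x) (hf.evenPot_nonneg hx)

lemma MemD.energy_nonneg (hf : MemD f) : 0 ≤ energy f :=
  setIntegral_nonneg measurableSet_Ioi fun x hx => mul_nonneg (hf.nonneg x) (hf.evenPot_nonneg hx)

/-- The form is monotone and `f` dominates the unit parabola, whose energy is `muBar (2/3)²`. -/
lemma MemD.le_energy (hf : MemD f) (hi : IntegrableOn f (Ioi 0)) : 4 / 9 * muBar ≤ energy f := by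
  rw [← ENNReal.ofReal_le_ofReal_iff hf.energy_nonneg, hf.ofReal_energy hi, ← homForm_eparab_one]
  have h : ∀ x, eparab 1 x ≤ ENNReal.ofReal (f x) := fun x =>
    ENNReal.ofReal_le_ofReal (hf.parabola_le x)
  exact homForm_mono h h

/-- The values of `s ↦ f(√s)` on a shifted uniform grid. -/
def gridVal (f : ℝ → ℝ) (n : ℝ) (j : ℕ) : ℝ := f (Real.sqrt ((j + 1) / n))

lemma MemD.gridVal_antitone (hf : MemD f) {n : ℝ} (hn : 0 < n) : Antitone (gridVal f n) :=
  fun i j h => hf.anti (Real.sqrt_nonneg _) (Real.sqrt_le_sqrt (by gcongr))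

lemma MemD.gridVal_convex (hf : MemD f) {n : ℝ} (hn : 0 < n) (j : ℕ) :
    gridVal f n (j + 1) - gridVal f n (j + 2) ≤ gridVal f n j - gridVal f n (j + 1) := by
  have h := hf.convexOn.slope_mono_adjacent (x := ((j : ℝ) + 1) / n) (y := ((j : ℝ) + 1 + 1) / n)
    (z := ((j : ℝ) + 2 + 1) / n) (mem_Ici.2 (by positivity)) (mem_Ici.2 (by positivity))
    (by gcongr; linarith) (by gcongr; linarith)
  have e1 : ((j : ℝ) + 1 + 1) / n - ((j : ℝ) + 1) / n = 1 / n := by ring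
  have e2 : ((j : ℝ) + 2 + 1) / n - ((j : ℝ) + 1 + 1) / n = 1 / n := by ring
  rw [e1, e2, div_le_div_iff_of_pos_right (by positivity)] at h
  unfold gridVal
  push_cast
  linarith

/-- The weights of the approximating mixture of parabolas. -/
def mixWeight (f : ℝ → ℝ) (n : ℝ) (j : ℕ) : ℝ :=
  (gridVal f n j - gridVal f n (j + 1)) - (gridVal f n (j + 1) - gridVal f n (j + 2))

/-- Finite mixtures of parabolas approximating `f` from below. -/
def mixture (f : ℝ → ℝ) (n : ℕ) (x : ℝ) : ENNReal :=
  ∑ j ∈ Finset.range (2 * (n + 1) ^ 2),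
    ENNReal.ofReal ((n + 1) * mixWeight f (n + 1) j) * eparab ((j + 1) / (n + 1)) x

lemma MemD.mixture_eq (hf : MemD f) (n : ℕ) (x : ℝ) :
    mixture f n x = ENNReal.ofReal (∑ j ∈ Finset.range (2 * (n + 1) ^ 2),
      mixWeight f (n + 1) j * hinge ((n + 1) * x ^ 2) (j + 1)) := by
  have hn : (0 : ℝ) < n + 1 := by positivity
  have hw : ∀ j, 0 ≤ mixWeight f (n + 1) j := fun j => sub_nonneg.2 (hf.gridVal_convex hn j)
  have hh : ∀ j, 0 ≤ hinge ((n + 1) * x ^ 2) (j + 1) := fun j => le_max_right _ _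
  rw [ENNReal.ofReal_sum_of_nonneg fun j _ => mul_nonneg (hw j) (hh j), mixture]
  refine Finset.sum_congr rfl fun j _ => ?_
  rw [eparab, ← ENNReal.ofReal_mul (mul_nonneg hn.le (hw j))]
  congr 1
  have h : hinge ((n + 1) * x ^ 2) (j + 1) = (n + 1) * parab ((j + 1) / (n + 1)) x := by
    rw [hinge, parab, mul_max_of_nonneg _ _ hn.le, mul_zero]
    congr 1
    push_cast
    field_simp
  rw [h]; ring

lemma MemD.map_sqrt_sq (hf : MemD f) (x : ℝ) : f (Real.sqrt (x ^ 2)) = f x := by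
  rw [Real.sqrt_sq_eq_abs]
  rcases abs_choice x with h | h <;> rw [h]
  exact hf.even x

/-- The shift by one in `gridVal` keeps the mixture below `f`, since `⌊σ⌋ + 1 > σ`. The choice `M =
(n + 1)²` sends the grid to infinity, so the truncation error is at most `3 f(√(n + 1))`. -/
lemma MemD.mixture_bounds (hf : MemD f) (n : ℕ) (x : ℝ) :
    f (Real.sqrt (x ^ 2 + 2 / (n + 1))) - 3 * f (Real.sqrt (n + 1)) ≤
      ∑ j ∈ Finset.range (2 * (n + 1) ^ 2), mixWeight f (n + 1) j * hinge ((n + 1) * x ^ 2) (j + 1) ∧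
    ∑ j ∈ Finset.range (2 * (n + 1) ^ 2), mixWeight f (n + 1) j * hinge ((n + 1) * x ^ 2) (j + 1) ≤
      f x := by
  have hn : (0 : ℝ) < n + 1 := by positivity
  set σ : ℝ := (n + 1) * x ^ 2 with hσ
  have hσ0 : 0 ≤ σ := by positivity
  obtain ⟨h1, h2⟩ := GCLM.mixture_bounds (hf.gridVal_antitone hn) (fun j => hf.nonneg _)
    (hf.gridVal_convex hn) hσ0 ((n + 1) ^ 2)
  constructor
  · refine le_trans (sub_le_sub (hf.anti (Real.sqrt_nonneg _) (Real.sqrt_le_sqrt ?_))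
      (mul_le_mul_of_nonneg_left (hf.anti (Real.sqrt_nonneg _) (Real.sqrt_le_sqrt ?_))
      (by norm_num))) h1
    · rw [div_le_iff₀ hn]
      have := (Nat.ceil_lt_add_one hσ0).le
      have e : (x ^ 2 + 2 / ((n : ℝ) + 1)) * (n + 1) = σ + 2 := by rw [hσ]; field_simp
      rw [e]; linarith
    · rw [le_div_iff₀ hn]
      push_cast
      nlinarith
  · refine h2.trans ?_
    rw [← hf.map_sqrt_sq x]
    refine hf.anti (Real.sqrt_nonneg _) (Real.sqrt_le_sqrt ?_)
    rw [le_div_iff₀ hn, mul_comm]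
    exact (Nat.lt_floor_add_one σ).le

lemma MemD.tendsto_mixture (hf : MemD f) (h0 : Tendsto f atTop (𝓝 0)) (x : ℝ) :
    Tendsto (fun n => mixture f n x) atTop (𝓝 (ENNReal.ofReal (f x))) := by
  simp only [hf.mixture_eq]
  refine ENNReal.tendsto_ofReal ?_
  have hn : Tendsto (fun n : ℕ => (n : ℝ) + 1) atTop atTop :=
    tendsto_atTop_add_const_right _ _ tendsto_natCast_atTop_atTop
  have h1 : Tendsto (fun n : ℕ => f (Real.sqrt (x ^ 2 + 2 / ((n : ℝ) + 1)))) atTop (𝓝 (f x)) := by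
    have h2 : Tendsto (fun n : ℕ => x ^ 2 + 2 / ((n : ℝ) + 1)) atTop (𝓝 (x ^ 2 + 0)) :=
      (tendsto_const_nhds.div_atTop hn).const_add _
    rw [add_zero] at h2
    have h3 := ((hf.continuous.comp Real.continuous_sqrt).tendsto (x ^ 2)).comp h2
    simp only [Function.comp_def, hf.map_sqrt_sq] at h3
    exact h3
  have h2 := h1.sub ((h0.comp (Real.tendsto_sqrt_atTop.comp hn)).const_mul 3)
  rw [mul_zero, sub_zero] at h2
  exact tendsto_of_tendsto_of_tendsto_of_le_of_le h2 tendsto_const_nhds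
    (fun n => (hf.mixture_bounds n x).1) (fun n => (hf.mixture_bounds n x).2)

/-- Each mixture satisfies the bound by bilinearity and has integral at most that of `f`; Fatou
passes it to `f`. -/
lemma MemD.energy_le (hf : MemD f) (hi : IntegrableOn f (Ioi 0)) :
    energy f ≤ muBar * (∫ x in Ioi 0, f x) ^ 2 := by
  have hI : 0 ≤ ∫ x in Ioi 0, f x := integral_nonneg hf.nonneg
  rw [← ENNReal.ofReal_le_ofReal_iff (mul_nonneg muBar_pos.le (sq_nonneg _)), hf.ofReal_energy hi]
  have hm : ∀ n, Measurable (mixture f n) := fun n => by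
    have := measurable_eparab
    unfold mixture; fun_prop
  refine homForm_le_of_tendsto measurable_eker hm hf.measurable_ofReal (fun x => ENNReal.ofReal_ne_top)
    (hf.tendsto_mixture (hf.tendsto_zero_of_integrableOn hi)) (fun r => ENNReal.ofReal_ne_top)
    (Eventually.of_forall fun n => ?_)
  refine (homForm_sum_eparab_le (Finset.range (2 * (n + 1) ^ 2))
    (fun j => ENNReal.ofReal ((n + 1) * mixWeight f (n + 1) j)) (s := fun j => (j + 1) / (n + 1))
    fun j => by positivity).trans ?_
  rw [ENNReal.ofReal_mul muBar_pos.le, ENNReal.ofReal_pow hI,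
    ofReal_integral_eq_lintegral_ofReal hi (Eventually.of_forall hf.nonneg)]
  gcongr with x
  exact (hf.mixture_eq n x).trans_le (ENNReal.ofReal_le_ofReal (hf.mixture_bounds n x).2)

lemma MemD.c_le (hf : MemD f) : c f ≤ 4 / Real.pi := by
  have h1 : ∫ y in Ioi (0 : ℝ), (f 0 - f y) / y ^ 2 ≤ 2 := by
    have hi := hf.integrableOn_c
    rw [← Ioc_union_Ioi_eq_Ioi (zero_le_one' ℝ)] at hi ⊢
    rw [setIntegral_union Ioc_disjoint_Ioi_same measurableSet_Ioi hi.left_of_union hi.right_of_union]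
    have h2 : ∫ y in Ioc (0 : ℝ) 1, (f 0 - f y) / y ^ 2 ≤ ∫ y in Ioc (0 : ℝ) 1, (1 : ℝ) := by
      refine setIntegral_mono_on hi.left_of_union (integrableOn_const (by simp)) measurableSet_Ioc
        fun y hy => ?_
      have := hy.1
      rw [hf.map_zero, div_le_one (by positivity)]
      linarith [(le_max_left _ _).trans (hf.parabola_le y)]
    have h3 : ∫ y in Ioi (1 : ℝ), (f 0 - f y) / y ^ 2 ≤ ∫ y in Ioi (1 : ℝ), y ^ (-2 : ℝ) := by
      refine setIntegral_mono_on hi.right_of_union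
        (integrableOn_Ioi_rpow_of_lt (by norm_num) one_pos) measurableSet_Ioi fun y hy => ?_
      have hy0 : 0 < y := zero_lt_one.trans hy
      rw [Real.rpow_neg hy0.le, div_eq_mul_inv, hf.map_zero]
      norm_cast
      exact mul_le_of_le_one_left (by positivity) (by linarith [hf.nonneg y])
    rw [integral_Ioi_rpow_of_lt (by norm_num) one_pos] at h3
    norm_num at h2 h3
    linarith
  unfold c
  calc 2 / Real.pi * ∫ y in Ioi (0 : ℝ), (f 0 - f y) / y ^ 2 ≤ 2 / Real.pi * 2 := by gcongr
    _ = _ := by ring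

lemma MemD.integral_pos (hf : MemD f) (hi : IntegrableOn f (Ioi 0)) : 0 < ∫ x in Ioi 0, f x := by
  have h := mul_le_integral_of_antitoneOn hf.antitoneOn_Ioi (fun y _ => hf.nonneg y) hi
    (show (0 : ℝ) < 1 / 2 by norm_num)
  have := (le_max_left _ _).trans (hf.parabola_le (1 / 2))
  linarith

end Bounds

end GCLM
end

/-! ### Assembly of the theorem -/

theorem mainTheorem4 (a : ℝ) (ha : a ≤ 1) (f : ℝ → ℝ) (hf : f ∈ GCLM.setD)
    (hfix : GCLM.R a f = f) :
    -- the quantities `b(f)`, `c(f)`, `μ(f)` are genuine (no divergent integral, no zero denominator)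
    (Tendsto f atTop (𝓝 (GCLM.atInfty f)) ∧
      IntegrableOn (fun y => f y - GCLM.atInfty f) (Ioi 0) ∧ 0 < GCLM.b f ∧
      IntegrableOn (fun y => (f 0 - f y) / y ^ 2) (Ioi 0) ∧ 0 < GCLM.c f ∧
      DifferentiableOn ℝ (GCLM.T f) (Ioi 0) ∧
      IntegrableOn (fun x => deriv (GCLM.T f) x * (x * f x)) (Ioi 0) ∧
      0 < 1 + a * GCLM.mu f) ∧
    GCLM.b f / GCLM.c f = (1 - a / 3) / (1 + a * GCLM.mu f) ∧
    0 ≤ GCLM.mu f ∧ GCLM.mu f ≤ GCLM.muBar ∧ GCLM.muBar < 1 ∧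
    (0 ≤ a →
      GCLM.muBar / (9 * (1 - a / 3) ^ 2) ≤ GCLM.mu f ∧
      0 < GCLM.muBar / (9 * (1 - a / 3) ^ 2)) := by
  have hD : GCLM.MemD f := hf
  have hi := hD.integrableOn_of_fixed ha hfix
  obtain ⟨L, hode⟩ := hD.exists_ode ha hfix
  have hpi := Real.pi_pos
  have hinf : GCLM.atInfty f = 0 :=
    tendsto_nhds_unique hD.tendsto (hD.tendsto_zero_of_integrableOn hi)
  have hI := hD.integral_pos hi
  have hq := hD.integral_deriv_T_mul hi fun x hx h => (hode x hx h).1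
  have hid := hD.fixed_identity ha hfix
  have hE0 := hD.energy_nonneg
  have hE1 := hD.energy_le hi
  have hE2 := hD.le_energy hi
  have hc := hD.c_pos
  have hc2 := hD.c_le
  have hmb := GCLM.muBar_pos
  have hb : GCLM.b f = 2 / Real.pi * ∫ y in Ioi 0, f y := by
    rw [GCLM.b, hinf]; simp
  set I := ∫ y in Ioi 0, f y
  set E := GCLM.energy f
  have hmu : GCLM.mu f = E / I ^ 2 := by
    have hQ : GCLM.Q f = 2 / Real.pi ^ 2 * E := by
      have : E = -(Real.pi * ∫ x in Ioi 0, deriv (GCLM.T f) x * (x * f x)) := by linarith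
      rw [GCLM.Q, this]; field_simp
    rw [GCLM.mu, hQ, hb]; field_simp
  have hden : GCLM.den a f = GCLM.b f * (1 + a * GCLM.mu f) := by
    rw [hb, hmu]
    have hd : GCLM.den a f = (2 * I ^ 2 + 2 * a * E) / (Real.pi * I) := by
      rw [eq_div_iff (by positivity), ← hid]; ring
    rw [hd]; field_simp
  have hbpos : 0 < GCLM.b f := by rw [hb]; positivity
  have h1 : 0 < 1 + a * GCLM.mu f := by
    have := hD.den_pos ha
    rw [hden] at this
    exact pos_of_mul_pos_right this hbpos.le
  have hmu0 : 0 ≤ GCLM.mu f := by rw [hmu]; positivity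
  have ha3 : 0 < 1 - a / 3 := by linarith
  refine ⟨⟨hD.tendsto, ?_, hbpos, hD.integrableOn_c, hc,
    fun x hx => (hD.differentiableAt_T hx).differentiableWithinAt,
    hD.integrableOn_deriv_T_mul hi, h1⟩, ?_, hmu0, ?_, GCLM.muBar_lt_one, fun ha0 => ⟨?_, ?_⟩⟩
  · simpa [hinf] using hi
  · rw [div_eq_div_iff hc.ne' h1.ne', ← hden, GCLM.den]
  · rw [hmu, div_le_iff₀ (by positivity)]; exact hE1
  -- For `a ≥ 0`, `2I/π = b ≤ b (1 + a μ) = (1 - a/3) c ≤ (1 - a/3) · 4/π`.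
  · have h2 : I ≤ 2 * (1 - a / 3) := by
      have h3 : GCLM.b f ≤ GCLM.den a f := by
        rw [hden]
        exact le_mul_of_one_le_right hbpos.le (by have := mul_nonneg ha0 hmu0; linarith)
      have h4 : GCLM.den a f ≤ (1 - a / 3) * (4 / Real.pi) := by
        unfold GCLM.den; gcongr
      have h5 := h3.trans h4
      rw [hb, div_mul_eq_mul_div, ← mul_div_assoc, div_le_div_iff_of_pos_right hpi] at h5
      linarith
    rw [hmu, div_le_div_iff₀ (by positivity) (by positivity)]
    calc GCLM.muBar * I ^ 2 ≤ GCLM.muBar * (2 * (1 - a / 3)) ^ 2 := by gcongr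
      _ = 4 / 9 * GCLM.muBar * (9 * (1 - a / 3) ^ 2) := by ring
      _ ≤ E * (9 * (1 - a / 3) ^ 2) := by gcongr
  · positivity
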